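/- **Setting.** For a finite alphabet $\mathcal A$ with the discrete topology, a (one-sided) subshift is a closed set $X\subseteq\mathcal A^{\mathbb N}$ with $\sigma X\subseteq X$, where $\sigma$ is the left shift and $\sigma_X=\sigma|_X$. Let $\mathcal L_n(X)$ be the set of words $x_1\dots x_n$ with $x\in X$, let $\mathcal L_0(X)=\{\varepsilon\}$ ($\varepsilon$ the empty word), and let $\mathcal L(X)=\bigcup_{n\ge 0}\mathcal L_n(X)$. Let $\mathcal M(X,\sigma_X)$ be the set of $\sigma_X$-invariant Borel probability measures on $X$, and write $\mu(I)$ for the $\mu$-measure of the cylinder of a word $I$. The entropy of $\mu\in\mathcal M(X,\sigma_X)$ is $h_\mu(\sigma_X)=-\lim_n\frac1n\sum_{I\in\mathcal L_n(X)}\mu(I)\log\mu(I)$. For an integer $p\ge 0$, $\mathcal D_w(X,p)$ is the set of $\phi:\mathcal L(X)\to[0,\infty)$ with $\phi(I)>0$ for at least one $I\ne\varepsilon$, for which there is $c\in(0,1]$ such that (1) $\phi(IJ)\le c^{-1}\phi(I)\phi(J)$ whenever $IJ\in\mathcal L(X)$, and (2) for all $I,J\in\mathcal L(X)$ there is $K\in\bigcup_{i=0}^p\mathcal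 L_i(X)$ with $IKJ\in\mathcal L(X)$ and $\phi(IKJ)\ge c\,\phi(I)\phi(J)$. $\mathcal D(X,p)$ is defined in the same way, with $K\in\mathcal L_p(X)$ in (2). Let $k\ge 2$, let $X_1,\dots,X_k$ be subshifts over finite alphabets, and let $\pi_i:X_i\to X_{i+1}$ $(1\le i\le k-1)$ be surjective one-block maps, i.e. $\pi_i$ applies a map between the alphabets letter by letter; $\pi_i$ acts on words in the same way. Let $\tau_0=\mathrm{id}$ and $\tau_i=\pi_i\circ\dots\circ\pi_1$. Let $\mathbf a=(a_1,\dots,a_k)\in\mathbb R^k$ with $a_1>0$ and $a_i\ge 0$ for $i\ge2$, and put $s_i=a_1+\dots+a_i$. For $\phi\in\mathcal D_w(X_1,p)$ let $\Phi=(\log\phi_n)_{n\ge1}$ with $\phi_n(x)=\phi(x_1\dots x_n)$ be the sub-additive potential generated by $\phi$, and for $\mu\in\mathcal M(X_1,\sigma_{X_1})$ let $\Phi_*(\mu)=\lim_n\frac1n\int\log\phi_n\,d\mu\in[-\infty,\infty)$. An $\mathbf a$-weighted equilibrium state of $\Phi$ is a $\mu\in\mathcal M(X_1,\sigma_{X_1})$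 that attains $$\sup_{\eta\in\mathcal M(X_1,\sigma_{X_1})}\Big(\Phi_*(\eta)+\sum_{i=1}^k a_i\,h_{\eta\circ\tau_{i-1}^{-1}}(\sigma_{X_i})\Big).$$ Put $\phi^{(1)}=\phi$ and, for $2\le i\le k$ and $J\in\mathcal L_n(X_i)$, $n\ge 0$, $$\phi^{(i)}(J)=\Big(\sum_{I\in\mathcal L_n(X_{i-1}):\,\pi_{i-1}I=J}\phi^{(i-1)}(I)^{1/s_{i-1}}\Big)^{s_{i-1}},\qquad \phi^{(k+1)}(n)=\sum_{I\in\mathcal L_n(X_k)}\phi^{(k)}(I)^{1/s_k}.$$ For $I\in\mathcal L_n(X_1)$, $n\ge 0$, put (with $0/0=0$) $$\widetilde\phi(I)=\Big(\prod_{i=1}^{k-1}\frac{\phi^{(i)}(\tau_{i-1}I)^{1/s_i}}{\phi^{(i+1)}(\tau_iI)^{1/s_i}}\Big)\cdot\frac{\phi^{(k)}(\tau_{k-1}I)^{1/s_k}}{\phi^{(k+1)}(n)},\qquad \widetilde\phi^*(I)=\sup_{m,n\ge0}\ \sum_{\substack{I_1\in\mathcal L_m(X_1),\,I_2\in\mathcal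 L_n(X_1)\\ I_1II_2\in\mathcal L(X_1)}}\widetilde\phi(I_1II_2).$$ **Theorem 7.1.** Let $\phi\in\mathcal D_w(X_1,p)$. Then $\Phi$ has a unique $\mathbf a$-weighted equilibrium state $\mu$. The measure $\mu$ is ergodic and has the following properties. (i) There are constants $C,c>0$ such that $C^{-1}\widetilde\phi^*(I)\le\mu(I)\le C\,\widetilde\phi^*(I)$ and $\widetilde\phi^*(I)\ge c\,\widetilde\phi(I)$ for all $I\in\mathcal L(X_1)$. (ii) There is $c>0$ such that $\liminf_{n\to\infty}\sum_{i=0}^p\mu\big(A\cap\sigma_{X_1}^{-n-i}(B)\big)\ge c\,\mu(A)\mu(B)$ for all Borel sets $A,B\subseteq X_1$. (iii) If $\mu(I)>0$ then $\phi(I)>0$ and $\widetilde\phi(I)>0$, the number $\Phi_*(\mu)$ is finite, and, with the convention $0\log0=0$ and with errors bounded uniformly in $n$, $$\sum_{I\in\mathcal L_n(X_1)}\mu(I)\log\mu(I)=\sum_{I\in\mathcal L_n(X_1)}\mu(I)\log\widetilde\phi(I)+O(1)=-n\,h_\mu(\sigma_{X_1})+O(1),$$ $$\sum_{I\in\mathcal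 L_n(X_1)}\mu(I)\log\phi(I)=n\,\Phi_*(\mu)+O(1).$$ (iv) If moreover $\phi\in\mathcal D(X_1,p)$, then there is $c>0$ such that $\liminf_{n\to\infty}\mu\big(A\cap\sigma_{X_1}^{-n}(B)\big)\ge c\,\mu(A)\mu(B)$ for all Borel sets $A,B\subseteq X_1$. -/

import Mathlib

open MeasureTheory Filter SymbolicDynamics.FullShift
open scoped NNReal ENNReal

noncomputable section

namespace FactorSubshift

section OneSubshift

variable {A : Type*}

/-- The left shift `σ` on one-sided sequences, `(σ x) n = x (1 + n)`. -/
abbrev leftShift : (ℕ → A) → (ℕ → A) := shift (1 : ℕ)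

/-- The word formed by the first `n` letters of the sequence `x`. -/
def word (x : ℕ → A) (n : ℕ) : List A := List.ofFn fun j : Fin n => x j

/-- The cylinder `[I]`: all sequences that begin with the word `I`. -/
def cyl (I : List A) : Set (ℕ → A) := {x | word x I.length = I}

variable [TopologicalSpace A]

/-- The language `𝓛(X)`: the empty word and all initial words of points of `X`. As `X` is
shift-invariant, these are all the words that occur anywhere in points of `X`. -/
def lang (X : Subshift A ℕ) : Set (List A) :=
  {I | I = [] ∨ ∃ x ∈ X.carrier, word x I.length = I}

/-- The finite set `𝓛ₙ(X)` of the words of length `n` in the language. -/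
def langN [Finite A] (X : Subshift A ℕ) (n : ℕ) : Finset (List A) :=
  ((List.finite_length_eq A n).subset
    (fun _ h => h.2 : {I | I ∈ lang X ∧ I.length = n} ⊆ {I | I.length = n})).toFinset

/-- The class `𝓓_w(X, p)` of weights on the language of `X`. A weight is given as a function on all
words, but only its values on `𝓛(X)` are used. -/
def MemDw (X : Subshift A ℕ) (p : ℕ) (φ : List A → ℝ≥0) : Prop :=
  (∃ I ∈ lang X, I ≠ [] ∧ 0 < φ I) ∧
  ∃ c : ℝ≥0, 0 < c ∧ c ≤ 1 ∧
    (∀ I J, I ++ J ∈ lang X → φ (I ++ J) ≤ c⁻¹ * φ I * φ J) ∧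
    (∀ I ∈ lang X, ∀ J ∈ lang X, ∃ K ∈ lang X, K.length ≤ p ∧ I ++ K ++ J ∈ lang X ∧
      c * φ I * φ J ≤ φ (I ++ K ++ J))

/-- The class `𝓓(X, p)`: as `𝓓_w(X, p)`, with connecting words of length exactly `p`. -/
def MemD (X : Subshift A ℕ) (p : ℕ) (φ : List A → ℝ≥0) : Prop :=
  (∃ I ∈ lang X, I ≠ [] ∧ 0 < φ I) ∧
  ∃ c : ℝ≥0, 0 < c ∧ c ≤ 1 ∧
    (∀ I J, I ++ J ∈ lang X → φ (I ++ J) ≤ c⁻¹ * φ I * φ J) ∧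
    (∀ I ∈ lang X, ∀ J ∈ lang X, ∃ K ∈ lang X, K.length = p ∧ I ++ K ++ J ∈ lang X ∧
      c * φ I * φ J ≤ φ (I ++ K ++ J))

variable [MeasurableSpace A]

/-- `μ ∈ 𝓜(X, σ_X)`. A shift-invariant Borel probability measure on `X` is given as a measure on the
space of all sequences that vanishes off `X`. -/
structure InvMeasure (X : Subshift A ℕ) (μ : Measure (ℕ → A)) : Prop where
  isProb : IsProbabilityMeasure μ
  null_compl : μ X.carrierᶜ = 0
  invariant : MeasurePreserving leftShift μ μ

/-- The measure-theoretic entropy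
`h_μ(σ_X) = -lim (1/n) ∑_{I ∈ 𝓛ₙ(X)} μ(I) log μ(I)`. For invariant `μ` the sequence of the sums is
nonnegative and sub-additive in `n`, so that the limit exists and is finite, and the upper limit
written here is the limit. -/
def entropy [Finite A] (X : Subshift A ℕ) (μ : Measure (ℕ → A)) : ℝ :=
  limsup (fun n : ℕ =>
    -(∑ I ∈ langN X n, μ.real (cyl I) * Real.log (μ.real (cyl I))) / (n : ℝ)) atTop

/-- The integral `∫ g dμ = ∫ g⁺ dμ - ∫ g⁻ dμ` of an extended-real function (used for functions that
are bounded above, so that the first term is finite). -/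
def extIntegral {Ω : Type*} [MeasurableSpace Ω] (μ : Measure Ω) (g : Ω → EReal) : EReal :=
  ((∫⁻ x, (g x).toENNReal ∂μ : ℝ≥0∞) : EReal) - ((∫⁻ x, (-g x).toENNReal ∂μ : ℝ≥0∞) : EReal)

/-- `Φ_*(μ) = lim (1/n) ∫ log φ(x₁…xₙ) dμ(x)`, in `[-∞, ∞)`, for the potential `Φ` generated by `φ`,
with `log 0 = -∞`. For sub-multiplicative `φ` and invariant `μ` the limit exists by sub-additivity,
and the upper limit written here is the limit. -/
def PhiStar (φ : List A → ℝ≥0) (μ : Measure (ℕ → A)) : EReal :=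
  limsup (fun n : ℕ =>
    extIntegral μ (fun x => ENNReal.log (φ (word x n) : ℝ≥0∞)) / (n : EReal)) atTop

end OneSubshift

section Star

open Classical in
/-- `ψ*(I) = sup_{m,n ≥ 0} ∑ ψ(I₁ I I₂)` over `I₁ ∈ 𝓛ₘ(X)`, `I₂ ∈ 𝓛ₙ(X)` with `I₁ I I₂ ∈ 𝓛(X)`. -/
def starSup {A : Type*} [TopologicalSpace A] [Finite A] (X : Subshift A ℕ) (ψ : List A → ℝ≥0)
    (I : List A) : ℝ≥0∞ :=
  ⨆ (m : ℕ) (n : ℕ),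
    ∑ P ∈ (langN X m ×ˢ langN X n).filter (fun P => P.1 ++ I ++ P.2 ∈ lang X),
      (ψ (P.1 ++ I ++ P.2) : ℝ≥0∞)

end Star

section Tower

/-! A tower of `k = m + 1` levels. The index `i : Fin (m + 1)` stands for the level `i + 1`; the
letter map `π i` goes from the alphabet of the level `i.castSucc` to that of `i.succ`. -/

variable {m : ℕ} {A : Fin (m + 1) → Type*}

/-- The composed letter map from the first level to the level `i` (the identity for `i = 0`). -/
def tau (π : (i : Fin m) → A i.castSucc → A i.succ) (i : Fin (m + 1)) : A 0 → A i :=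
  Fin.induction (motive := fun i => A 0 → A i) id (fun i t => π i ∘ t) i

/-- The partial sum of the weights `a` over the levels up to and including `i`. -/
def psum (a : Fin (m + 1) → ℝ) (i : Fin (m + 1)) : ℝ := ∑ j ∈ Finset.Iic i, a j

variable [∀ i, TopologicalSpace (A i)]

/-- `π i` induces a one-block factor map from the subshift at `i.castSucc` onto that at `i.succ`. -/
def IsOneBlockTower (X : (i : Fin (m + 1)) → Subshift (A i) ℕ)
    (π : (i : Fin m) → A i.castSucc → A i.succ) : Prop :=
  ∀ i : Fin m,
    (fun (x : ℕ → A i.castSucc) (n : ℕ) => π i (x n)) '' (X i.castSucc).carrier = (X i.succ).carrier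

variable [∀ i, Finite (A i)]

open Classical in
/-- The weights `φ⁽ⁱ⁾` on the words of the level `i`: `φ⁽¹⁾ = φ`, and
`φ⁽ⁱ⁺¹⁾(J) = (∑_{I : πᵢ I = J} φ⁽ⁱ⁾(I) ^ (1 / s)) ^ s` with `s = a₁ + ⋯ + aᵢ`. -/
def phiLevel (X : (i : Fin (m + 1)) → Subshift (A i) ℕ)
    (π : (i : Fin m) → A i.castSucc → A i.succ) (a : Fin (m + 1) → ℝ) (φ : List (A 0) → ℝ≥0)
    (i : Fin (m + 1)) : List (A i) → ℝ≥0 :=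
  Fin.induction (motive := fun i => List (A i) → ℝ≥0) φ
    (fun i ψ J =>
      (∑ I ∈ (langN (X i.castSucc) J.length).filter (fun I => I.map (π i) = J),
        ψ I ^ (1 / psum a i.castSucc)) ^ psum a i.castSucc) i

/-- `φ⁽ᵏ⁺¹⁾(n) = ∑_{I ∈ 𝓛ₙ(X_k)} φ⁽ᵏ⁾(I) ^ (1 / (a₁ + ⋯ + a_k))`. -/
def phiTop (X : (i : Fin (m + 1)) → Subshift (A i) ℕ)
    (π : (i : Fin m) → A i.castSucc → A i.succ) (a : Fin (m + 1) → ℝ) (φ : List (A 0) → ℝ≥0)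
    (n : ℕ) : ℝ≥0 :=
  ∑ I ∈ langN (X (Fin.last m)) n, phiLevel X π a φ (Fin.last m) I ^ (1 / psum a (Fin.last m))

/-- The product formula for the weight `φ̃`. Where `φ(I) = 0` the formula reads `0 / 0` at some
places, and the value is `0`. -/
def phiTilde (X : (i : Fin (m + 1)) → Subshift (A i) ℕ)
    (π : (i : Fin m) → A i.castSucc → A i.succ) (a : Fin (m + 1) → ℝ) (φ : List (A 0) → ℝ≥0)
    (I : List (A 0)) : ℝ≥0 :=
  (∏ i : Fin m,
    phiLevel X π a φ i.castSucc (I.map (tau π i.castSucc)) ^ (1 / psum a i.castSucc) /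
      phiLevel X π a φ i.succ (I.map (tau π i.succ)) ^ (1 / psum a i.castSucc)) *
  (phiLevel X π a φ (Fin.last m) (I.map (tau π (Fin.last m))) ^ (1 / psum a (Fin.last m)) /
    phiTop X π a φ I.length)

variable [∀ i, MeasurableSpace (A i)]

/-- The image of `μ` on the level `i` under the factor map `(x n)ₙ ↦ (τ (x n))ₙ`. -/
def push (π : (i : Fin m) → A i.castSucc → A i.succ) (i : Fin (m + 1)) (μ : Measure (ℕ → A 0)) :
    Measure (ℕ → A i) :=
  μ.map fun x n => tau π i (x n)

/-- `Φ_*(μ) + ∑ᵢ aᵢ h(image of μ on the level i)`. -/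
def weightedValue (X : (i : Fin (m + 1)) → Subshift (A i) ℕ)
    (π : (i : Fin m) → A i.castSucc → A i.succ) (a : Fin (m + 1) → ℝ) (φ : List (A 0) → ℝ≥0)
    (μ : Measure (ℕ → A 0)) : EReal :=
  PhiStar φ μ + ((∑ i, a i * entropy (X i) (push π i μ) : ℝ) : EReal)

/-- `μ` is an `a`-weighted equilibrium state of the potential generated by `φ`. -/
def IsWeightedEquilibrium (X : (i : Fin (m + 1)) → Subshift (A i) ℕ)
    (π : (i : Fin m) → A i.castSucc → A i.succ) (a : Fin (m + 1) → ℝ) (φ : List (A 0) → ℝ≥0)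
    (μ : Measure (ℕ → A 0)) : Prop :=
  InvMeasure (X 0) μ ∧
    weightedValue X π a φ μ =
      ⨆ (η : Measure (ℕ → A 0)) (_ : InvMeasure (X 0) η), weightedValue X π a φ η

end Tower

end FactorSubshift

end

open MeasureTheory Filter SymbolicDynamics.FullShift
open scoped NNReal ENNReal

noncomputable section

namespace FactorSubshift

/-! ### Words, cylinders and sets determined by finitely many coordinates -/

section Words

variable {A : Type*}

/-! The weight `phiTilde` is a probability vector on the words of each length `n`: its factors are
conditional weights along the fibres of the factor maps, and the last factor is normalized by `Z n =
phiTop n`. The equilibrium state is built from these vectors, and its optimality and uniqueness are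
read off from relative entropies with respect to them.

Construction. Passing from level `i` to the next divides the product by a nonnegative power of the
weight of the new level, because `1 / s_i ≥ 1 / s_{i+1}` (`stoppedWeight_succ`). All level weights
are sub-multiplicative, so a word `K` that connects `I` and `J` for `φ` connects them for `phiTilde`
too, up to a constant (`exists_stoppedWeight_mul_le`, `connects_phiTilde`). A limit `μ` of averaged
shifts of the discrete measures with masses `phiTilde` is invariant. Connecting words show that the
mass of a pattern inside a long word can only grow, up to a constant, when the margins get longer
(`exists_wordMeasure_le_extend`). Hence `μ(I)` is comparable with `phiTilde*(I)`, and `μ` satisfies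
the mixing bounds, first on clopen sets and then by approximation on Borel sets. The mixing bound
implies ergodicity.

Variational part. For a measure `η` on `X 0`, Gibbs' inequality on each level gives gaps `D_i ≥ 0`
and `E ≥ 0`. The relative entropy of `η` with respect to `phiTilde` on words of length `n` is `∑ D_i
+ E`, while `s_k log Z n` minus the finite-time weighted value of `η` is `∑ s_i D_i + s_k E`. So the
two quantities agree up to the factors `a 0` and `s_k` (`towerValue_bounds`). Since `Z` is
multiplicative up to constants, `s_k log Z n = nP + O(1)`. By sub-additivity no invariant measure
has a weighted value above `P`, and one with value `P` has bounded relative entropies. Bounded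
relative entropies and `phiTilde ≤ const · μ` force absolute continuity with respect to the ergodic
measure `μ`, hence equality (`absolutelyContinuous_of_wordKL_le`). Conversely, a word measure has
relative entropy zero at its full length. Sub-additivity bounds the relative entropies of its inner
windows, and convexity carries the bound to `μ`. Thus `μ` attains `P`. The estimates in (iii) follow
because the summands of the weighted value are all almost sub-additive while their sum is almost
linear. -/

lemma iterate_leftShift (n : ℕ) (x : ℕ → A) (j : ℕ) : leftShift^[n] x j = x (n + j) := by
  induction n generalizing j with
  | zero => simp
  | succ n ih =>
    rw [Function.iterate_succ_apply']
    change leftShift^[n] x (1 + j) = _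
    rw [ih]
    congr 1; omega

lemma leftShift_iterate_add (m n : ℕ) (x : ℕ → A) :
    leftShift^[m] (leftShift^[n] x) = leftShift^[n + m] x := by
  rw [← Function.iterate_add_apply, add_comm]

@[simp] lemma length_word (x : ℕ → A) (n : ℕ) : (word x n).length = n := by simp [word]

@[simp] lemma word_zero (x : ℕ → A) : word x 0 = [] := by simp [word]

lemma word_eq_word_iff {x y : ℕ → A} {n : ℕ} : word x n = word y n ↔ ∀ j < n, x j = y j := by
  constructor
  · intro h j hj
    have := congrFun (List.ofFn_injective h) ⟨j, hj⟩
    exact this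
  · intro h
    unfold word
    congr 1
    funext j
    exact h j j.2

lemma word_add (x : ℕ → A) (m n : ℕ) : word x (m + n) = word x m ++ word (leftShift^[m] x) n := by
  unfold word
  rw [List.ofFn_add]
  simp [iterate_leftShift]

lemma word_map {B : Type*} (g : A → B) (x : ℕ → A) (n : ℕ) :
    word (fun j => g (x j)) n = (word x n).map g := by
  simp [word, List.map_ofFn, Function.comp_def]

lemma mem_cyl {x : ℕ → A} {I : List A} : x ∈ cyl I ↔ word x I.length = I := Iff.rfl

lemma mem_cyl_append {x : ℕ → A} {I J : List A} :
    x ∈ cyl (I ++ J) ↔ x ∈ cyl I ∧ leftShift^[I.length] x ∈ cyl J := by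
  rw [mem_cyl, mem_cyl, mem_cyl, List.length_append, word_add]
  constructor
  · intro h
    exact List.append_inj h (by simp)
  · rintro ⟨h₁, h₂⟩
    rw [h₁, h₂]

lemma mem_cyl_word (x : ℕ → A) (n : ℕ) : x ∈ cyl (word x n) := by simp [mem_cyl]

/-- The set `B` is determined by the first `r` coordinates. -/
def DetBy (r : ℕ) (B : Set (ℕ → A)) : Prop := ∀ x y : ℕ → A, word x r = word y r → x ∈ B → y ∈ B

lemma DetBy.mono {r s : ℕ} {B : Set (ℕ → A)} (h : DetBy r B) (hrs : r ≤ s) : DetBy s B := by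
  intro x y hxy
  refine h x y ?_
  rw [word_eq_word_iff] at *
  exact fun j hj => hxy j (hj.trans_le hrs)

lemma DetBy.inter {r : ℕ} {B D : Set (ℕ → A)} (h : DetBy r B) (h' : DetBy r D) :
    DetBy r (B ∩ D) := fun x y hxy hx => ⟨h x y hxy hx.1, h' x y hxy hx.2⟩

lemma DetBy.compl {r : ℕ} {B : Set (ℕ → A)} (h : DetBy r B) : DetBy r Bᶜ :=
  fun x y hxy hx hy => hx (h y x hxy.symm hy)

lemma DetBy.union {r : ℕ} {B D : Set (ℕ → A)} (h : DetBy r B) (h' : DetBy r D) :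
    DetBy r (B ∪ D) := by
  rintro x y hxy (hx | hx)
  exacts [Or.inl (h x y hxy hx), Or.inr (h' x y hxy hx)]

lemma DetBy.preimage {r : ℕ} {B : Set (ℕ → A)} (h : DetBy r B) (i : ℕ) :
    DetBy (i + r) (leftShift^[i] ⁻¹' B) := by
  intro x y hxy
  refine h _ _ ?_
  rw [word_eq_word_iff] at *
  intro j hj
  rw [iterate_leftShift, iterate_leftShift]
  exact hxy _ (by omega)

lemma detBy_cyl (I : List A) : DetBy I.length (cyl I) := by
  intro x y hxy hx
  rw [mem_cyl] at *
  rw [← hxy, hx]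

lemma detBy_univ (r : ℕ) : DetBy r (Set.univ : Set (ℕ → A)) := fun _ _ _ _ => trivial

lemma DetBy.eq_preimage {r : ℕ} {B : Set (ℕ → A)} (h : DetBy r B) :
    B = (fun x : ℕ → A => fun j : Fin r => x j) ⁻¹'
      ((fun x : ℕ → A => fun j : Fin r => x j) '' B) := by
  ext x
  constructor
  · intro hx
    exact ⟨x, hx, rfl⟩
  · rintro ⟨y, hy, hyx⟩
    refine h y x ?_ hy
    rw [word_eq_word_iff]
    intro j hj
    exact congrFun hyx ⟨j, hj⟩

lemma DetBy.isClopen [TopologicalSpace A] [DiscreteTopology A] {r : ℕ} {B : Set (ℕ → A)}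
    (h : DetBy r B) : IsClopen B := by
  rw [h.eq_preimage]
  exact (isClopen_discrete _).preimage (by fun_prop)

lemma measurable_leftShift [MeasurableSpace A] : Measurable (leftShift : (ℕ → A) → (ℕ → A)) := by
  unfold leftShift shift
  fun_prop

lemma measurable_leftShift_iterate [MeasurableSpace A] (n : ℕ) :
    Measurable (leftShift^[n] : (ℕ → A) → (ℕ → A)) := measurable_leftShift.iterate n

lemma isSetAlgebra_detBy : IsSetAlgebra {B : Set (ℕ → A) | ∃ r, DetBy r B} where
  empty_mem := ⟨0, fun _ _ _ h => h⟩
  compl_mem := fun _ ⟨r, h⟩ => ⟨r, h.compl⟩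
  union_mem := fun _ _ ⟨r, h⟩ ⟨s, h'⟩ =>
    ⟨max r s, (h.mono (le_max_left _ _)).union (h'.mono (le_max_right _ _))⟩

lemma isPiSystem_detBy : IsPiSystem {B : Set (ℕ → A) | ∃ r, DetBy r B} := by
  rintro B ⟨r, h⟩ D ⟨s, h'⟩ -
  exact ⟨max r s, (h.mono (le_max_left _ _)).inter (h'.mono (le_max_right _ _))⟩

/-- A function on words is bounded on the words of bounded length. -/
lemma exists_bound_of_length_le [Finite A] (g : List A → ℝ≥0) (q : ℕ) :
    ∃ M : ℝ≥0, 0 < M ∧ ∀ I : List A, I.length ≤ q → g I ≤ M := by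
  have hfin : {I : List A | I.length ≤ q}.Finite := List.finite_length_le A q
  obtain ⟨M, hM⟩ := (hfin.image g).bddAbove
  exact ⟨M + 1, by positivity, fun I hI =>
    (hM ⟨I, hI, rfl⟩).trans (le_add_of_nonneg_right zero_le_one)⟩

variable [Finite A] [MeasurableSpace A] [DiscreteMeasurableSpace A]

lemma DetBy.measurableSet {r : ℕ} {B : Set (ℕ → A)} (h : DetBy r B) : MeasurableSet B := by
  rw [h.eq_preimage]
  exact (Set.toFinite _).measurableSet.preimage (by fun_prop)

lemma measurableSet_cyl (I : List A) : MeasurableSet (cyl I) := (detBy_cyl I).measurableSet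

lemma generateFrom_detBy :
    (MeasurableSpace.pi : MeasurableSpace (ℕ → A)) =
      MeasurableSpace.generateFrom {B : Set (ℕ → A) | ∃ r, DetBy r B} := by
  apply le_antisymm
  · refine iSup_le fun i => ?_
    rintro _ ⟨s, -, rfl⟩
    refine MeasurableSpace.measurableSet_generateFrom ⟨i + 1, fun x y hxy hx => ?_⟩
    rw [word_eq_word_iff] at hxy
    simpa [← hxy i (by omega)] using hx
  · refine MeasurableSpace.generateFrom_le ?_
    rintro B ⟨r, h⟩
    exact h.measurableSet

end Words

/-! ### The language of a subshift -/

section Language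

variable {A : Type*} [TopologicalSpace A] {X : Subshift A ℕ}

lemma iterate_mem_carrier {x : ℕ → A} (hx : x ∈ X.carrier) (n : ℕ) :
    leftShift^[n] x ∈ X.carrier := by
  induction n with
  | zero => exact hx
  | succ n ih =>
    rw [Function.iterate_succ_apply']
    exact X.mapsTo 1 ih

lemma word_mem_lang {x : ℕ → A} (hx : x ∈ X.carrier) (n : ℕ) : word x n ∈ lang X :=
  Or.inr ⟨x, hx, by simp⟩

lemma nil_mem_lang : [] ∈ lang X := Or.inl rfl

lemma mem_lang_of_mem_cyl {x : ℕ → A} (hx : x ∈ X.carrier) {I : List A} (h : x ∈ cyl I) :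
    I ∈ lang X := Or.inr ⟨x, hx, h⟩

lemma exists_mem_cyl (hX : X.carrier.Nonempty) {I : List A} (h : I ∈ lang X) :
    ∃ x ∈ X.carrier, x ∈ cyl I := by
  rcases h with rfl | h
  · obtain ⟨x, hx⟩ := hX
    exact ⟨x, hx, by simp [mem_cyl]⟩
  · exact h

lemma lang_of_append_left {I J : List A} (h : I ++ J ∈ lang X) : I ∈ lang X := by
  rcases h with h | ⟨x, hx, h⟩
  · rw [List.append_eq_nil_iff] at h
    exact Or.inl h.1
  · exact mem_lang_of_mem_cyl hx (mem_cyl_append.1 h).1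

lemma lang_of_append_right {I J : List A} (h : I ++ J ∈ lang X) : J ∈ lang X := by
  rcases h with h | ⟨x, hx, h⟩
  · rw [List.append_eq_nil_iff] at h
    exact Or.inl h.2
  · exact mem_lang_of_mem_cyl (iterate_mem_carrier hx _) (mem_cyl_append.1 h).2

variable [Finite A]

lemma mem_langN {n : ℕ} {I : List A} : I ∈ langN X n ↔ I ∈ lang X ∧ I.length = n := by
  simp [langN]

lemma word_mem_langN {x : ℕ → A} (hx : x ∈ X.carrier) (n : ℕ) : word x n ∈ langN X n :=
  mem_langN.2 ⟨word_mem_lang hx n, length_word _ _⟩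

lemma langN_zero : langN X 0 = {[]} := by
  ext I
  rw [mem_langN, Finset.mem_singleton, List.length_eq_zero_iff]
  exact ⟨fun h => h.2, fun h => ⟨h ▸ nil_mem_lang, h⟩⟩

/-- Splitting words into an initial and a final part: a sub-multiplicative weight has
sub-multiplicative sums. -/
lemma sum_langN_add_le {g g₁ g₂ : List A → ℝ≥0} {C : ℝ≥0} (m n : ℕ)
    (hg : ∀ I J, I.length = m → I ++ J ∈ lang X → g (I ++ J) ≤ C * g₁ I * g₂ J)
    (P Q R : List A → Prop) [DecidablePred P] [DecidablePred Q] [DecidablePred R]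
    (hR : ∀ I J, I.length = m → J.length = n → R (I ++ J) → P I ∧ Q J) :
    ∑ I ∈ (langN X (m + n)).filter R, g I ≤
      C * (∑ I ∈ (langN X m).filter P, g₁ I) * ∑ J ∈ (langN X n).filter Q, g₂ J := by
  classical
  set s := (langN X (m + n)).filter R
  have hs : ∀ I ∈ s, (I.take m).length = m ∧ (I.drop m).length = n ∧
      I.take m ∈ (langN X m).filter P ∧ I.drop m ∈ (langN X n).filter Q := by
    intro I hI
    obtain ⟨hI, hRI⟩ := Finset.mem_filter.1 hI
    obtain ⟨hIl, hlen⟩ := mem_langN.1 hI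
    have h1 : (I.take m).length = m := by simp [hlen]
    have h2 : (I.drop m).length = n := by simp [hlen]
    have h3 := hR (I.take m) (I.drop m) h1 h2 (by rwa [List.take_append_drop])
    rw [← List.take_append_drop m I] at hIl
    exact ⟨h1, h2, Finset.mem_filter.2 ⟨mem_langN.2 ⟨lang_of_append_left hIl, h1⟩, h3.1⟩,
      Finset.mem_filter.2 ⟨mem_langN.2 ⟨lang_of_append_right hIl, h2⟩, h3.2⟩⟩
  calc ∑ I ∈ s, g I ≤ ∑ I ∈ s, C * (g₁ (I.take m) * g₂ (I.drop m)) := by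
        refine Finset.sum_le_sum fun I hI => ?_
        have hIl := (mem_langN.1 (Finset.mem_filter.1 hI).1).1
        rw [← List.take_append_drop m I] at hIl
        have := hg _ _ (hs I hI).1 hIl
        rwa [List.take_append_drop, mul_assoc] at this
    _ = ∑ q ∈ s.image (fun I => (I.take m, I.drop m)), C * (g₁ q.1 * g₂ q.2) := by
        rw [Finset.sum_image]
        intro I _ J _ h
        simp only [Prod.mk.injEq] at h
        rw [← List.take_append_drop m I, h.1, h.2, List.take_append_drop]
    _ ≤ ∑ q ∈ (langN X m).filter P ×ˢ (langN X n).filter Q, C * (g₁ q.1 * g₂ q.2) := by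
        refine Finset.sum_le_sum_of_subset ?_
        intro q hq
        obtain ⟨I, hI, rfl⟩ := Finset.mem_image.1 hq
        exact Finset.mem_product.2 (hs I hI).2.2
    _ = C * (∑ I ∈ (langN X m).filter P, g₁ I) * ∑ J ∈ (langN X n).filter Q, g₂ J := by
        rw [← Finset.mul_sum, Finset.sum_product, mul_assoc, Finset.sum_mul_sum]

end Language

/-! ### Discrete measures on words and the effect of connecting words -/

section WordMeasure

variable {A : Type*} [TopologicalSpace A]

/-- `pt` selects for each word of the language a point of `X` beginning with that word. -/
def IsSelection (X : Subshift A ℕ) (pt : List A → ℕ → A) : Prop :=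
  ∀ W ∈ lang X, pt W ∈ X.carrier ∧ pt W ∈ cyl W

lemma exists_isSelection {X : Subshift A ℕ} (hX : X.carrier.Nonempty) :
    ∃ pt, IsSelection X pt := by
  classical
  refine ⟨fun W => if h : W ∈ lang X then (exists_mem_cyl hX h).choose else hX.some, ?_⟩
  intro W hW
  simp only [hW, dite_true]
  exact (exists_mem_cyl hX hW).choose_spec

/-- The weight `f` loses at most the factor `c` under suitable extensions by one letter. -/
structure Extendable (X : Subshift A ℕ) (c : ℝ≥0) (f : List A → ℝ≥0) : Prop where
  pos : 0 < c
  le_one : c ≤ 1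
  left : ∀ I ∈ lang X, ∃ a, a :: I ∈ lang X ∧ c * f I ≤ f (a :: I)
  right : ∀ I ∈ lang X, ∃ a, I ++ [a] ∈ lang X ∧ c * f I ≤ f (I ++ [a])

/-- Any two words can be connected by a word with length in `S`, at the cost of a factor `c`. -/
structure Connects (X : Subshift A ℕ) (S : Finset ℕ) (c : ℝ≥0) (f : List A → ℝ≥0) : Prop where
  pos : 0 < c
  connect : ∀ I ∈ lang X, ∀ J ∈ lang X, ∃ K, K.length ∈ S ∧ I ++ K ++ J ∈ lang X ∧
    c * f I * f J ≤ f (I ++ K ++ J)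

variable {X : Subshift A ℕ} {f : List A → ℝ≥0} {c d : ℝ≥0} {S : Finset ℕ} {p : ℕ}

lemma Extendable.pad_right (h : Extendable X c f) (t : ℕ) {I : List A} (hI : I ∈ lang X) :
    ∃ R : List A, R.length = t ∧ I ++ R ∈ lang X ∧ c ^ t * f I ≤ f (I ++ R) := by
  induction t with
  | zero => exact ⟨[], rfl, by simpa using hI, by simp⟩
  | succ t ih =>
    obtain ⟨R, hR, hIR, hf⟩ := ih
    obtain ⟨a, ha, hfa⟩ := h.right _ hIR
    refine ⟨R ++ [a], by simp [hR], by simpa using ha, ?_⟩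
    rw [← List.append_assoc]
    refine le_trans ?_ hfa
    rw [pow_succ', mul_assoc]
    gcongr

lemma Extendable.pad_left (h : Extendable X c f) (t : ℕ) {I : List A} (hI : I ∈ lang X) :
    ∃ R : List A, R.length = t ∧ R ++ I ∈ lang X ∧ c ^ t * f I ≤ f (R ++ I) := by
  induction t with
  | zero => exact ⟨[], rfl, by simpa using hI, by simp⟩
  | succ t ih =>
    obtain ⟨R, hR, hIR, hf⟩ := ih
    obtain ⟨a, ha, hfa⟩ := h.left _ hIR
    refine ⟨a :: R, by simp [hR], by simpa using ha, ?_⟩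
    rw [List.cons_append]
    refine le_trans ?_ hfa
    rw [pow_succ', mul_assoc]
    gcongr

/-- The length of `K` varies with the pair. Padding by `p - |K|` letters gives all these words the
common length `|I| + |J| + p`, so that a single word measure charges them; this costs at most `c ^
p`. -/
lemma Connects.pad_right (hc : Connects X S d f) (he : Extendable X c f)
    (hS : ∀ k ∈ S, k ≤ p) {I J : List A} (hI : I ∈ lang X) (hJ : J ∈ lang X) :
    ∃ K R : List A, K.length ∈ S ∧ K.length + R.length = p ∧ I ++ K ++ J ++ R ∈ lang X ∧
      c ^ p * d * f I * f J ≤ f (I ++ K ++ J ++ R) := by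
  obtain ⟨K, hK, hL, hf⟩ := hc.connect I hI J hJ
  obtain ⟨R, hR, hL', hf'⟩ := he.pad_right (p - K.length) hL
  refine ⟨K, R, hK, by have := hS _ hK; omega, hL', le_trans ?_ hf'⟩
  calc c ^ p * d * f I * f J = c ^ p * (d * f I * f J) := by ring
    _ ≤ c ^ (p - K.length) * f (I ++ K ++ J) :=
      mul_le_mul' (pow_le_pow_of_le_one zero_le he.le_one (Nat.sub_le _ _)) hf

lemma Connects.pad_left (hc : Connects X S d f) (he : Extendable X c f)
    (hS : ∀ k ∈ S, k ≤ p) {I J : List A} (hI : I ∈ lang X) (hJ : J ∈ lang X) :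
    ∃ K R : List A, K.length ∈ S ∧ K.length + R.length = p ∧ R ++ (I ++ K ++ J) ∈ lang X ∧
      c ^ p * d * f I * f J ≤ f (R ++ (I ++ K ++ J)) := by
  obtain ⟨K, hK, hL, hf⟩ := hc.connect I hI J hJ
  obtain ⟨R, hR, hL', hf'⟩ := he.pad_left (p - K.length) hL
  refine ⟨K, R, hK, by have := hS _ hK; omega, hL', le_trans ?_ hf'⟩
  calc c ^ p * d * f I * f J = c ^ p * (d * f I * f J) := by ring
    _ ≤ c ^ (p - K.length) * f (I ++ K ++ J) :=
      mul_le_mul' (pow_le_pow_of_le_one zero_le he.le_one (Nat.sub_le _ _)) hf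

variable [Finite A] [MeasurableSpace A]

/-- The discrete measure that puts the mass `f W` on the selected point of the word `W`, for all
words `W` of length `N`. -/
def wordMeasure (X : Subshift A ℕ) (f : List A → ℝ≥0) (pt : List A → ℕ → A) (N : ℕ) :
    Measure (ℕ → A) :=
  ∑ W ∈ langN X N, (f W : ℝ≥0∞) • Measure.dirac (pt W)

variable {pt : List A → ℕ → A}

open Classical in
lemma wordMeasure_apply {N : ℕ} {B : Set (ℕ → A)} (hB : MeasurableSet B) :
    wordMeasure X f pt N B = ∑ W ∈ (langN X N).filter (fun W => pt W ∈ B), (f W : ℝ≥0∞) := by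
  simp only [wordMeasure, Measure.coe_finsetSum, Finset.sum_apply, Measure.smul_apply,
    smul_eq_mul, Measure.dirac_apply' _ hB, Finset.sum_filter, Set.indicator_apply, Pi.one_apply,
    mul_ite, mul_one, mul_zero]

lemma wordMeasure_univ (N : ℕ) :
    wordMeasure X f pt N Set.univ = ∑ W ∈ langN X N, (f W : ℝ≥0∞) := by
  simp [wordMeasure_apply]

lemma isProbabilityMeasure_wordMeasure {N : ℕ} (h1 : ∑ W ∈ langN X N, f W = 1) :
    IsProbabilityMeasure (wordMeasure X f pt N) := by
  constructor
  rw [wordMeasure_univ]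
  exact_mod_cast congrArg ((↑) : ℝ≥0 → ℝ≥0∞) h1

lemma wordMeasure_compl_carrier [DiscreteTopology A] [DiscreteMeasurableSpace A]
    (hpt : IsSelection X pt) (N : ℕ) : wordMeasure X f pt N X.carrierᶜ = 0 := by
  refine (wordMeasure_apply X.isClosed.measurableSet.compl).trans
    (Finset.sum_eq_zero fun W hW => ?_)
  simp only [Finset.mem_filter] at hW
  exact absurd (hpt W (mem_langN.1 hW.1).1).1 hW.2

lemma le_wordMeasure_of_mem {N : ℕ} {W : List A} (hW : W ∈ langN X N)
    {B : Set (ℕ → A)} (hB : MeasurableSet B) (h : pt W ∈ B) :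
    (f W : ℝ≥0∞) ≤ wordMeasure X f pt N B := by
  classical
  rw [wordMeasure_apply hB]
  exact Finset.single_le_sum (f := fun W => (f W : ℝ≥0∞)) (fun _ _ => zero_le)
    (Finset.mem_filter.2 ⟨hW, h⟩)

variable [DiscreteMeasurableSpace A]

lemma wordMeasure_cyl (hpt : IsSelection X pt) {N : ℕ} {W : List A} (hW : W ∈ langN X N) :
    wordMeasure X f pt N (cyl W) = f W := by
  classical
  rw [wordMeasure_apply (measurableSet_cyl W)]
  have : (langN X N).filter (fun V => pt V ∈ cyl W) = {W} := by
    ext V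
    simp only [Finset.mem_filter, Finset.mem_singleton]
    constructor
    · rintro ⟨hV, hVW⟩
      have h := (hpt V (mem_langN.1 hV).1).2
      rw [mem_cyl, (mem_langN.1 hV).2] at h
      rw [mem_cyl, (mem_langN.1 hW).2, h] at hVW
      exact hVW
    · rintro rfl
      exact ⟨hW, (hpt V (mem_langN.1 hW).1).2⟩
  rw [this, Finset.sum_singleton]

/-- A lower bound for cylinders, summed over the cylinders of two sets. -/
lemma mul_wordMeasure_le (hpt : IsSelection X pt) {ν : Measure (ℕ → A)} {ℓ v : ℕ} (α β : ℕ → ℕ)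
    (h : ∀ W ∈ langN X ℓ, ∀ V ∈ langN X v, ∃ k ∈ S, ((c * f W * f V : ℝ≥0) : ℝ≥0∞) ≤
      ν (leftShift^[α k] ⁻¹' cyl W ∩ leftShift^[β k] ⁻¹' cyl V))
    {B D : Set (ℕ → A)} (hB : DetBy ℓ B) (hD : DetBy v D) :
    c * wordMeasure X f pt ℓ B * wordMeasure X f pt v D ≤
      ∑ k ∈ S, ν (leftShift^[α k] ⁻¹' B ∩ leftShift^[β k] ⁻¹' D) := by
  classical
  rw [wordMeasure_apply hB.measurableSet, wordMeasure_apply hD.measurableSet]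
  set s := (langN X ℓ).filter (fun W => pt W ∈ B)
  set t := (langN X v).filter (fun W => pt W ∈ D)
  have key : ∀ {r : ℕ} {E : Set (ℕ → A)}, DetBy r E →
      ∀ W ∈ (langN X r).filter (fun W => pt W ∈ E), cyl W ⊆ E := by
    intro r E hE W hW x hx
    obtain ⟨hW, hWE⟩ := Finset.mem_filter.1 hW
    obtain ⟨hW, hl⟩ := mem_langN.1 hW
    have h' := (hpt W hW).2
    rw [mem_cyl, hl] at h' hx
    exact hE _ _ (h'.trans hx.symm) hWE
  calc (c : ℝ≥0∞) * (∑ W ∈ s, (f W : ℝ≥0∞)) * ∑ V ∈ t, (f V : ℝ≥0∞)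
      = ∑ q ∈ s ×ˢ t, ((c * f q.1 * f q.2 : ℝ≥0) : ℝ≥0∞) := by
        rw [mul_assoc, Finset.sum_mul_sum, Finset.mul_sum, Finset.sum_product]
        refine Finset.sum_congr rfl fun W _ => ?_
        rw [Finset.mul_sum]
        refine Finset.sum_congr rfl fun V _ => ?_
        push_cast
        ring
    -- The connecting length depends on the pair of words, so every admissible length is summed.
    _ ≤ ∑ q ∈ s ×ˢ t, ∑ k ∈ S,
          ν (leftShift^[α k] ⁻¹' cyl q.1 ∩ leftShift^[β k] ⁻¹' cyl q.2) := by
        refine Finset.sum_le_sum fun q hq => ?_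
        obtain ⟨hq1, hq2⟩ := Finset.mem_product.1 hq
        obtain ⟨k, hk, hle⟩ := h q.1 (Finset.mem_filter.1 hq1).1 q.2 (Finset.mem_filter.1 hq2).1
        exact hle.trans (Finset.single_le_sum
          (f := fun k => ν (leftShift^[α k] ⁻¹' cyl q.1 ∩ leftShift^[β k] ⁻¹' cyl q.2))
          (fun _ _ => zero_le) hk)
    _ = ∑ k ∈ S, ∑ q ∈ s ×ˢ t,
          ν (leftShift^[α k] ⁻¹' cyl q.1 ∩ leftShift^[β k] ⁻¹' cyl q.2) := Finset.sum_comm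
    _ ≤ _ := by
        refine Finset.sum_le_sum fun k _ => ?_
        -- For a fixed `k` the sets of different pairs are disjoint: words of fixed lengths are read
        -- at fixed positions.
        rw [← measure_biUnion_finset]
        · refine measure_mono (Set.iUnion₂_subset fun q hq => ?_)
          obtain ⟨hq1, hq2⟩ := Finset.mem_product.1 hq
          exact Set.inter_subset_inter (Set.preimage_mono (key hB _ hq1))
            (Set.preimage_mono (key hD _ hq2))
        · intro q hq q' hq' hne
          simp only [Finset.coe_product, Set.mem_prod, Finset.mem_coe] at hq hq'
          have hl : ∀ {r : ℕ} {E : Set (ℕ → A)} {W : List A},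
              W ∈ (langN X r).filter (fun W => pt W ∈ E) → W.length = r :=
            fun hW => (mem_langN.1 (Finset.mem_filter.1 hW).1).2
          rw [Function.onFun, Set.disjoint_left]
          rintro x ⟨hx1, hx2⟩ ⟨hx1', hx2'⟩
          apply hne
          ext1
          · rw [← mem_cyl.1 hx1, ← mem_cyl.1 hx1', hl hq.1, hl hq'.1]
          · rw [← mem_cyl.1 hx2, ← mem_cyl.1 hx2', hl hq.2, hl hq'.2]
        · intro q _
          exact ((measurable_leftShift_iterate _) (measurableSet_cyl _)).inter
            ((measurable_leftShift_iterate _) (measurableSet_cyl _))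

lemma wordMeasure_connect_right (hpt : IsSelection X pt) (hc : Connects X S d f)
    (he : Extendable X c f) (hS : ∀ k ∈ S, k ≤ p) {ℓ v : ℕ} {B D : Set (ℕ → A)}
    (hB : DetBy ℓ B) (hD : DetBy v D) :
    ((c ^ p * d : ℝ≥0) : ℝ≥0∞) * wordMeasure X f pt ℓ B * wordMeasure X f pt v D ≤
      ∑ k ∈ S, wordMeasure X f pt (ℓ + v + p) (B ∩ leftShift^[ℓ + k] ⁻¹' D) := by
  refine mul_wordMeasure_le hpt (fun _ => 0) (fun k => ℓ + k) ?_ hB hD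
  intro W hW V hV
  obtain ⟨hW', rfl⟩ := mem_langN.1 hW
  obtain ⟨hV', rfl⟩ := mem_langN.1 hV
  obtain ⟨K, R, hK, hKR, hL, hf⟩ := hc.pad_right he hS hW' hV'
  refine ⟨K.length, hK, (ENNReal.coe_le_coe.2 hf).trans (le_wordMeasure_of_mem
    (mem_langN.2 ⟨hL, ?_⟩) (((measurable_leftShift_iterate _) (measurableSet_cyl _)).inter
      ((measurable_leftShift_iterate _) (measurableSet_cyl _))) ?_)⟩
  · simp only [List.length_append]; omega
  · have h := (mem_cyl_append.1 (hpt _ hL).2).1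
    rw [mem_cyl_append, mem_cyl_append, List.length_append] at h
    exact ⟨h.1.1, h.2⟩

/-- With the padding on the left, the set `D` stays at the position `p + ℓ` for every `k`, and it is
`B` that moves. This serves to enlarge the left margin of `D`. -/
lemma wordMeasure_connect_left (hpt : IsSelection X pt) (hc : Connects X S d f)
    (he : Extendable X c f) (hS : ∀ k ∈ S, k ≤ p) {ℓ v : ℕ} {B D : Set (ℕ → A)}
    (hB : DetBy ℓ B) (hD : DetBy v D) :
    ((c ^ p * d : ℝ≥0) : ℝ≥0∞) * wordMeasure X f pt ℓ B * wordMeasure X f pt v D ≤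
      ∑ k ∈ S, wordMeasure X f pt (ℓ + v + p)
        (leftShift^[p - k] ⁻¹' B ∩ leftShift^[p + ℓ] ⁻¹' D) := by
  refine mul_wordMeasure_le hpt (fun k => p - k) (fun _ => p + ℓ) ?_ hB hD
  intro W hW V hV
  obtain ⟨hW', rfl⟩ := mem_langN.1 hW
  obtain ⟨hV', rfl⟩ := mem_langN.1 hV
  obtain ⟨K, R, hK, hKR, hL, hf⟩ := hc.pad_left he hS hW' hV'
  refine ⟨K.length, hK, (ENNReal.coe_le_coe.2 hf).trans (le_wordMeasure_of_mem
    (mem_langN.2 ⟨hL, ?_⟩) (((measurable_leftShift_iterate _) (measurableSet_cyl _)).inter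
      ((measurable_leftShift_iterate _) (measurableSet_cyl _))) ?_)⟩
  · simp only [List.length_append]; omega
  · have h := (mem_cyl_append.1 (hpt _ hL).2).2
    rw [mem_cyl_append, mem_cyl_append, List.length_append, leftShift_iterate_add] at h
    refine ⟨?_, ?_⟩
    · rw [Set.mem_preimage, show p - K.length = R.length by omega]
      exact h.1.1
    · have h2 := h.2
      rwa [leftShift_iterate_add, show R.length + (W.length + K.length) = p + W.length by omega] at h2

/-- Connecting with the whole space: `D` is `univ`, seen on words of length `t - p`, and then the
summands for the different `k` coincide. -/
lemma wordMeasure_le_extend_right (hpt : IsSelection X pt)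
    (h1 : ∀ n, ∑ W ∈ langN X n, f W = 1) (hc : Connects X S d f)
    (he : Extendable X c f) (hS : ∀ k ∈ S, k ≤ p) {ℓ t : ℕ} (ht : p ≤ t) {B : Set (ℕ → A)}
    (hB : DetBy ℓ B) :
    ((c ^ p * d : ℝ≥0) : ℝ≥0∞) * wordMeasure X f pt ℓ B ≤
      S.card * wordMeasure X f pt (ℓ + t) B := by
  have h := wordMeasure_connect_right hpt hc he hS hB (detBy_univ (t - p))
  have := isProbabilityMeasure_wordMeasure (pt := pt) (h1 (t - p))
  rw [measure_univ, mul_one] at h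
  refine h.trans_eq ?_
  simp only [Set.preimage_univ, Set.inter_univ, Finset.sum_const, nsmul_eq_mul]
  congr 3
  omega

lemma wordMeasure_le_extend_left (hpt : IsSelection X pt)
    (h1 : ∀ n, ∑ W ∈ langN X n, f W = 1) (hc : Connects X S d f)
    (he : Extendable X c f) (hS : ∀ k ∈ S, k ≤ p) {ℓ t : ℕ} (ht : p ≤ t) {B : Set (ℕ → A)}
    (hB : DetBy ℓ B) :
    ((c ^ p * d : ℝ≥0) : ℝ≥0∞) * wordMeasure X f pt ℓ B ≤
      S.card * wordMeasure X f pt (t + ℓ) (leftShift^[t] ⁻¹' B) := by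
  have h := wordMeasure_connect_left hpt hc he hS (detBy_univ (t - p)) hB
  have := isProbabilityMeasure_wordMeasure (pt := pt) (h1 (t - p))
  rw [measure_univ, mul_one] at h
  refine h.trans_eq ?_
  simp only [Set.preimage_univ, Set.univ_inter, Finset.sum_const, nsmul_eq_mul]
  rw [show p + (t - p) = t by omega, show t - p + ℓ + p = t + ℓ by omega]

/-- Up to a constant, longer margins increase the mass of a set. -/
lemma exists_wordMeasure_le_extend (hpt : IsSelection X pt)
    (h1 : ∀ n, ∑ W ∈ langN X n, f W = 1) (hc : Connects X S d f)
    (he : Extendable X c f) (hS : ∀ k ∈ S, k ≤ p) :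
    ∃ C : ℝ≥0, 0 < C ∧ ∀ (a b a' b' : ℕ) (B : Set (ℕ → A)), DetBy a B → b + p ≤ b' → a + p ≤ a' →
      wordMeasure X f pt (b + a) (leftShift^[b] ⁻¹' B) ≤
        C * wordMeasure X f pt (b' + a') (leftShift^[b'] ⁻¹' B) := by
  set e : ℝ≥0 := c ^ p * d with he'
  have hepos : 0 < e := mul_pos (pow_pos he.pos _) hc.pos
  -- One factor for each margin; the `1` only secures positivity.
  refine ⟨(e⁻¹ * S.card) * (e⁻¹ * S.card) + 1, by positivity, ?_⟩
  intro a b a' b' B hB hb ha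
  have hdiv : ∀ x y : ℝ≥0∞, (e : ℝ≥0∞) * x ≤ S.card * y → x ≤ ((e⁻¹ * S.card : ℝ≥0) : ℝ≥0∞) * y := by
    intro x y h
    calc x = ((e⁻¹ * e : ℝ≥0) : ℝ≥0∞) * x := by rw [inv_mul_cancel₀ hepos.ne']; simp
      _ = (e⁻¹ : ℝ≥0) * (e * x) := by push_cast; rw [mul_assoc]
      _ ≤ (e⁻¹ : ℝ≥0) * (S.card * y) := by gcongr
      _ = _ := by push_cast; rw [mul_assoc]
  have h2 := hdiv _ _ (wordMeasure_le_extend_right hpt h1 hc he hS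
    (t := a' - a) (by omega) (hB.preimage b))
  have h3 := hdiv _ _ (wordMeasure_le_extend_left hpt h1 hc he hS (ℓ := b + a')
    (t := b' - b) (by omega) ((hB.preimage b).mono (by omega)))
  rw [show b + a + (a' - a) = b + a' by omega] at h2
  rw [show b' - b + (b + a') = b' + a' by omega, ← Set.preimage_comp, ← Function.iterate_add,
    show b + (b' - b) = b' by omega] at h3
  refine (h2.trans (mul_le_mul' le_rfl h3)).trans ?_
  rw [← mul_assoc]
  gcongr
  push_cast
  exact le_self_add

end WordMeasure

/-! ### The limit measure: existence, invariance, mixing on clopen sets -/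

section LimitMeasure

open scoped Topology

variable {A : Type*} [TopologicalSpace A] [Finite A] [MeasurableSpace A]

/-- The average of the shifts of the word measure of length `3 (N + 1)`, over the middle third. -/
def avgMeasure (X : Subshift A ℕ) (f : List A → ℝ≥0) (pt : List A → ℕ → A) (N : ℕ) :
    Measure (ℕ → A) :=
  ((N + 1 : ℕ) : ℝ≥0∞)⁻¹ • ∑ j ∈ Finset.range (N + 1),
    (wordMeasure X f pt (3 * (N + 1))).map leftShift^[N + 1 + j]

/-- The measure `μ` is a limit of the averages `avgMeasure` on sets determined by finitely many
coordinates. -/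
def IsWordLimit (X : Subshift A ℕ) (f : List A → ℝ≥0) (pt : List A → ℕ → A)
    (μ : Measure (ℕ → A)) : Prop :=
  ∀ (r : ℕ) (B : Set (ℕ → A)), DetBy r B →
    Tendsto (fun N => avgMeasure X f pt N B) (hyperfilter ℕ) (𝓝 (μ B))

variable {X : Subshift A ℕ} {f : List A → ℝ≥0} {pt : List A → ℕ → A} {c d : ℝ≥0} {S : Finset ℕ}
  {p : ℕ} {μ : Measure (ℕ → A)}

lemma avgMeasure_apply {B : Set (ℕ → A)} (hB : MeasurableSet B) (N : ℕ) :
    avgMeasure X f pt N B = ((N + 1 : ℕ) : ℝ≥0∞)⁻¹ * ∑ j ∈ Finset.range (N + 1),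
      wordMeasure X f pt (3 * (N + 1)) (leftShift^[N + 1 + j] ⁻¹' B) := by
  simp only [avgMeasure, Measure.smul_apply, Measure.coe_finsetSum, Finset.sum_apply, smul_eq_mul]
  congr 1
  exact Finset.sum_congr rfl fun j _ => Measure.map_apply (measurable_leftShift_iterate _) hB

lemma inv_mul_sum_range_const (N : ℕ) (x : ℝ≥0∞) :
    ((N + 1 : ℕ) : ℝ≥0∞)⁻¹ * ∑ _j ∈ Finset.range (N + 1), x = x := by
  rw [Finset.sum_const, Finset.card_range, nsmul_eq_mul, ← mul_assoc,
    ENNReal.inv_mul_cancel (by simp) (ENNReal.natCast_ne_top _), one_mul]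

lemma isProbabilityMeasure_avgMeasure (h1 : ∀ n, ∑ W ∈ langN X n, f W = 1) (N : ℕ) :
    IsProbabilityMeasure (avgMeasure X f pt N) := by
  constructor
  have := isProbabilityMeasure_wordMeasure (pt := pt) (h1 (3 * (N + 1)))
  simp only [avgMeasure_apply MeasurableSet.univ, Set.preimage_univ, measure_univ]
  exact inv_mul_sum_range_const N 1

variable [DiscreteMeasurableSpace A]

lemma avgMeasure_carrier_compl [DiscreteTopology A] (hpt : IsSelection X pt) (N : ℕ) :
    avgMeasure X f pt N X.carrierᶜ = 0 := by
  rw [avgMeasure_apply X.isClosed.measurableSet.compl, Finset.sum_eq_zero, mul_zero]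
  intro j _
  exact measure_mono_null (fun x hx hx' => hx (iterate_mem_carrier hx' _))
    (wordMeasure_compl_carrier (f := f) hpt _)

/-- Weak compactness of the probability measures on a compact space, along an ultrafilter instead of
a subsequence. Sets determined by finitely many coordinates are clopen, so weak convergence gives
convergence of their masses; the complement of `X` is open, so it stays null. -/
lemma exists_isWordLimit [DiscreteTopology A] (hpt : IsSelection X pt) (h1 : ∀ n, ∑ W ∈ langN X n, f W = 1) :
    ∃ μ : Measure (ℕ → A), IsProbabilityMeasure μ ∧ μ X.carrierᶜ = 0 ∧ IsWordLimit X f pt μ := by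
  let P : ℕ → ProbabilityMeasure (ℕ → A) := fun N =>
    ⟨avgMeasure X f pt N, isProbabilityMeasure_avgMeasure h1 N⟩
  let : TopologicalSpace.MetrizableSpace (ℕ → A) := TopologicalSpace.metrizableSpace_of_t3_secondCountable _
  obtain ⟨Q, -, hQ⟩ := isCompact_univ.ultrafilter_le_nhds ((hyperfilter ℕ).map P) (by simp)
  have hlim : Tendsto P (hyperfilter ℕ) (𝓝 Q) := hQ
  refine ⟨Q, inferInstance, ?_, ?_⟩
  · have h := ProbabilityMeasure.le_liminf_measure_open_of_tendsto hlim X.isClosed.isOpen_compl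
    have h0 : (fun N => (P N : Measure (ℕ → A)) X.carrierᶜ) = fun _ => 0 := by
      funext N
      exact avgMeasure_carrier_compl hpt N
    rw [h0] at h
    simpa using h
  · intro r B hB
    refine ProbabilityMeasure.tendsto_measure_of_null_frontier_of_tendsto' hlim ?_
    rw [hB.isClopen.frontier_eq, measure_empty]

lemma IsWordLimit.le_sum (hμ : IsWordLimit X f pt μ) {r : ℕ} {B : ℕ → Set (ℕ → A)}
    (hB : ∀ k ∈ S, DetBy r (B k)) {x : ℝ≥0∞}
    (h : ∀ᶠ N in atTop, ∀ j ≤ N,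
      x ≤ ∑ k ∈ S, wordMeasure X f pt (3 * (N + 1)) (leftShift^[N + 1 + j] ⁻¹' B k)) :
    x ≤ ∑ k ∈ S, μ (B k) := by
  have ht : Tendsto (fun N => ∑ k ∈ S, avgMeasure X f pt N (B k)) (hyperfilter ℕ)
      (𝓝 (∑ k ∈ S, μ (B k))) := tendsto_finsetSum _ fun k hk => hμ r _ (hB k hk)
  refine ge_of_tendsto ht ((h.filter_mono Nat.hyperfilter_le_atTop).mono fun N hN => ?_)
  have hrw : ∑ k ∈ S, avgMeasure X f pt N (B k) = ((N + 1 : ℕ) : ℝ≥0∞)⁻¹ *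
      ∑ j ∈ Finset.range (N + 1), ∑ k ∈ S,
        wordMeasure X f pt (3 * (N + 1)) (leftShift^[N + 1 + j] ⁻¹' B k) := by
    rw [Finset.sum_comm, Finset.mul_sum]
    exact Finset.sum_congr rfl fun k hk => avgMeasure_apply (hB k hk).measurableSet N
  rw [hrw]
  calc x = ((N + 1 : ℕ) : ℝ≥0∞)⁻¹ * ∑ _j ∈ Finset.range (N + 1), x :=
        (inv_mul_sum_range_const N x).symm
    _ ≤ _ := by
        gcongr with j hj
        exact hN j (by simpa [Nat.lt_succ_iff] using hj)

lemma IsWordLimit.measure_le (hμ : IsWordLimit X f pt μ) {r : ℕ} {B : Set (ℕ → A)}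
    (hB : DetBy r B) {x : ℝ≥0∞}
    (h : ∀ᶠ N in atTop, ∀ j ≤ N,
      wordMeasure X f pt (3 * (N + 1)) (leftShift^[N + 1 + j] ⁻¹' B) ≤ x) :
    μ B ≤ x := by
  refine le_of_tendsto (hμ r B hB) ((h.filter_mono Nat.hyperfilter_le_atTop).mono fun N hN => ?_)
  rw [avgMeasure_apply hB.measurableSet]
  calc _ ≤ ((N + 1 : ℕ) : ℝ≥0∞)⁻¹ * ∑ _j ∈ Finset.range (N + 1), x := by
        gcongr with j hj
        exact hN j (by simpa [Nat.lt_succ_iff] using hj)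
    _ = x := inv_mul_sum_range_const N x

/-- A bound on all masses of `B` at inner positions bounds `μ B`. -/
lemma IsWordLimit.measure_le_of_forall (hμ : IsWordLimit X f pt μ) {r : ℕ} {B : Set (ℕ → A)}
    (hB : DetBy r B) {x : ℝ≥0∞}
    (h : ∀ b a, r ≤ a → wordMeasure X f pt (b + a) (leftShift^[b] ⁻¹' B) ≤ x) : μ B ≤ x := by
  refine hμ.measure_le hB ((eventually_ge_atTop r).mono fun N hN j hj => ?_)
  have := h (N + 1 + j) (3 * (N + 1) - (N + 1 + j)) (by omega)
  rwa [show N + 1 + j + (3 * (N + 1) - (N + 1 + j)) = 3 * (N + 1) by omega] at this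

/-- Shifting exchanges one summand of the average, which changes the mass by at most `1 / (N + 1)`.
The resulting inequality, applied to a set and to its complement, is an equality. -/
lemma IsWordLimit.measurePreserving [IsProbabilityMeasure μ] (hμ : IsWordLimit X f pt μ)
    (h1 : ∀ n, ∑ W ∈ langN X n, f W = 1) : MeasurePreserving leftShift μ μ := by
  have hle : ∀ r B, DetBy r B → μ (leftShift ⁻¹' B) ≤ μ B := by
    intro r B hB
    have hB' : DetBy (1 + r) (leftShift ⁻¹' B) := hB.preimage 1
    have h0 : Tendsto (fun N : ℕ => ((N + 1 : ℕ) : ℝ≥0∞)⁻¹) (hyperfilter ℕ) (𝓝 0) :=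
      ((tendsto_add_atTop_iff_nat 1).2 ENNReal.tendsto_inv_nat_nhds_zero).mono_left
        Nat.hyperfilter_le_atTop
    have ht := (hμ r B hB).add h0
    rw [add_zero] at ht
    refine le_of_tendsto_of_tendsto (hμ _ _ hB') ht (Eventually.of_forall fun N => ?_)
    simp only
    rw [avgMeasure_apply hB.measurableSet, avgMeasure_apply hB'.measurableSet]
    have := isProbabilityMeasure_wordMeasure (pt := pt) (h1 (3 * (N + 1)))
    set g : ℕ → ℝ≥0∞ := fun j =>
      wordMeasure X f pt (3 * (N + 1)) (leftShift^[N + 1 + j] ⁻¹' B) with hg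
    have hsucc : ∀ j, wordMeasure X f pt (3 * (N + 1))
        (leftShift^[N + 1 + j] ⁻¹' (leftShift ⁻¹' B)) = g (j + 1) := by
      intro j
      simp only [hg]
      rw [← Set.preimage_comp, ← Function.iterate_succ']
      rfl
    simp only [hsucc]
    calc ((N + 1 : ℕ) : ℝ≥0∞)⁻¹ * ∑ j ∈ Finset.range (N + 1), g (j + 1)
        ≤ ((N + 1 : ℕ) : ℝ≥0∞)⁻¹ * (∑ j ∈ Finset.range (N + 1), g j + 1) := by
          refine mul_le_mul' le_rfl ?_
          calc _ ≤ ∑ j ∈ Finset.range (N + 1), g (j + 1) + g 0 := le_self_add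
            _ = ∑ j ∈ Finset.range (N + 1), g j + g (N + 1) := by
              rw [← Finset.sum_range_succ', Finset.sum_range_succ]
            _ ≤ _ := by gcongr; exact prob_le_one
      _ = _ := by rw [mul_add, mul_one]
  refine ⟨measurable_leftShift, ?_⟩
  have : IsProbabilityMeasure (μ.map leftShift) :=
    Measure.isProbabilityMeasure_map measurable_leftShift.aemeasurable
  refine ext_of_generate_finite _ generateFrom_detBy isPiSystem_detBy ?_ (by simp)
  rintro B ⟨r, hB⟩
  rw [Measure.map_apply measurable_leftShift hB.measurableSet]
  refine le_antisymm (hle r B hB) ?_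
  have h := hle r _ hB.compl
  have hm : MeasurableSet (leftShift ⁻¹' B) := measurable_leftShift hB.measurableSet
  rw [Set.preimage_compl, prob_compl_eq_one_sub hm, prob_compl_eq_one_sub hB.measurableSet] at h
  exact (ENNReal.sub_le_sub_iff_left prob_le_one ENNReal.one_ne_top).1 h

/-- At every position in the middle third of a long word both margins exceed those given by `a` and
`b`, so each summand of the average dominates the left side up to the constant for longer margins.
-/
lemma IsWordLimit.exists_wordMeasure_le (hμ : IsWordLimit X f pt μ) (hpt : IsSelection X pt)
    (h1 : ∀ n, ∑ W ∈ langN X n, f W = 1) (hc : Connects X S d f)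
    (he : Extendable X c f) (hS : ∀ k ∈ S, k ≤ p) :
    ∃ C : ℝ≥0, 0 < C ∧ ∀ (a b : ℕ) (B : Set (ℕ → A)), DetBy a B →
      wordMeasure X f pt (b + a) (leftShift^[b] ⁻¹' B) ≤ C * μ B := by
  obtain ⟨C, hC, h⟩ := exists_wordMeasure_le_extend hpt h1 hc he hS
  refine ⟨C, hC, fun a b B hB => ?_⟩
  have hC0 : (C : ℝ≥0∞) ≠ 0 := by exact_mod_cast hC.ne'
  rw [← ENNReal.div_le_iff' hC0 ENNReal.coe_ne_top]
  have := hμ.le_sum (S := {0}) (B := fun _ => B) (fun _ _ => hB)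
    (x := wordMeasure X f pt (b + a) (leftShift^[b] ⁻¹' B) / C) ?_
  · simpa using this
  · refine (eventually_ge_atTop (a + b + p)).mono fun N hN j hj => ?_
    rw [Finset.sum_singleton, ENNReal.div_le_iff' hC0 ENNReal.coe_ne_top]
    have := h a b (3 * (N + 1) - (N + 1 + j)) (N + 1 + j) B hB (by omega) (by omega)
    rwa [show N + 1 + j + (3 * (N + 1) - (N + 1 + j)) = 3 * (N + 1) by omega] at this

/-- The mixing bound for sets determined by finitely many coordinates. -/
lemma IsWordLimit.exists_mixing_detBy (hμ : IsWordLimit X f pt μ) (hpt : IsSelection X pt)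
    (h1 : ∀ n, ∑ W ∈ langN X n, f W = 1) (hc : Connects X S d f)
    (he : Extendable X c f) (hS : ∀ k ∈ S, k ≤ p) :
    ∃ e : ℝ≥0, 0 < e ∧ ∀ (r s : ℕ) (B D : Set (ℕ → A)), DetBy r B → DetBy s D →
      e * μ B * μ D ≤
        liminf (fun n : ℕ => ∑ k ∈ S, μ (B ∩ leftShift^[n + k] ⁻¹' D)) atTop := by
  obtain ⟨C, hC, h⟩ := exists_wordMeasure_le_extend hpt h1 hc he hS
  set e : ℝ≥0 := c ^ p * d with he'
  have hepos : 0 < e := mul_pos (pow_pos he.pos _) hc.pos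
  refine ⟨e / (C * C), by positivity, fun r s B D hB hD => ?_⟩
  set L := liminf (fun n : ℕ => ∑ k ∈ S, μ (B ∩ leftShift^[n + k] ⁻¹' D)) atTop
  have hCC : ((C * C : ℝ≥0) : ℝ≥0∞) ≠ 0 := by exact_mod_cast (mul_pos hC hC).ne'
  -- It suffices to bound products of word-measure masses with arbitrary margins: `μ B` and `μ D`
  -- are at most any uniform bound for such masses.
  have key : ∀ b a, r ≤ a → ∀ b' a', s ≤ a' →
      (e : ℝ≥0∞) * wordMeasure X f pt (b + a) (leftShift^[b] ⁻¹' B) *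
        wordMeasure X f pt (b' + a') (leftShift^[b'] ⁻¹' D) ≤ (C * C : ℝ≥0) * L := by
    intro b a ha b' a' ha'
    rw [← ENNReal.div_le_iff' hCC ENNReal.coe_ne_top]
    refine le_liminf_of_le (by isBoundedDefault)
      ((eventually_ge_atTop (a + 2 * p + b')).mono fun n hn => ?_)
    refine hμ.le_sum (r := r + n + (Finset.sup S id) + s) ?_ ?_
    · intro k hk
      have : k ≤ Finset.sup S id := Finset.le_sup (f := id) hk
      exact (hB.mono (by omega)).inter ((hD.preimage (n + k)).mono (by omega))
    · refine (eventually_ge_atTop (n + b + a' + 2 * p)).mono fun N hN j hj => ?_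
      rw [ENNReal.div_le_iff' hCC ENNReal.coe_ne_top]
      obtain ⟨i, hi⟩ : ∃ i, i = N + 1 + j := ⟨_, rfl⟩
      -- The word of length `3 (N + 1)` consists of a block of length `i + w` with `B` at `i`, a
      -- connecting word of length `k`, a block of length `b' + p + v` with `D` at `b' + p`, and
      -- padding. So `D` occurs at the distance `w + k + b' + p = n + k` after `B`.
      obtain ⟨w, hw⟩ : ∃ w, n = w + (b' + p) := ⟨n - (b' + p), by omega⟩
      obtain ⟨v, hv⟩ : ∃ v, 3 * (N + 1) = i + w + (b' + p + v) + p :=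
        ⟨3 * (N + 1) - (i + w + (b' + p) + p), by omega⟩
      rw [← hi]
      have hb1 := h a b w i B (hB.mono ha) (by omega) (by omega)
      have hb2 := h a' b' v (b' + p) D (hD.mono ha') le_rfl (by omega)
      have hb3 := wordMeasure_connect_right (ℓ := i + w) (v := b' + p + v) hpt hc he hS
        ((hB.preimage i).mono (show i + r ≤ i + w by omega))
        ((hD.preimage (b' + p)).mono (show b' + p + s ≤ b' + p + v by omega))
      rw [← hv] at hb3
      calc _ ≤ (e : ℝ≥0∞) * (C * wordMeasure X f pt (i + w) (leftShift^[i] ⁻¹' B)) *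
            (C * wordMeasure X f pt (b' + p + v) (leftShift^[b' + p] ⁻¹' D)) := by gcongr
        _ = (C * C : ℝ≥0) * (e * wordMeasure X f pt (i + w) (leftShift^[i] ⁻¹' B) *
            wordMeasure X f pt (b' + p + v) (leftShift^[b' + p] ⁻¹' D)) := by push_cast; ring
        _ ≤ _ := by
          refine mul_le_mul' le_rfl (hb3.trans_eq (Finset.sum_congr rfl fun k _ => ?_))
          rw [Set.preimage_inter, ← Set.preimage_comp, ← Set.preimage_comp,
            ← Function.iterate_add, ← Function.iterate_add]
          congr 4
          omega
  -- Replaces a word-measure mass by the mass under `μ`, one factor at a time, with the other factor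
  -- absorbed in `y`.
  have hconv : ∀ {y x : ℝ≥0∞} {E : Set (ℕ → A)} {t : ℕ}, DetBy t E → y ≠ ∞ →
      (∀ b a, t ≤ a → y * wordMeasure X f pt (b + a) (leftShift^[b] ⁻¹' E) ≤ x) →
      y * μ E ≤ x := by
    intro y x E t hE hy hyx
    rcases eq_or_ne y 0 with rfl | hy0
    · simp
    · rw [mul_comm, ← ENNReal.le_div_iff_mul_le (Or.inl hy0) (Or.inl hy)]
      refine hμ.measure_le_of_forall hE fun b a ha => ?_
      rw [ENNReal.le_div_iff_mul_le (Or.inl hy0) (Or.inl hy), mul_comm]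
      exact hyx b a ha
  have hfin : ∀ N E, wordMeasure X f pt N E ≠ ∞ := by
    intro N E
    have := isProbabilityMeasure_wordMeasure (pt := pt) (h1 N)
    exact measure_ne_top _ _
  have h2 : (e : ℝ≥0∞) * μ B * μ D ≤ (C * C : ℝ≥0) * L := by
    have h3 : ∀ b' a', s ≤ a' → (e : ℝ≥0∞) *
        wordMeasure X f pt (b' + a') (leftShift^[b'] ⁻¹' D) * μ B ≤ (C * C : ℝ≥0) * L := by
      intro b' a' ha'
      refine hconv hB (ENNReal.mul_ne_top ENNReal.coe_ne_top (hfin _ _)) fun b a ha => ?_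
      rw [mul_right_comm]
      exact key b a ha b' a' ha'
    have hμB : μ B ≤ 1 := hμ.measure_le_of_forall hB fun b a _ => by
      have := isProbabilityMeasure_wordMeasure (pt := pt) (h1 (b + a))
      exact prob_le_one
    refine hconv hD (ENNReal.mul_ne_top ENNReal.coe_ne_top
      (ne_top_of_le_ne_top ENNReal.one_ne_top hμB)) fun b' a' ha' => ?_
    rw [mul_right_comm]
    exact h3 b' a' ha'
  calc ((e / (C * C) : ℝ≥0) : ℝ≥0∞) * μ B * μ D
      = ((C * C : ℝ≥0) : ℝ≥0∞)⁻¹ * (e * μ B * μ D) := by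
        rw [ENNReal.coe_div (mul_pos hC hC).ne', div_eq_mul_inv]; ring
    _ ≤ ((C * C : ℝ≥0) : ℝ≥0∞)⁻¹ * ((C * C : ℝ≥0) * L) := by gcongr
    _ = L := by rw [← mul_assoc, ENNReal.inv_mul_cancel hCC ENNReal.coe_ne_top, one_mul]

end LimitMeasure

/-! ### Mixing on Borel sets and ergodicity -/

section Mixing

/-- A mixing bound for sets determined by finitely many coordinates extends to all Borel sets. -/
lemma mixing_of_detBy {A : Type*} [Finite A] [MeasurableSpace A] [DiscreteMeasurableSpace A]
    {S : Finset ℕ} {μ : Measure (ℕ → A)} [IsProbabilityMeasure μ] (hinv : MeasurePreserving leftShift μ μ) {e : ℝ≥0}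
    (h : ∀ (r s : ℕ) (B D : Set (ℕ → A)), DetBy r B → DetBy s D →
      e * μ B * μ D ≤ liminf (fun n : ℕ => ∑ k ∈ S, μ (B ∩ leftShift^[n + k] ⁻¹' D)) atTop)
    {B D : Set (ℕ → A)} (hB : MeasurableSet B) (hD : MeasurableSet D) :
    e * μ B * μ D ≤ liminf (fun n : ℕ => ∑ k ∈ S, μ (B ∩ leftShift^[n + k] ⁻¹' D)) atTop := by
  have hdense := Measure.MeasureDense.of_generateFrom_isSetAlgebra_finite μ
    isSetAlgebra_detBy generateFrom_detBy
  have happ : ∀ (E : Set (ℕ → A)), MeasurableSet E → ∀ δ : ℝ≥0, 0 < δ →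
      ∃ r E', DetBy r E' ∧ μ (symmDiff E E') ≤ δ := by
    intro E hE δ hδ
    obtain ⟨t, ⟨r, ht⟩, hlt⟩ := hdense.approx E hE (measure_ne_top _ _) δ (by exact_mod_cast hδ)
    exact ⟨r, t, ht, by simpa using hlt.le⟩
  set F : ℕ → ℝ≥0∞ := fun n => ∑ k ∈ S, μ (B ∩ leftShift^[n + k] ⁻¹' D) with hF
  -- Replacing both sets costs `2 δ` for each `k ∈ S` on the right and at most `3 e δ` on the left,
  -- as `δ ≤ 1`.
  set M : ℝ≥0 := 2 * S.card + 3 * e + 1 with hM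
  refine ENNReal.le_of_forall_pos_le_add fun ε hε _ => ?_
  set δ : ℝ≥0 := min 1 (ε / M) with hδ
  have hMpos : 0 < M := by positivity
  have hδpos : 0 < δ := lt_min one_pos (by positivity)
  obtain ⟨r, B', hB', hBd⟩ := happ B hB δ hδpos
  obtain ⟨s, D', hD', hDd⟩ := happ D hD δ hδpos
  have hle : ∀ {E E' : Set (ℕ → A)}, μ (symmDiff E E') ≤ δ → μ E ≤ μ E' + δ := by
    intro E E' hE
    calc μ E ≤ μ (E' ∪ symmDiff E E') := by
          refine measure_mono fun x hx => ?_
          by_cases hx' : x ∈ E'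
          · exact Or.inl hx'
          · exact Or.inr (Or.inl ⟨hx, hx'⟩)
      _ ≤ μ E' + μ (symmDiff E E') := measure_union_le _ _
      _ ≤ _ := by gcongr
  have hFle : ∀ n, ∑ k ∈ S, μ (B' ∩ leftShift^[n + k] ⁻¹' D') ≤ F n + (S.card * (2 * δ) : ℝ≥0) := by
    intro n
    have hcard : ((S.card * (2 * δ) : ℝ≥0) : ℝ≥0∞) = ∑ _k ∈ S, ((2 * δ : ℝ≥0) : ℝ≥0∞) := by
      rw [Finset.sum_const, nsmul_eq_mul]; push_cast; rfl
    rw [hF, hcard, ← Finset.sum_add_distrib]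
    refine Finset.sum_le_sum fun k _ => ?_
    have hDd' : μ (leftShift^[n + k] ⁻¹' symmDiff D D') ≤ δ := by
      rw [(hinv.iterate _).measure_preimage (hD.symmDiff hD'.measurableSet).nullMeasurableSet]
      exact hDd
    calc _ ≤ μ ((B ∩ leftShift^[n + k] ⁻¹' D) ∪
          (symmDiff B B' ∪ leftShift^[n + k] ⁻¹' symmDiff D D')) := by
          refine measure_mono fun x hx => ?_
          by_cases hx1 : x ∈ B
          · by_cases hx2 : x ∈ leftShift^[n + k] ⁻¹' D
            · exact Or.inl ⟨hx1, hx2⟩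
            · exact Or.inr (Or.inr (Or.inr ⟨hx.2, hx2⟩))
          · exact Or.inr (Or.inl (Or.inr ⟨hx.1, hx1⟩))
      _ ≤ _ := (measure_union_le _ _).trans (by
          gcongr
          refine (measure_union_le _ _).trans ?_
          rw [two_mul]; push_cast; gcongr)
  have hlim : e * μ B' * μ D' ≤ liminf F atTop + (S.card * (2 * δ) : ℝ≥0) := by
    refine (h r s B' D' hB' hD').trans ?_
    rw [← liminf_add_const atTop F _ (by isBoundedDefault) (by isBoundedDefault)]
    exact liminf_le_liminf (Eventually.of_forall hFle)
  have hδ1 : (δ : ℝ≥0∞) ≤ 1 := by exact_mod_cast min_le_left _ _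
  calc (e : ℝ≥0∞) * μ B * μ D ≤ e * (μ B' + δ) * (μ D' + δ) := by
        gcongr
        exacts [hle hBd, hle hDd]
    _ = e * μ B' * μ D' + e * (μ B' * δ + δ * μ D' + δ * δ) := by ring
    _ ≤ (liminf F atTop + (S.card * (2 * δ) : ℝ≥0)) + e * (1 * δ + δ * 1 + 1 * δ) := by
        gcongr
        exacts [prob_le_one, prob_le_one]
    _ = liminf F atTop + ((S.card * (2 * δ) + e * (1 * δ + δ * 1 + 1 * δ) : ℝ≥0) : ℝ≥0∞) := by
        push_cast; rw [add_assoc]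
    _ ≤ liminf F atTop + ε := by
        gcongr
        calc (S.card * (2 * δ) + e * (1 * δ + δ * 1 + 1 * δ) : ℝ≥0) =
              (2 * S.card + 3 * e) * δ := by ring
          _ ≤ M * (ε / M) := by
              gcongr
              · rw [hM]; exact le_self_add
              · exact min_le_right _ _
          _ = ε := by field_simp

/-- An invariant set never meets the preimages of its complement, so the bound for the pair `s`,
`sᶜ` reads `e * μ s * μ sᶜ ≤ 0`. -/
lemma ergodic_of_mixing {A : Type*} [MeasurableSpace A] {S : Finset ℕ} {μ : Measure (ℕ → A)}
    [IsProbabilityMeasure μ] (hinv : MeasurePreserving leftShift μ μ)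
    {e : ℝ≥0} (he : 0 < e)
    (h : ∀ B D : Set (ℕ → A), MeasurableSet B → MeasurableSet D →
      e * μ B * μ D ≤ liminf (fun n : ℕ => ∑ k ∈ S, μ (B ∩ leftShift^[n + k] ⁻¹' D)) atTop) :
    Ergodic leftShift μ := by
  refine ⟨hinv, ⟨fun s hs hinvs => ?_⟩⟩
  have h0 := h s sᶜ hs hs.compl
  have hiter : ∀ n, leftShift^[n] ⁻¹' s = s := by
    intro n
    induction n with
    | zero => rfl
    | succ n ih => rw [Function.iterate_succ, Set.preimage_comp, ih, hinvs]
  simp only [Set.preimage_compl, hiter, Set.inter_compl_self, measure_empty,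
    Finset.sum_const_zero, liminf_const, nonpos_iff_eq_zero, mul_eq_zero, ENNReal.coe_eq_zero,
    he.ne', false_or] at h0
  rw [eventuallyConst_set']
  rcases h0 with h0 | h0
  · left; exact ae_eq_empty.2 h0
  · right; exact ae_eq_univ.2 h0

end Mixing

/-! ### Comparison of the limit measure with the supremum weight -/

section StarSup

lemma le_starSup {A : Type*} [TopologicalSpace A] [Finite A] {X : Subshift A ℕ}
    {f : List A → ℝ≥0} {I : List A} (hI : I ∈ lang X) : (f I : ℝ≥0∞) ≤ starSup X f I := by
  classical
  unfold starSup
  refine le_iSup₂_of_le 0 0 ?_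
  refine le_trans ?_ (Finset.single_le_sum
    (f := fun P : List A × List A => (f (P.1 ++ I ++ P.2) : ℝ≥0∞)) (fun _ _ => zero_le)
    (a := ([], [])) ?_)
  · simp
  · simp [langN_zero, hI]

variable {A : Type*} [TopologicalSpace A] [Finite A] [MeasurableSpace A]
  [DiscreteMeasurableSpace A]
  {X : Subshift A ℕ} {f : List A → ℝ≥0} {pt : List A → ℕ → A} {μ : Measure (ℕ → A)}

open Classical in
-- A word of length `m + |I| + n` with `I` at position `m` splits in exactly one way. This makes the
-- supremum weight a supremum of word-measure masses over all margins.
lemma sum_inner_eq_wordMeasure (hpt : IsSelection X pt) (I : List A) (m n : ℕ) :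
    ∑ P ∈ (langN X m ×ˢ langN X n).filter (fun P => P.1 ++ I ++ P.2 ∈ lang X),
      (f (P.1 ++ I ++ P.2) : ℝ≥0∞) =
    wordMeasure X f pt (m + (I.length + n)) (leftShift^[m] ⁻¹' cyl I) := by
  rw [wordMeasure_apply ((measurable_leftShift_iterate _) (measurableSet_cyl _))]
  refine Finset.sum_bij (fun P _ => P.1 ++ I ++ P.2) ?_ ?_ ?_ ?_
  · intro P hP
    simp only [Finset.mem_filter, Finset.mem_product, mem_langN] at hP ⊢
    obtain ⟨⟨⟨-, hm⟩, -, hn⟩, hL⟩ := hP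
    refine ⟨⟨hL, by simp [hm, hn]⟩, ?_⟩
    have := (mem_cyl_append.1 (mem_cyl_append.1 (hpt _ hL).2).1).2
    rwa [hm] at this
  · intro P hP Q hQ h
    simp only [Finset.mem_filter, Finset.mem_product, mem_langN] at hP hQ
    simp only [List.append_assoc] at h
    have h1 := List.append_inj h (by rw [hP.1.1.2, hQ.1.1.2])
    exact Prod.ext h1.1 (List.append_cancel_left h1.2)
  · intro W hW
    simp only [Finset.mem_filter, mem_langN, Set.mem_preimage] at hW
    obtain ⟨⟨hL, hlen⟩, hI⟩ := hW
    have hc := (hpt _ hL).2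
    rw [mem_cyl, hlen, word_add, word_add, mem_cyl.1 hI, ← List.append_assoc] at hc
    have hL' := hL
    rw [← hc] at hL'
    refine ⟨(_, _), ?_, hc⟩
    simp only [Finset.mem_filter, Finset.mem_product, mem_langN]
    exact ⟨⟨⟨lang_of_append_left (lang_of_append_left hL'), length_word _ _⟩,
      lang_of_append_right hL', length_word _ _⟩, hL'⟩
  · intro P _
    rfl

lemma starSup_eq_iSup_wordMeasure (hpt : IsSelection X pt) (I : List A) :
    starSup X f I =
      ⨆ (m : ℕ) (n : ℕ), wordMeasure X f pt (m + (I.length + n)) (leftShift^[m] ⁻¹' cyl I) := by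
  unfold starSup
  simp only [sum_inner_eq_wordMeasure hpt]

lemma IsWordLimit.cyl_le_starSup (hμ : IsWordLimit X f pt μ) (hpt : IsSelection X pt)
    (I : List A) : μ (cyl I) ≤ starSup X f I := by
  rw [starSup_eq_iSup_wordMeasure hpt]
  refine hμ.measure_le_of_forall (detBy_cyl I) fun b a ha => ?_
  obtain ⟨n, rfl⟩ := Nat.exists_eq_add_of_le ha
  exact le_iSup₂ (f := fun m n =>
    wordMeasure X f pt (m + (I.length + n)) (leftShift^[m] ⁻¹' cyl I)) b n

lemma starSup_le_of_wordMeasure_le (hpt : IsSelection X pt) {C : ℝ≥0}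
    (h : ∀ (a b : ℕ) (B : Set (ℕ → A)), DetBy a B →
      wordMeasure X f pt (b + a) (leftShift^[b] ⁻¹' B) ≤ C * μ B) (I : List A) :
    starSup X f I ≤ C * μ (cyl I) := by
  rw [starSup_eq_iSup_wordMeasure hpt]
  exact iSup₂_le fun m n => h _ m _ ((detBy_cyl I).mono (Nat.le_add_right _ _))

end StarSup

/-! ### Weights on the tower: normalization and super-multiplicativity -/

section TowerWeights

lemma Iic_succ_eq_insert {m : ℕ} (i : Fin m) :
    Finset.Iic i.succ = insert i.succ (Finset.Iic i.castSucc) := by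
  ext j
  simp only [Finset.mem_Iic, Finset.mem_insert, Fin.le_def, Fin.ext_iff, Fin.val_succ,
    Fin.val_castSucc]
  omega

lemma filter_castSucc_lt_succ {m : ℕ} (i : Fin m) :
    Finset.univ.filter (fun j : Fin m => j.castSucc < i.succ) =
      insert i (Finset.univ.filter (fun j : Fin m => j.castSucc < i.castSucc)) := by
  ext j
  simp only [Finset.mem_filter, Finset.mem_univ, true_and, Finset.mem_insert, Fin.lt_def,
    Fin.ext_iff, Fin.val_succ, Fin.val_castSucc]
  omega

variable {m : ℕ} {A : Fin (m + 1) → Type*}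

@[simp] lemma tau_zero (π : (i : Fin m) → A i.castSucc → A i.succ) : tau π 0 = id := rfl

lemma tau_succ (π : (i : Fin m) → A i.castSucc → A i.succ) (i : Fin m) :
    tau π i.succ = π i ∘ tau π i.castSucc := by
  simp [tau, Fin.induction_succ]

lemma map_tau_succ (π : (i : Fin m) → A i.castSucc → A i.succ) (i : Fin m) (I : List (A 0)) :
    I.map (tau π i.succ) = (I.map (tau π i.castSucc)).map (π i) := by
  rw [tau_succ, List.map_map]

lemma psum_zero (a : Fin (m + 1) → ℝ) : psum a 0 = a 0 := by
  unfold psum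
  rw [show Finset.Iic (0 : Fin (m + 1)) = {0} by ext j; simp, Finset.sum_singleton]

lemma psum_succ (a : Fin (m + 1) → ℝ) (i : Fin m) :
    psum a i.succ = psum a i.castSucc + a i.succ := by
  unfold psum
  rw [Iic_succ_eq_insert, Finset.sum_insert (by simp [Fin.le_def]), add_comm]

variable {a : Fin (m + 1) → ℝ}

lemma psum_pos (ha0 : 0 < a 0) (ha : ∀ i, 0 ≤ a i) (i : Fin (m + 1)) : 0 < psum a i := by
  induction i using Fin.induction with
  | zero => rwa [psum_zero]
  | succ i ih => rw [psum_succ]; exact add_pos_of_pos_of_nonneg ih (ha _)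

lemma psum_mono (ha : ∀ i, 0 ≤ a i) {i j : Fin (m + 1)} (hij : i ≤ j) : psum a i ≤ psum a j :=
  Finset.sum_le_sum_of_subset_of_nonneg (Finset.Iic_subset_Iic.2 hij) fun k _ _ => ha k

variable [∀ i, TopologicalSpace (A i)] {X : (i : Fin (m + 1)) → Subshift (A i) ℕ}
  {π : (i : Fin m) → A i.castSucc → A i.succ}

lemma IsOneBlockTower.tau_mem (hπ : IsOneBlockTower X π) (i : Fin (m + 1)) {x : ℕ → A 0}
    (hx : x ∈ (X 0).carrier) : (fun n => tau π i (x n)) ∈ (X i).carrier := by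
  induction i using Fin.induction with
  | zero => exact hx
  | succ i ih =>
    rw [← hπ i]
    exact ⟨_, ih, by funext n; rw [tau_succ]; rfl⟩

lemma IsOneBlockTower.map_mem_lang (hπ : IsOneBlockTower X π) (i : Fin m)
    {I : List (A i.castSucc)} (hI : I ∈ lang (X i.castSucc)) : I.map (π i) ∈ lang (X i.succ) := by
  rcases hI with rfl | ⟨x, hx, h⟩
  · exact nil_mem_lang
  · refine Or.inr ⟨fun n => π i (x n), ?_, ?_⟩
    · rw [← hπ i]; exact ⟨x, hx, rfl⟩
    · rw [word_map, List.length_map, h]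

lemma IsOneBlockTower.map_tau_mem_lang (hπ : IsOneBlockTower X π) (i : Fin (m + 1))
    {I : List (A 0)} (hI : I ∈ lang (X 0)) : I.map (tau π i) ∈ lang (X i) := by
  induction i using Fin.induction with
  | zero => simpa using hI
  | succ i ih => rw [map_tau_succ]; exact hπ.map_mem_lang i ih

variable [∀ i, Finite (A i)] {φ : List (A 0) → ℝ≥0}

@[simp] lemma phiLevel_zero : phiLevel X π a φ 0 = φ := rfl

open Classical in
lemma phiLevel_succ (i : Fin m) (J : List (A i.succ)) :
    phiLevel X π a φ i.succ J =
      (∑ I ∈ (langN (X i.castSucc) J.length).filter (fun I => I.map (π i) = J),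
        phiLevel X π a φ i.castSucc I ^ (1 / psum a i.castSucc)) ^ psum a i.castSucc := by
  simp [phiLevel, Fin.induction_succ]

/-- The weight of a word at the level `i` relative to its image at the level `i + 1`. -/
def condWeight (X : (i : Fin (m + 1)) → Subshift (A i) ℕ)
    (π : (i : Fin m) → A i.castSucc → A i.succ) (a : Fin (m + 1) → ℝ) (φ : List (A 0) → ℝ≥0)
    (i : Fin m) (I : List (A i.castSucc)) : ℝ≥0 :=
  phiLevel X π a φ i.castSucc I ^ (1 / psum a i.castSucc) /
    phiLevel X π a φ i.succ (I.map (π i)) ^ (1 / psum a i.castSucc)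

/-- The partial products of the relative weights below the level `i`. -/
def partialWeight (X : (i : Fin (m + 1)) → Subshift (A i) ℕ)
    (π : (i : Fin m) → A i.castSucc → A i.succ) (a : Fin (m + 1) → ℝ) (φ : List (A 0) → ℝ≥0)
    (i : Fin (m + 1)) (I : List (A 0)) : ℝ≥0 :=
  ∏ j ∈ Finset.univ.filter (fun j : Fin m => j.castSucc < i),
    condWeight X π a φ j (I.map (tau π j.castSucc))

/-- The weight obtained by stopping the product formula for `phiTilde` at the level `i`, without
normalization. -/
def stoppedWeight (X : (i : Fin (m + 1)) → Subshift (A i) ℕ)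
    (π : (i : Fin m) → A i.castSucc → A i.succ) (a : Fin (m + 1) → ℝ) (φ : List (A 0) → ℝ≥0)
    (i : Fin (m + 1)) (I : List (A 0)) : ℝ≥0 :=
  partialWeight X π a φ i I * phiLevel X π a φ i (I.map (tau π i)) ^ (1 / psum a i)

lemma partialWeight_zero (I : List (A 0)) : partialWeight X π a φ 0 I = 1 := by
  simp [partialWeight]

lemma partialWeight_succ (i : Fin m) (I : List (A 0)) :
    partialWeight X π a φ i.succ I =
      partialWeight X π a φ i.castSucc I * condWeight X π a φ i (I.map (tau π i.castSucc)) := by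
  unfold partialWeight
  rw [filter_castSucc_lt_succ, Finset.prod_insert (by simp), mul_comm]

lemma phiTilde_eq (I : List (A 0)) :
    phiTilde X π a φ I = stoppedWeight X π a φ (Fin.last m) I / phiTop X π a φ I.length := by
  unfold phiTilde stoppedWeight partialWeight
  rw [mul_div_assoc]
  congr 1
  rw [Finset.filter_true_of_mem (fun j _ => Fin.castSucc_lt_last j)]
  refine Finset.prod_congr rfl fun i _ => ?_
  rw [map_tau_succ]
  rfl

/-- `φ` is sub-multiplicative on the language, up to the constant `C`. -/
def SubMul {A : Type*} [TopologicalSpace A] (X : Subshift A ℕ) (C : ℝ≥0) (φ : List A → ℝ≥0) :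
    Prop := 0 < C ∧ ∀ I J, I ++ J ∈ lang X → φ (I ++ J) ≤ C * φ I * φ J

lemma SubMul.rpow {A : Type*} [TopologicalSpace A] {X : Subshift A ℕ} {C : ℝ≥0}
    {φ : List A → ℝ≥0} (h : SubMul X C φ) {t : ℝ} (ht : 0 ≤ t) :
    SubMul X (C ^ t) (fun I => φ I ^ t) := by
  refine ⟨NNReal.rpow_pos h.1, fun I J hIJ => ?_⟩
  rw [← NNReal.mul_rpow, ← NNReal.mul_rpow]
  exact NNReal.rpow_le_rpow (h.2 I J hIJ) ht

/-- A word over `J₁ J₂` is a word over `J₁` followed by one over `J₂`, so the fibre sum is at most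
the product of the fibre sums. The powers `1 / s` and `s` preserve such bounds. -/
lemma exists_subMul_phiLevel (ha0 : 0 < a 0) (ha : ∀ i, 0 ≤ a i) {C : ℝ≥0}
    (h : SubMul (X 0) C φ) (i : Fin (m + 1)) : ∃ C', SubMul (X i) C' (phiLevel X π a φ i) := by
  classical
  induction i using Fin.induction with
  | zero => exact ⟨C, h⟩
  | succ i ih =>
    obtain ⟨C', hC'⟩ := ih
    set s := psum a i.castSucc
    have hs : 0 < s := psum_pos ha0 ha _
    have hr := hC'.rpow (t := 1 / s) (by positivity)
    refine ⟨(C' ^ (1 / s)) ^ s, NNReal.rpow_pos hr.1, fun J₁ J₂ _ => ?_⟩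
    rw [phiLevel_succ, phiLevel_succ, phiLevel_succ, ← NNReal.mul_rpow, ← NNReal.mul_rpow,
      List.length_append]
    refine NNReal.rpow_le_rpow ?_ hs.le
    refine sum_langN_add_le (X := X i.castSucc) _ _ (fun I J _ => hr.2 I J) _ _ _ ?_
    intro I J hI hJ hIJ
    rw [List.map_append] at hIJ
    exact List.append_inj hIJ (by simp [hI])

lemma exists_phiTop_add_le (ha0 : 0 < a 0) (ha : ∀ i, 0 ≤ a i) {C : ℝ≥0}
    (h : SubMul (X 0) C φ) : ∃ C' : ℝ≥0, 0 < C' ∧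
      ∀ n k, phiTop X π a φ (n + k) ≤ C' * phiTop X π a φ n * phiTop X π a φ k := by
  obtain ⟨C', hC'⟩ := exists_subMul_phiLevel (π := π) ha0 ha h (Fin.last m)
  have hr := hC'.rpow (t := 1 / psum a (Fin.last m))
    (by have := psum_pos ha0 ha (Fin.last m); positivity)
  refine ⟨_, hr.1, fun n k => ?_⟩
  set g := fun I => phiLevel X π a φ (Fin.last m) I ^ (1 / psum a (Fin.last m))
  have := sum_langN_add_le (X := X (Fin.last m)) (g := g) (g₁ := g) (g₂ := g) n k
    (fun I J _ => hr.2 I J) (fun _ => True) (fun _ => True) (fun _ => True) (fun _ _ _ _ _ => ⟨trivial, trivial⟩)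
  simp only [Finset.filter_true] at this
  exact this

open Classical in
lemma sum_fiber_phiLevel (ha0 : 0 < a 0) (ha : ∀ i, 0 ≤ a i) (i : Fin m) (J : List (A i.succ)) :
    ∑ I ∈ (langN (X i.castSucc) J.length).filter (fun I => I.map (π i) = J),
      phiLevel X π a φ i.castSucc I ^ (1 / psum a i.castSucc) =
    phiLevel X π a φ i.succ J ^ (1 / psum a i.castSucc) := by
  have hs := psum_pos ha0 ha i.castSucc
  rw [phiLevel_succ, ← NNReal.rpow_mul, mul_one_div_cancel hs.ne', NNReal.rpow_one]

lemma phiLevel_succ_ne_zero (ha0 : 0 < a 0) (ha : ∀ i, 0 ≤ a i) (i : Fin m)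
    {I : List (A i.castSucc)} (hI : I ∈ lang (X i.castSucc))
    (h : phiLevel X π a φ i.castSucc I ≠ 0) : phiLevel X π a φ i.succ (I.map (π i)) ≠ 0 := by
  classical
  have hs := psum_pos ha0 ha i.castSucc
  intro h0
  have hsum := sum_fiber_phiLevel (X := X) (π := π) (φ := φ) ha0 ha i (I.map (π i))
  rw [h0, NNReal.zero_rpow (by positivity), Finset.sum_eq_zero_iff] at hsum
  have := hsum I (Finset.mem_filter.2 ⟨mem_langN.2 ⟨hI, by simp⟩, rfl⟩)
  rw [NNReal.rpow_eq_zero (by positivity)] at this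
  exact h this

lemma phiLevel_ne_zero (hπ : IsOneBlockTower X π) (ha0 : 0 < a 0) (ha : ∀ i, 0 ≤ a i)
    (i : Fin (m + 1)) {I : List (A 0)} (hI : I ∈ lang (X 0)) (h : φ I ≠ 0) :
    phiLevel X π a φ i (I.map (tau π i)) ≠ 0 := by
  induction i using Fin.induction with
  | zero => simpa using h
  | succ i ih =>
    rw [map_tau_succ]
    exact phiLevel_succ_ne_zero ha0 ha i (hπ.map_tau_mem_lang _ hI) ih

/-- Summing the relative weights of the level `i` over the fibres. -/
lemma sum_condWeight_mul (hπ : IsOneBlockTower X π) (ha0 : 0 < a 0) (ha : ∀ i, 0 ≤ a i)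
    (i : Fin m) (n : ℕ) (w : List (A i.succ) → ℝ≥0) :
    ∑ I ∈ langN (X i.castSucc) n, condWeight X π a φ i I * w (I.map (π i)) =
      ∑ J ∈ (langN (X i.succ) n).filter (fun J => phiLevel X π a φ i.succ J ≠ 0), w J := by
  classical
  have hs := psum_pos ha0 ha i.castSucc
  rw [← Finset.sum_fiberwise_of_maps_to (s := langN (X i.castSucc) n) (t := langN (X i.succ) n)
    (g := fun I => I.map (π i))]
  · rw [Finset.sum_filter]
    refine Finset.sum_congr rfl fun J hJ => ?_
    obtain ⟨-, rfl⟩ := mem_langN.1 hJ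
    have : ∑ I ∈ (langN (X i.castSucc) J.length).filter (fun I => I.map (π i) = J),
        condWeight X π a φ i I * w (I.map (π i)) =
        (∑ I ∈ (langN (X i.castSucc) J.length).filter (fun I => I.map (π i) = J),
          phiLevel X π a φ i.castSucc I ^ (1 / psum a i.castSucc)) *
          ((phiLevel X π a φ i.succ J ^ (1 / psum a i.castSucc))⁻¹ * w J) := by
      rw [Finset.sum_mul]
      refine Finset.sum_congr rfl fun I hI => ?_
      rw [condWeight, (Finset.mem_filter.1 hI).2, div_eq_mul_inv, mul_assoc]
    rw [this, sum_fiber_phiLevel ha0 ha]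
    -- If the image has weight zero, the whole fibre has weight zero, the quotients are `0 / 0 = 0`,
    -- and the image drops out of the sum.
    split_ifs with h
    · rw [← mul_assoc, mul_inv_cancel₀, one_mul]
      rwa [Ne, NNReal.rpow_eq_zero (by positivity)]
    · rw [not_not.1 h, NNReal.zero_rpow (by positivity), zero_mul]
  · intro I hI
    obtain ⟨hI, hl⟩ := mem_langN.1 hI
    exact mem_langN.2 ⟨hπ.map_mem_lang i hI, by simp [hl]⟩

/-- The relative weights act as conditional probabilities along the fibres and are summed out level
by level. Over words of weight zero there is no mass to recover, whence the condition on `w`. -/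
lemma sum_partialWeight_mul (hπ : IsOneBlockTower X π) (ha0 : 0 < a 0) (ha : ∀ i, 0 ≤ a i)
    (i : Fin (m + 1)) (n : ℕ) (w : List (A i) → ℝ≥0)
    (hw : ∀ J, phiLevel X π a φ i J = 0 → w J = 0) :
    ∑ I ∈ langN (X 0) n, partialWeight X π a φ i I * w (I.map (tau π i)) =
      ∑ J ∈ langN (X i) n, w J := by
  induction i using Fin.induction with
  | zero => simp [partialWeight_zero]
  | succ i ih =>
    have hs := psum_pos ha0 ha i.castSucc
    have := ih (fun I => condWeight X π a φ i I * w (I.map (π i))) (by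
      intro J hJ
      simp only [condWeight]
      rw [hJ, NNReal.zero_rpow (by positivity), zero_div, zero_mul])
    simp only [partialWeight_succ, mul_assoc, map_tau_succ]
    rw [this, sum_condWeight_mul hπ ha0 ha, Finset.sum_filter]
    refine Finset.sum_congr rfl fun J _ => ?_
    split_ifs with h
    · rfl
    · exact (hw J (not_not.1 h)).symm

lemma sum_stoppedWeight_last (hπ : IsOneBlockTower X π) (ha0 : 0 < a 0) (ha : ∀ i, 0 ≤ a i)
    (n : ℕ) : ∑ I ∈ langN (X 0) n, stoppedWeight X π a φ (Fin.last m) I = phiTop X π a φ n := by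
  have hs := psum_pos ha0 ha (Fin.last m)
  refine sum_partialWeight_mul hπ ha0 ha (Fin.last m) n
    (fun J => phiLevel X π a φ (Fin.last m) J ^ (1 / psum a (Fin.last m))) ?_
  intro J hJ
  simp only [hJ]
  exact NNReal.zero_rpow (by positivity)

lemma sum_phiTilde (hπ : IsOneBlockTower X π) (ha0 : 0 < a 0) (ha : ∀ i, 0 ≤ a i)
    {n : ℕ} (hZ : phiTop X π a φ n ≠ 0) : ∑ I ∈ langN (X 0) n, phiTilde X π a φ I = 1 := by
  rw [← div_self hZ, ← sum_stoppedWeight_last hπ ha0 ha, Finset.sum_div]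
  refine Finset.sum_congr rfl fun I hI => ?_
  rw [phiTilde_eq, (mem_langN.1 hI).2, sum_stoppedWeight_last hπ ha0 ha]

lemma stoppedWeight_zero (I : List (A 0)) :
    stoppedWeight X π a φ 0 I = φ I ^ (1 / a 0) := by
  simp [stoppedWeight, partialWeight_zero, psum_zero]

/-- The new level enters with the exponent `-1 / s_i` from the relative weight and `1 / s_{i+1}`
from the last factor. Since the partial sums of `a` increase, the net power stands in the
denominator, where an upper bound for the level weight is what is needed. -/
lemma stoppedWeight_succ (hπ : IsOneBlockTower X π) (ha0 : 0 < a 0) (ha : ∀ i, 0 ≤ a i)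
    (i : Fin m) {I : List (A 0)} (hI : I ∈ lang (X 0)) (h : φ I ≠ 0) :
    stoppedWeight X π a φ i.succ I = stoppedWeight X π a φ i.castSucc I *
      (phiLevel X π a φ i.succ (I.map (tau π i.succ)) ^
        (1 / psum a i.castSucc - 1 / psum a i.succ))⁻¹ := by
  have h0 := phiLevel_ne_zero (φ := φ) hπ ha0 ha i.succ hI h
  simp only [stoppedWeight, partialWeight_succ, condWeight]
  rw [NNReal.rpow_sub h0, inv_div, ← map_tau_succ]
  ring

lemma ne_zero_of_stoppedWeight_ne_zero (ha0 : 0 < a 0) (i : Fin (m + 1))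
    {I : List (A 0)} (h : stoppedWeight X π a φ i I ≠ 0) : φ I ≠ 0 := by
  induction i using Fin.induction with
  | zero =>
    intro h0
    rw [stoppedWeight_zero, h0, NNReal.zero_rpow (by positivity)] at h
    exact h rfl
  | succ i ih =>
    refine ih ?_
    simp only [stoppedWeight, partialWeight_succ, condWeight, div_eq_mul_inv] at h ⊢
    intro h0
    apply h
    rw [mul_comm, ← mul_assoc _ _ (_⁻¹), h0]
    simp

lemma stoppedWeight_ne_zero (hπ : IsOneBlockTower X π) (ha0 : 0 < a 0) (ha : ∀ i, 0 ≤ a i)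
    (i : Fin (m + 1)) {I : List (A 0)} (hI : I ∈ lang (X 0)) (h : φ I ≠ 0) :
    stoppedWeight X π a φ i I ≠ 0 := by
  induction i using Fin.induction with
  | zero =>
    rw [stoppedWeight_zero]
    exact (NNReal.rpow_pos (pos_iff_ne_zero.2 h)).ne'
  | succ i ih =>
    rw [stoppedWeight_succ hπ ha0 ha i hI h]
    exact mul_ne_zero ih (inv_ne_zero (NNReal.rpow_pos (pos_iff_ne_zero.2
      (phiLevel_ne_zero hπ ha0 ha _ hI h))).ne')

/-- The stopped weights are super-multiplicative along words at which `φ` is super-multiplicative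
and its factors are sub-multiplicative. -/
lemma exists_stoppedWeight_mul_le (hπ : IsOneBlockTower X π) (ha0 : 0 < a 0) (ha : ∀ i, 0 ≤ a i)
    {b : ℝ≥0} (hb : 0 < b) {M : Fin (m + 1) → ℝ≥0} (hM : ∀ i, 0 < M i) (i : Fin (m + 1)) :
    ∃ e : ℝ≥0, 0 < e ∧ ∀ I ∈ lang (X 0), ∀ J ∈ lang (X 0), ∀ W ∈ lang (X 0),
      b * φ I * φ J ≤ φ W →
      (∀ i, phiLevel X π a φ i (W.map (tau π i)) ≤
        M i * phiLevel X π a φ i (I.map (tau π i)) * phiLevel X π a φ i (J.map (tau π i))) →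
      e * stoppedWeight X π a φ i I * stoppedWeight X π a φ i J ≤ stoppedWeight X π a φ i W := by
  induction i using Fin.induction with
  | zero =>
    refine ⟨b ^ (1 / a 0), NNReal.rpow_pos hb, fun I _ J _ W _ h _ => ?_⟩
    simp only [stoppedWeight_zero]
    rw [← NNReal.mul_rpow, ← NNReal.mul_rpow]
    exact NNReal.rpow_le_rpow h (by positivity)
  | succ i ih =>
    obtain ⟨e, he, ih⟩ := ih
    set t := 1 / psum a i.castSucc - 1 / psum a i.succ with ht
    have ht0 : 0 ≤ t := sub_nonneg.2 (one_div_le_one_div_of_le (psum_pos ha0 ha _)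
      (psum_mono ha (Fin.castSucc_lt_succ (i := i)).le))
    refine ⟨e * (M i.succ ^ t)⁻¹, mul_pos he (inv_pos.2 (NNReal.rpow_pos (hM _))),
      fun I hI J hJ W hW h hsub => ?_⟩
    -- If a factor vanishes there is nothing to prove. Otherwise `φ` is positive at `I` and `J`,
    -- hence at `W`, as the quotient formula requires.
    by_cases hI0 : stoppedWeight X π a φ i.succ I = 0
    · simp [hI0]
    by_cases hJ0 : stoppedWeight X π a φ i.succ J = 0
    · simp [hJ0]
    have hφI := ne_zero_of_stoppedWeight_ne_zero ha0 _ hI0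
    have hφJ := ne_zero_of_stoppedWeight_ne_zero ha0 _ hJ0
    have hφW : φ W ≠ 0 := (lt_of_lt_of_le (by positivity) h).ne'
    rw [stoppedWeight_succ hπ ha0 ha i hI hφI, stoppedWeight_succ hπ ha0 ha i hJ hφJ,
      stoppedWeight_succ hπ ha0 ha i hW hφW, ← ht]
    have h1 := ih I hI J hJ W hW h hsub
    have h2 := NNReal.rpow_le_rpow (hsub i.succ) ht0
    rw [NNReal.mul_rpow, NNReal.mul_rpow] at h2
    have hpos : 0 < phiLevel X π a φ i.succ (W.map (tau π i.succ)) ^ t :=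
      NNReal.rpow_pos (pos_iff_ne_zero.2 (phiLevel_ne_zero hπ ha0 ha _ hW hφW))
    calc _ = (e * stoppedWeight X π a φ i.castSucc I * stoppedWeight X π a φ i.castSucc J) *
          (M i.succ ^ t * phiLevel X π a φ i.succ (I.map (tau π i.succ)) ^ t *
            phiLevel X π a φ i.succ (J.map (tau π i.succ)) ^ t)⁻¹ := by
          rw [mul_inv, mul_inv]; ring
      _ ≤ _ := mul_le_mul' h1 (inv_anti₀ hpos h2)

end TowerWeights

/-! ### Consequences of the weight classes on one level -/

section OneLevelWeights

variable {A : Type*} [TopologicalSpace A] {X : Subshift A ℕ} {p : ℕ} {φ : List A → ℝ≥0}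
  {S : Finset ℕ} {c C : ℝ≥0}

lemma MemDw.exists_subMul (h : MemDw X p φ) : ∃ C, SubMul X C φ := by
  obtain ⟨-, c, hc, -, h, -⟩ := h
  exact ⟨c⁻¹, inv_pos.2 hc, h⟩

lemma MemDw.exists_connects (h : MemDw X p φ) : ∃ c, Connects X (Finset.range (p + 1)) c φ := by
  obtain ⟨-, c, hc, -, -, h⟩ := h
  refine ⟨c, hc, fun I hI J hJ => ?_⟩
  obtain ⟨K, -, hK, h⟩ := h I hI J hJ
  exact ⟨K, by simpa [Nat.lt_succ_iff] using hK, h⟩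

lemma MemD.exists_connects (h : MemD X p φ) : ∃ c, Connects X {p} c φ := by
  obtain ⟨-, c, hc, -, -, h⟩ := h
  refine ⟨c, hc, fun I hI J hJ => ?_⟩
  obtain ⟨K, -, hK, h⟩ := h I hI J hJ
  exact ⟨K, by simpa using hK, h⟩

lemma MemDw.carrier_nonempty (h : MemDw X p φ) : X.carrier.Nonempty := by
  obtain ⟨⟨I, hI, hne, -⟩, -⟩ := h
  rcases hI with rfl | ⟨x, hx, -⟩
  · exact absurd rfl hne
  · exact ⟨x, hx⟩

lemma SubMul.nil_ne_zero (h : SubMul X C φ) {I : List A} (hI : I ∈ lang X) (h0 : φ I ≠ 0) :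
    φ [] ≠ 0 := by
  intro hnil
  have := h.2 [] I (by simpa using hI)
  rw [hnil, List.nil_append, mul_zero, zero_mul] at this
  exact h0 (le_antisymm this zero_le)

/-- Connect the word with a fixed nonempty word `J` of positive weight and keep only the adjacent
letter. The discarded part has bounded length, so by sub-multiplicativity discarding it costs a
bounded factor. -/
lemma exists_extendable [Finite A] (hsub : SubMul X C φ) (hcon : Connects X S c φ)
    {J : List A} (hJ : J ∈ lang X) (hne : J ≠ []) (h0 : φ J ≠ 0) : ∃ d, Extendable X d φ := by
  obtain ⟨M, hM, hbound⟩ := exists_bound_of_length_le φ (S.sup id + J.length)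
  have hC := hsub.1
  have hc := hcon.pos
  have hφJ : 0 < φ J := pos_iff_ne_zero.2 h0
  have hS : ∀ k ∈ S, k ≤ S.sup id := fun k hk => Finset.le_sup (f := id) hk
  have hmin : ∀ x y : ℝ≥0, c * φ J * x ≤ C * M * y → min 1 (c * φ J / (C * M)) * x ≤ y := by
    intro x y h
    calc _ ≤ c * φ J / (C * M) * x := mul_le_mul' (min_le_right _ _) le_rfl
      _ = (c * φ J * x) / (C * M) := by ring
      _ ≤ (C * M * y) / (C * M) := by gcongr
      _ = y := by field_simp
  refine ⟨min 1 (c * φ J / (C * M)), lt_min one_pos (by positivity), min_le_left _ _, ?_, ?_⟩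
  · intro I hI
    obtain ⟨K, hK, hL, hle⟩ := hcon.connect J hJ I hI
    obtain ⟨W, b, hW⟩ : ∃ W b, J ++ K = W ++ [b] :=
      (List.eq_nil_or_concat' (J ++ K)).resolve_left (by simp [hne])
    have hWlen : W.length ≤ S.sup id + J.length := by
      have := congrArg List.length hW
      have := hS _ hK
      simp only [List.length_append, List.length_singleton] at *
      omega
    rw [hW, List.append_assoc] at hL hle
    refine ⟨b, lang_of_append_right hL, hmin _ _ (hle.trans ((hsub.2 _ _ hL).trans ?_))⟩
    gcongr
    · exact hbound W hWlen
    · exact le_rfl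
  · intro I hI
    obtain ⟨K, hK, hL, hle⟩ := hcon.connect I hI J hJ
    obtain ⟨b, W, hW⟩ : ∃ b W, K ++ J = b :: W := List.exists_cons_of_ne_nil (by simp [hne])
    have hWlen : W.length ≤ S.sup id + J.length := by
      have := congrArg List.length hW
      have := hS _ hK
      simp only [List.length_append, List.length_cons] at *
      omega
    rw [List.append_assoc, hW, ← List.singleton_append, ← List.append_assoc] at hL hle
    refine ⟨b, lang_of_append_left hL, hmin _ _ ?_⟩
    calc c * φ J * φ I = c * φ I * φ J := by ring
      _ ≤ φ (I ++ [b] ++ W) := hle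
      _ ≤ C * φ (I ++ [b]) * φ W := hsub.2 _ _ hL
      _ ≤ C * φ (I ++ [b]) * M := by gcongr; exact hbound W hWlen
      _ = C * M * φ (I ++ [b]) := by ring

lemma Extendable.exists_langN_ne_zero [Finite A] (h : Extendable X c φ) (h0 : φ [] ≠ 0) (n : ℕ) :
    ∃ I ∈ langN X n, φ I ≠ 0 := by
  obtain ⟨R, hR, hL, hle⟩ := h.pad_right n nil_mem_lang
  refine ⟨R, mem_langN.2 ⟨hL, hR⟩, ?_⟩
  have := h.pos
  exact (lt_of_lt_of_le (mul_pos (pow_pos this n) (pos_iff_ne_zero.2 h0)) hle).ne'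

end OneLevelWeights

/-! ### Connecting words for the normalized weight; growth of the partition sums -/

section TowerWeights

variable {m : ℕ} {A : Fin (m + 1) → Type*} {a : Fin (m + 1) → ℝ} [∀ i, TopologicalSpace (A i)]
  {X : (i : Fin (m + 1)) → Subshift (A i) ℕ} {π : (i : Fin m) → A i.castSucc → A i.succ}
  [∀ i, Finite (A i)] {φ : List (A 0) → ℝ≥0} {C c d : ℝ≥0} {S : Finset ℕ}

lemma phiTop_ne_zero (hπ : IsOneBlockTower X π) (ha0 : 0 < a 0) (ha : ∀ i, 0 ≤ a i)
    (hne : ∀ n, ∃ I ∈ langN (X 0) n, φ I ≠ 0) (n : ℕ) : phiTop X π a φ n ≠ 0 := by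
  obtain ⟨I, hI, h0⟩ := hne n
  rw [← sum_stoppedWeight_last hπ ha0 ha]
  intro hsum
  rw [Finset.sum_eq_zero_iff] at hsum
  exact stoppedWeight_ne_zero hπ ha0 ha _ (mem_langN.1 hI).1 h0 (hsum I hI)

lemma exists_phiLevel_connect_le (hπ : IsOneBlockTower X π) (ha0 : 0 < a 0) (ha : ∀ i, 0 ≤ a i)
    (hsub : SubMul (X 0) C φ) (q : ℕ) :
    ∃ M : Fin (m + 1) → ℝ≥0, (∀ i, 0 < M i) ∧ ∀ I K J : List (A 0), K.length ≤ q →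
      I ++ K ++ J ∈ lang (X 0) → ∀ i, phiLevel X π a φ i ((I ++ K ++ J).map (tau π i)) ≤
        M i * phiLevel X π a φ i (I.map (tau π i)) * phiLevel X π a φ i (J.map (tau π i)) := by
  choose D hD using fun i => exists_subMul_phiLevel (π := π) ha0 ha hsub i
  choose B hB hbound using fun i => exists_bound_of_length_le (phiLevel X π a φ i) q
  refine ⟨fun i => D i * D i * B i, fun i => mul_pos (mul_pos (hD i).1 (hD i).1) (hB i), ?_⟩
  intro I K J hK hL i
  have hL' := hπ.map_tau_mem_lang i hL
  rw [List.map_append, List.map_append] at hL' ⊢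
  calc _ ≤ D i * phiLevel X π a φ i (I.map (tau π i) ++ K.map (tau π i)) *
        phiLevel X π a φ i (J.map (tau π i)) := (hD i).2 _ _ hL'
    _ ≤ D i * (D i * phiLevel X π a φ i (I.map (tau π i)) *
          phiLevel X π a φ i (K.map (tau π i))) * phiLevel X π a φ i (J.map (tau π i)) := by
        gcongr
        exact (hD i).2 _ _ (lang_of_append_left hL')
    _ ≤ D i * (D i * phiLevel X π a φ i (I.map (tau π i)) * B i) *
          phiLevel X π a φ i (J.map (tau π i)) := by
        gcongr
        exact hbound i _ (by simpa using hK)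
    _ = _ := by ring

/-- The connecting word for `φ` serves again: the level weights of `K` are bounded since its length
is. -/
lemma exists_stoppedWeight_connect (hπ : IsOneBlockTower X π) (ha0 : 0 < a 0)
    (ha : ∀ i, 0 ≤ a i) (hsub : SubMul (X 0) C φ) (hcon : Connects (X 0) S c φ) :
    ∃ e, Connects (X 0) S e (stoppedWeight X π a φ (Fin.last m)) := by
  obtain ⟨M, hM, hMle⟩ := exists_phiLevel_connect_le (π := π) hπ ha0 ha hsub (S.sup id)
  obtain ⟨e, he, h⟩ := exists_stoppedWeight_mul_le (φ := φ) hπ ha0 ha hcon.pos hM (Fin.last m)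
  refine ⟨e, he, fun I hI J hJ => ?_⟩
  obtain ⟨K, hK, hL, hle⟩ := hcon.connect I hI J hJ
  exact ⟨K, hK, hL, h I hI J hJ _ hL hle (hMle I K J (Finset.le_sup (f := id) hK) hL)⟩

lemma exists_stoppedWeight_extendable (hπ : IsOneBlockTower X π) (ha0 : 0 < a 0)
    (ha : ∀ i, 0 ≤ a i) (hsub : SubMul (X 0) C φ) (hext : Extendable (X 0) c φ) (h0 : φ [] ≠ 0) :
    ∃ e, Extendable (X 0) e (stoppedWeight X π a φ (Fin.last m)) := by
  have hnil : ∀ i, phiLevel X π a φ i [] ≠ 0 := fun i => by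
    simpa using phiLevel_ne_zero (φ := φ) hπ ha0 ha i nil_mem_lang h0
  choose D hD using fun i => exists_subMul_phiLevel (π := π) ha0 ha hsub i
  choose B hB hbound using fun i => exists_bound_of_length_le (phiLevel X π a φ i) 1
  have hT0 := stoppedWeight_ne_zero (φ := φ) hπ ha0 ha (Fin.last m) nil_mem_lang h0
  set T := stoppedWeight X π a φ (Fin.last m) with hT
  -- A one-letter extension of `I` is treated as a word joining `I` and the empty word. The
  -- constants are divided by the weights of the empty word to cancel them in the hypotheses.
  obtain ⟨e, he, h⟩ := exists_stoppedWeight_mul_le (φ := φ) hπ ha0 ha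
    (b := c / φ []) (div_pos hext.pos (pos_iff_ne_zero.2 h0))
    (M := fun i => D i * B i / phiLevel X π a φ i [])
    (fun i => div_pos (mul_pos (hD i).1 (hB i)) (pos_iff_ne_zero.2 (hnil i))) (Fin.last m)
  have key : ∀ I ∈ lang (X 0), ∀ W ∈ lang (X 0), c * φ I ≤ φ W →
      (∀ i, phiLevel X π a φ i (W.map (tau π i)) ≤
        D i * B i * phiLevel X π a φ i (I.map (tau π i))) → min 1 (e * T []) * T I ≤ T W := by
    intro I hI W hW hφ hlev
    have := h I hI [] nil_mem_lang W hW ?_ ?_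
    · calc _ ≤ e * T [] * T I := mul_le_mul' (min_le_right _ _) le_rfl
        _ = e * T I * T [] := by ring
        _ ≤ _ := this
    · refine le_trans (le_of_eq ?_) hφ
      field_simp
    · intro i
      refine (hlev i).trans (le_of_eq ?_)
      have := hnil i
      rw [List.map_nil]
      field_simp
  refine ⟨min 1 (e * T []), lt_min one_pos (mul_pos he (pos_iff_ne_zero.2 hT0)),
    min_le_left _ _, fun I hI => ?_, fun I hI => ?_⟩
  · obtain ⟨b, hL, hle⟩ := hext.left I hI
    refine ⟨b, hL, key I hI _ hL hle fun i => ?_⟩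
    have hL' := hπ.map_tau_mem_lang i hL
    rw [← List.singleton_append, List.map_append] at hL' ⊢
    refine ((hD i).2 _ _ hL').trans ?_
    gcongr
    exact hbound i _ (by simp)
  · obtain ⟨b, hL, hle⟩ := hext.right I hI
    refine ⟨b, hL, key I hI _ hL hle fun i => ?_⟩
    have hL' := hπ.map_tau_mem_lang i hL
    rw [List.map_append] at hL' ⊢
    refine ((hD i).2 _ _ hL').trans ?_
    rw [mul_right_comm]
    gcongr
    exact hbound i _ (by simp)

/-- Normalization is harmless: the partition sum of the joined word is at most a constant times the
product of the two partition sums. -/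
lemma connects_phiTilde (ha0 : 0 < a 0) (ha : ∀ i, 0 ≤ a i)
    (hsub : SubMul (X 0) C φ) (hZ : ∀ n, phiTop X π a φ n ≠ 0)
    (hcon : Connects (X 0) S c (stoppedWeight X π a φ (Fin.last m))) :
    ∃ e, Connects (X 0) S e (phiTilde X π a φ) := by
  obtain ⟨D, hD, hZle⟩ := exists_phiTop_add_le (π := π) ha0 ha hsub
  obtain ⟨B, hB⟩ := ((Set.finite_Iic (S.sup id)).image (phiTop X π a φ)).bddAbove
  have hB' : ∀ k ∈ S, phiTop X π a φ k ≤ B + 1 := fun k hk =>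
    (hB ⟨k, Finset.le_sup (f := id) hk, rfl⟩).trans (le_add_of_nonneg_right zero_le_one)
  have hc := hcon.pos
  refine ⟨c / (D * D * (B + 1)), by positivity, fun I hI J hJ => ?_⟩
  obtain ⟨K, hK, hL, hle⟩ := hcon.connect I hI J hJ
  refine ⟨K, hK, hL, ?_⟩
  simp only [phiTilde_eq]
  set T := stoppedWeight X π a φ (Fin.last m)
  have h1 : phiTop X π a φ (I ++ K ++ J).length ≤
      (D * D * (B + 1)) * phiTop X π a φ I.length * phiTop X π a φ J.length := by
    rw [List.length_append, List.length_append]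
    calc _ ≤ D * phiTop X π a φ (I.length + K.length) * phiTop X π a φ J.length := hZle _ _
      _ ≤ D * (D * phiTop X π a φ I.length * (B + 1)) * phiTop X π a φ J.length := by
          gcongr
          refine (hZle _ _).trans ?_
          gcongr
          exact hB' _ hK
      _ = _ := by ring
  calc c / (D * D * (B + 1)) * (T I / phiTop X π a φ I.length) *
        (T J / phiTop X π a φ J.length) = (c * T I * T J) /
          ((D * D * (B + 1)) * phiTop X π a φ I.length * phiTop X π a φ J.length) := by
        field_simp
    _ ≤ T (I ++ K ++ J) / ((D * D * (B + 1)) * phiTop X π a φ I.length *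
          phiTop X π a φ J.length) := by gcongr
    _ ≤ _ := by
        have := pos_iff_ne_zero.2 (hZ (I ++ K ++ J).length)
        gcongr

lemma extendable_phiTilde (ha0 : 0 < a 0) (ha : ∀ i, 0 ≤ a i)
    (hsub : SubMul (X 0) C φ) (hZ : ∀ n, phiTop X π a φ n ≠ 0)
    (hext : Extendable (X 0) c (stoppedWeight X π a φ (Fin.last m))) :
    ∃ e, Extendable (X 0) e (phiTilde X π a φ) := by
  obtain ⟨D, hD, hZle⟩ := exists_phiTop_add_le (π := π) ha0 ha hsub
  have hc := hext.pos
  have hZ1 := pos_iff_ne_zero.2 (hZ 1)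
  have key : ∀ I W : List (A 0), W.length = I.length + 1 →
      c * stoppedWeight X π a φ (Fin.last m) I ≤ stoppedWeight X π a φ (Fin.last m) W →
      min 1 (c / (D * phiTop X π a φ 1)) * phiTilde X π a φ I ≤ phiTilde X π a φ W := by
    intro I W hlen hle
    rw [phiTilde_eq, phiTilde_eq, hlen]
    have h1 := pos_iff_ne_zero.2 (hZ (I.length + 1))
    have h2 := pos_iff_ne_zero.2 (hZ I.length)
    set T := stoppedWeight X π a φ (Fin.last m)
    calc _ ≤ c / (D * phiTop X π a φ 1) * (T I / phiTop X π a φ I.length) :=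
          mul_le_mul' (min_le_right _ _) le_rfl
      _ = (c * T I) / (D * phiTop X π a φ I.length * phiTop X π a φ 1) := by field_simp
      _ ≤ T W / (D * phiTop X π a φ I.length * phiTop X π a φ 1) := by gcongr
      _ ≤ _ := by
          gcongr
          exact hZle _ _
  refine ⟨min 1 (c / (D * phiTop X π a φ 1)), lt_min one_pos (by positivity), min_le_left _ _,
    fun I hI => ?_, fun I hI => ?_⟩
  · obtain ⟨b, hL, hle⟩ := hext.left I hI
    exact ⟨b, hL, key I _ (by simp) hle⟩
  · obtain ⟨b, hL, hle⟩ := hext.right I hI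
    exact ⟨b, hL, key I _ (by simp) hle⟩

variable [∀ i, MeasurableSpace (A i)] [∀ i, DiscreteMeasurableSpace (A i)]

/-- For each connecting length, a joined word determines the two words it joins. Summing the
connecting bound over all pairs therefore bounds `Z n * Z k` by a constant times partition sums at
the lengths `n + j + k`, `j ∈ S`, and these are comparable with `Z (n + k)` from above. -/
lemma exists_phiTop_mul_le (hπ : IsOneBlockTower X π) (ha0 : 0 < a 0) (ha : ∀ i, 0 ≤ a i)
    (hX : (X 0).carrier.Nonempty) (hsub : SubMul (X 0) C φ) (hZ : ∀ n, phiTop X π a φ n ≠ 0)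
    (hcon : Connects (X 0) S c (stoppedWeight X π a φ (Fin.last m))) :
    ∃ D : ℝ≥0, 0 < D ∧
      ∀ n k, phiTop X π a φ n * phiTop X π a φ k ≤ D * phiTop X π a φ (n + k) := by
  obtain ⟨pt, hpt⟩ := exists_isSelection hX
  obtain ⟨D, hD, hZle⟩ := exists_phiTop_add_le (π := π) ha0 ha hsub
  obtain ⟨B, hB⟩ := ((Set.finite_Iic (S.sup id)).image (phiTop X π a φ)).bddAbove
  have hB' : ∀ k ∈ S, phiTop X π a φ k ≤ B + 1 := fun k hk =>
    (hB ⟨k, Finset.le_sup (f := id) hk, rfl⟩).trans (le_add_of_nonneg_right zero_le_one)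
  have hc := hcon.pos
  refine ⟨(S.card * S.card + 1) * D * (B + 1) / c, by positivity, fun n k => ?_⟩
  have hn := pos_iff_ne_zero.2 (hZ n)
  have hk := pos_iff_ne_zero.2 (hZ k)
  have hnk := pos_iff_ne_zero.2 (hZ (n + k))
  have h1 : ∀ n, IsProbabilityMeasure (wordMeasure (X 0) (phiTilde X π a φ) pt n) := fun n =>
    isProbabilityMeasure_wordMeasure (sum_phiTilde hπ ha0 ha (hZ n))
  -- In normalized weights `e` is the connecting constant for these two lengths. The measure `ν`
  -- below is a sum of `|S|` probability measures and is evaluated once for each `j ∈ S`, so that `e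
  -- ≤ |S|²`.
  set e : ℝ≥0 := c * phiTop X π a φ n * phiTop X π a φ k / (D * (B + 1) * phiTop X π a φ (n + k))
    with he
  have hle := mul_wordMeasure_le (S := S) (c := e) (f := phiTilde X π a φ) hpt
    (ν := ∑ j ∈ S, wordMeasure (X 0) (phiTilde X π a φ) pt (n + j + k)) (ℓ := n) (v := k)
    (fun _ => 0) (fun j => n + j) ?_ (detBy_univ n) (detBy_univ k)
  · simp only [measure_univ, mul_one, Set.preimage_univ, Set.inter_univ, Measure.coe_finsetSum,
      Finset.sum_apply, Finset.sum_const, nsmul_eq_mul] at hle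
    have hle' : e ≤ S.card * S.card := by exact_mod_cast hle
    rw [he, div_le_iff₀ (by positivity)] at hle'
    rw [div_mul_eq_mul_div, le_div_iff₀ hc]
    calc _ = c * phiTop X π a φ n * phiTop X π a φ k := by ring
      _ ≤ _ := hle'
      _ ≤ (S.card * S.card + 1) * (D * (B + 1) * phiTop X π a φ (n + k)) := by
          gcongr; exact le_self_add
      _ = _ := by ring
  · intro W hW V hV
    obtain ⟨hW', rfl⟩ := mem_langN.1 hW
    obtain ⟨hV', rfl⟩ := mem_langN.1 hV
    obtain ⟨K, hK, hL, hT⟩ := hcon.connect W hW' V hV'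
    refine ⟨K.length, hK, ?_⟩
    have hmem := mem_cyl_append.1 (hpt _ hL).2
    rw [mem_cyl_append, List.length_append] at hmem
    have hle := le_wordMeasure_of_mem (f := phiTilde X π a φ) (pt := pt)
      (N := W.length + K.length + V.length)
      (mem_langN.2 ⟨hL, by simp [add_assoc]⟩)
      ((measurableSet_cyl W).inter ((measurable_leftShift_iterate (W.length + K.length))
        (measurableSet_cyl V))) ⟨hmem.1.1, hmem.2⟩
    refine le_trans (ENNReal.coe_le_coe.2 ?_) (hle.trans ?_)
    · simp only [phiTilde_eq, he]
      set T := stoppedWeight X π a φ (Fin.last m)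
      have h2 : phiTop X π a φ (W ++ K ++ V).length ≤
          D * (B + 1) * phiTop X π a φ (W.length + V.length) := by
        rw [List.length_append, List.length_append,
          show W.length + K.length + V.length = W.length + V.length + K.length by omega]
        refine (hZle _ _).trans ?_
        rw [mul_right_comm]
        gcongr
        exact hB' _ hK
      have h3 := pos_iff_ne_zero.2 (hZ (W ++ K ++ V).length)
      calc _ = (c * T W * T V) / (D * (B + 1) * phiTop X π a φ (W.length + V.length)) := by
            field_simp
        _ ≤ T (W ++ K ++ V) / (D * (B + 1) * phiTop X π a φ (W.length + V.length)) := by gcongr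
        _ ≤ _ := by gcongr
    · rw [Measure.coe_finsetSum, Finset.sum_apply]
      exact Finset.single_le_sum (f := fun j =>
        wordMeasure (X 0) (phiTilde X π a φ) pt (W.length + j + V.length)
          (cyl W ∩ leftShift^[W.length + K.length] ⁻¹' cyl V)) (fun _ _ => zero_le) hK

end TowerWeights

/-! ### Gibbs' inequality -/

section Gibbs

/-- Termwise `log x ≤ x - 1` at `x = q i / p i`. As `Real.log 0 = 0`, zeros of `q` at charged points
have to be excluded. -/
lemma sum_mul_log_sub_log_le {ι : Type*} (s : Finset ι) (p q : ι → ℝ) (hp : ∀ i ∈ s, 0 ≤ p i)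
    (hq : ∀ i ∈ s, 0 ≤ q i) (hpq : ∀ i ∈ s, p i ≠ 0 → q i ≠ 0) :
    ∑ i ∈ s, p i * (Real.log (q i) - Real.log (p i)) ≤ ∑ i ∈ s, q i - ∑ i ∈ s, p i := by
  rw [← Finset.sum_sub_distrib]
  refine Finset.sum_le_sum fun i hi => ?_
  by_cases h : p i = 0
  · rw [h, zero_mul, sub_zero]; exact hq i hi
  · have hp' : 0 < p i := (hp i hi).lt_of_ne' h
    have hq' : 0 < q i := (hq i hi).lt_of_ne' (hpq i hi h)
    rw [← Real.log_div hq'.ne' hp'.ne']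
    have := Real.log_le_sub_one_of_pos (div_pos hq' hp')
    calc p i * Real.log (q i / p i) ≤ p i * (q i / p i - 1) := by gcongr
      _ = q i - p i := by field_simp

end Gibbs

/-! ### Means and entropies of the distribution of words -/

section OneLevel

lemma measureReal_cyl_le_take {A : Type*} [MeasurableSpace A] {ρ : Measure (ℕ → A)}
    [IsProbabilityMeasure ρ] {W : List A} (n : ℕ) : ρ.real (cyl W) ≤ ρ.real (cyl (W.take n)) := by
  refine measureReal_mono fun x hx => ?_
  rw [← List.take_append_drop n W] at hx
  exact (mem_cyl_append.1 hx).1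

lemma measureReal_cyl_le_drop {A : Type*} [Finite A] [MeasurableSpace A]
    [DiscreteMeasurableSpace A] {ρ : Measure (ℕ → A)} [IsProbabilityMeasure ρ] {W : List A} {n : ℕ} (hn : n ≤ W.length) :
    ρ.real (cyl W) ≤ (ρ.map leftShift^[n]).real (cyl (W.drop n)) := by
  rw [map_measureReal_apply (measurable_leftShift_iterate n) (measurableSet_cyl _)]
  refine measureReal_mono fun x hx => ?_
  rw [← List.take_append_drop n W] at hx
  have := (mem_cyl_append.1 hx).2
  rwa [List.length_take, min_eq_left hn] at this

variable {A : Type*} [TopologicalSpace A] [Finite A] [MeasurableSpace A]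

/-- The mean of a function of the first `n` letters. -/
def wordMean (X : Subshift A ℕ) (ρ : Measure (ℕ → A)) (n : ℕ) (g : List A → ℝ) : ℝ :=
  ∑ I ∈ langN X n, ρ.real (cyl I) * g I

/-- The entropy of the distribution of the first `n` letters. -/
def wordEntropy (X : Subshift A ℕ) (ρ : Measure (ℕ → A)) (n : ℕ) : ℝ :=
  -wordMean X ρ n (fun I => Real.log (ρ.real (cyl I)))

variable {X : Subshift A ℕ} {ρ : Measure (ℕ → A)}

lemma wordMean_congr {n : ℕ} {g g' : List A → ℝ}
    (h : ∀ I ∈ langN X n, ρ.real (cyl I) ≠ 0 → g I = g' I) :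
    wordMean X ρ n g = wordMean X ρ n g' := by
  refine Finset.sum_congr rfl fun I hI => ?_
  by_cases h0 : ρ.real (cyl I) = 0
  · simp [h0]
  · rw [h I hI h0]

lemma wordMean_mono {n : ℕ} {g g' : List A → ℝ}
    (h : ∀ I ∈ langN X n, ρ.real (cyl I) ≠ 0 → g I ≤ g' I) :
    wordMean X ρ n g ≤ wordMean X ρ n g' := by
  refine Finset.sum_le_sum fun I hI => ?_
  by_cases h0 : ρ.real (cyl I) = 0
  · simp [h0]
  · exact mul_le_mul_of_nonneg_left (h I hI h0) measureReal_nonneg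

lemma wordMean_add (n : ℕ) (g g' : List A → ℝ) :
    wordMean X ρ n (fun I => g I + g' I) = wordMean X ρ n g + wordMean X ρ n g' := by
  simp only [wordMean, mul_add, Finset.sum_add_distrib]

lemma wordMean_sub (n : ℕ) (g g' : List A → ℝ) :
    wordMean X ρ n (fun I => g I - g' I) = wordMean X ρ n g - wordMean X ρ n g' := by
  simp only [wordMean, mul_sub, Finset.sum_sub_distrib]

lemma wordMean_const_mul (n : ℕ) (t : ℝ) (g : List A → ℝ) :
    wordMean X ρ n (fun I => t * g I) = t * wordMean X ρ n g := by
  simp only [wordMean, Finset.mul_sum]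
  exact Finset.sum_congr rfl fun I _ => by ring

lemma wordMean_sum {ι : Type*} (s : Finset ι) (n : ℕ) (g : ι → List A → ℝ) :
    wordMean X ρ n (fun I => ∑ i ∈ s, g i I) = ∑ i ∈ s, wordMean X ρ n (g i) := by
  simp only [wordMean, Finset.mul_sum]
  exact Finset.sum_comm

lemma wordEntropy_nonneg [IsProbabilityMeasure ρ] (n : ℕ) : 0 ≤ wordEntropy X ρ n := by
  rw [wordEntropy, wordMean, ← Finset.sum_neg_distrib]
  refine Finset.sum_nonneg fun I _ => ?_
  have := Real.negMulLog_nonneg (x := ρ.real (cyl I)) measureReal_nonneg measureReal_le_one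
  rw [Real.negMulLog] at this
  linarith

lemma map_shift_compl_carrier [DiscreteTopology A] [DiscreteMeasurableSpace A]
    (h0 : ρ X.carrierᶜ = 0) (n : ℕ) : ρ.map leftShift^[n] X.carrierᶜ = 0 := by
  rw [Measure.map_apply (measurable_leftShift_iterate n) X.isClosed.measurableSet.compl]
  exact measure_mono_null (fun x hx hx' => hx (iterate_mem_carrier hx' _)) h0

variable [DiscreteMeasurableSpace A] [IsProbabilityMeasure ρ]

/-- Writes sums over words as integrals, so that prefixes, shifts and factor maps are handled by
change of variables. -/
lemma integral_word (h0 : ρ X.carrierᶜ = 0) (n : ℕ) (g : List A → ℝ) :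
    ∫ x, g (word x n) ∂ρ = wordMean X ρ n g := by
  have hae : (fun x => g (word x n)) =ᵐ[ρ]
      fun x => ∑ I ∈ langN X n, (cyl I).indicator (fun _ => g I) x := by
    have : ∀ᵐ x ∂ρ, x ∈ X.carrier := h0
    filter_upwards [this] with x hx
    rw [Finset.sum_eq_single_of_mem (word x n) (word_mem_langN hx n)]
    · rw [Set.indicator_of_mem (mem_cyl_word x n)]
    · intro I hI hne
      refine Set.indicator_of_notMem (fun hmem => hne ?_) _
      rw [mem_cyl, (mem_langN.1 hI).2] at hmem
      exact hmem.symm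
  rw [integral_congr_ae hae, integral_finsetSum]
  · refine Finset.sum_congr rfl fun I _ => ?_
    rw [integral_indicator_const _ (measurableSet_cyl I), smul_eq_mul]
  · intro I _
    exact (integrable_const _).indicator (measurableSet_cyl I)

lemma wordMean_const (h0 : ρ X.carrierᶜ = 0) (n : ℕ) (t : ℝ) :
    wordMean X ρ n (fun _ => t) = t := by
  rw [← integral_word h0]; simp

lemma sum_measureReal_cyl (h0 : ρ X.carrierᶜ = 0) (n : ℕ) :
    ∑ I ∈ langN X n, ρ.real (cyl I) = 1 := by
  simpa [wordMean] using wordMean_const h0 n 1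

lemma wordMean_take (h0 : ρ X.carrierᶜ = 0) (n k : ℕ) (g : List A → ℝ) :
    wordMean X ρ (n + k) (fun I => g (I.take n)) = wordMean X ρ n g := by
  rw [← integral_word h0, ← integral_word h0]
  simp [word_add, List.take_left']

lemma wordMean_drop [DiscreteTopology A] (h0 : ρ X.carrierᶜ = 0) (n k : ℕ) (g : List A → ℝ) :
    wordMean X ρ (n + k) (fun I => g (I.drop n)) = wordMean X (ρ.map leftShift^[n]) k g := by
  have : IsProbabilityMeasure (ρ.map leftShift^[n]) :=
    Measure.isProbabilityMeasure_map (measurable_leftShift_iterate n).aemeasurable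
  rw [← integral_word h0, ← integral_word (map_shift_compl_carrier h0 n),
    integral_map (measurable_leftShift_iterate n).aemeasurable]
  · simp [word_add, List.drop_left']
  · refine Measurable.aestronglyMeasurable ?_
    have : (fun x : ℕ → A => g (word x k)) =
        (fun v : Fin k → A => g (List.ofFn v)) ∘ fun (x : ℕ → A) (j : Fin k) => x j := rfl
    rw [this]
    exact (measurable_of_finite _).comp (by fun_prop)

/-- Sub-additivity of the entropy of words. -/
lemma wordEntropy_add_le [DiscreteTopology A] (h0 : ρ X.carrierᶜ = 0) (n k : ℕ) :
    wordEntropy X ρ (n + k) ≤ wordEntropy X ρ n + wordEntropy X (ρ.map leftShift^[n]) k := by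
  have : IsProbabilityMeasure (ρ.map leftShift^[n]) :=
    Measure.isProbabilityMeasure_map (measurable_leftShift_iterate n).aemeasurable
  have h0' := map_shift_compl_carrier h0 n
  set ρ' := ρ.map leftShift^[n] with hρ'
  have hpos : ∀ W ∈ langN X (n + k), ρ.real (cyl W) ≠ 0 →
      0 < ρ.real (cyl (W.take n)) ∧ 0 < ρ'.real (cyl (W.drop n)) := by
    intro W hW hne
    have h := measureReal_nonneg.lt_of_ne' hne
    exact ⟨h.trans_le (measureReal_cyl_le_take n),
      h.trans_le (measureReal_cyl_le_drop (by rw [(mem_langN.1 hW).2]; omega))⟩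
  -- Gibbs' inequality for the joint distribution against the product of the distributions of the
  -- two parts.
  have hG := sum_mul_log_sub_log_le (langN X (n + k)) (fun W => ρ.real (cyl W))
    (fun W => ρ.real (cyl (W.take n)) * ρ'.real (cyl (W.drop n)))
    (fun _ _ => measureReal_nonneg) (fun _ _ => mul_nonneg measureReal_nonneg measureReal_nonneg)
    (fun W hW hne => (mul_pos (hpos W hW hne).1 (hpos W hW hne).2).ne')
  have hq : ∑ W ∈ langN X (n + k), ρ.real (cyl (W.take n)) * ρ'.real (cyl (W.drop n)) ≤ 1 := by
    have := sum_langN_add_le (X := X) (C := 1)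
      (g := fun W => (ρ (cyl (W.take n))).toNNReal * (ρ' (cyl (W.drop n))).toNNReal)
      (g₁ := fun I => (ρ (cyl I)).toNNReal) (g₂ := fun I => (ρ' (cyl I)).toNNReal) n k
      (fun I J hI _ => by
        simp only [one_mul]
        rw [List.take_left' hI, List.drop_left' hI])
      (fun _ => True) (fun _ => True) (fun _ => True) (fun _ _ _ _ _ => ⟨trivial, trivial⟩)
    simp only [Finset.filter_true, one_mul] at this
    have h := NNReal.coe_le_coe.2 this
    push_cast at h
    refine h.trans_eq ?_
    have h1 := sum_measureReal_cyl h0 n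
    have h2 := sum_measureReal_cyl h0' k
    simp only [Measure.real] at h1 h2
    rw [h1, h2, one_mul]
  have hsplit : wordMean X ρ (n + k) (fun W =>
      Real.log (ρ.real (cyl (W.take n)) * ρ'.real (cyl (W.drop n))) - Real.log (ρ.real (cyl W))) =
      -wordEntropy X ρ n - wordEntropy X ρ' k + wordEntropy X ρ (n + k) := by
    have e1 := wordMean_take (ρ := ρ) (X := X) h0 n k (fun I => Real.log (ρ.real (cyl I)))
    have e2 := wordMean_drop (ρ := ρ) (X := X) h0 n k (fun I => Real.log (ρ'.real (cyl I)))
    rw [← hρ'] at e2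
    rw [wordEntropy, wordEntropy, wordEntropy, ← e1, ← e2, neg_neg, sub_neg_eq_add,
      ← wordMean_add, ← sub_eq_add_neg, ← wordMean_sub]
    refine wordMean_congr fun W hW hne => ?_
    rw [Real.log_mul (hpos W hW hne).1.ne' (hpos W hW hne).2.ne']
  have h1 := sum_measureReal_cyl h0 (n + k)
  have hG' : wordMean X ρ (n + k) (fun W =>
      Real.log (ρ.real (cyl (W.take n)) * ρ'.real (cyl (W.drop n))) - Real.log (ρ.real (cyl W)))
        ≤ 0 := by
    refine hG.trans ?_
    rw [h1]
    linarith
  linarith [hsplit, hG']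

/-- `φ` is positive on the words of length `n` that are charged by `ρ`. -/
def PosOn (X : Subshift A ℕ) (φ : List A → ℝ≥0) (ρ : Measure (ℕ → A)) (n : ℕ) : Prop :=
  ∀ I ∈ langN X n, ρ.real (cyl I) ≠ 0 → φ I ≠ 0

lemma wordMean_log_add_le [DiscreteTopology A] {φ : List A → ℝ≥0} {C : ℝ≥0} (hsub : SubMul X C φ)
    (h0 : ρ X.carrierᶜ = 0) {n k : ℕ} (hpos : PosOn X φ ρ (n + k)) :
    wordMean X ρ (n + k) (fun I => Real.log (φ I)) ≤
      wordMean X ρ n (fun I => Real.log (φ I)) +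
        wordMean X (ρ.map leftShift^[n]) k (fun I => Real.log (φ I)) + Real.log C := by
  rw [← wordMean_take h0 n k, ← wordMean_drop h0 n k, ← wordMean_add,
    ← wordMean_const h0 (n + k) (Real.log C), ← wordMean_add]
  refine wordMean_mono fun W hW hne => ?_
  have hφ := pos_iff_ne_zero.2 (hpos W hW hne)
  have h := hsub.2 (W.take n) (W.drop n) (by
    rw [List.take_append_drop]; exact (mem_langN.1 hW).1)
  rw [List.take_append_drop] at h
  have hp : 0 < C * φ (W.take n) * φ (W.drop n) := hφ.trans_le h
  have h1 : φ (W.take n) ≠ 0 := fun h0 => by simp [h0] at hp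
  have h2 : φ (W.drop n) ≠ 0 := fun h0 => by simp [h0] at hp
  have hC : C ≠ 0 := fun h0 => by simp [h0] at hp
  have := Real.log_le_log (by exact_mod_cast hφ) (NNReal.coe_le_coe.2 h)
  push_cast at this
  rw [Real.log_mul (by simp [hC, h1]) (by simpa using h2), Real.log_mul (by simpa using hC)
    (by simpa using h1)] at this
  linarith

end OneLevel

/-! ### Summation by parts along the levels -/

section Abel

variable {m : ℕ}

/-- Summation by parts. -/
lemma sum_psum_mul_sub (a F : Fin (m + 1) → ℝ) :
    ∑ i : Fin m, psum a i.castSucc * (F i.castSucc - F i.succ) +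
      psum a (Fin.last m) * F (Fin.last m) = ∑ i, a i * F i := by
  have key : ∀ j : Fin (m + 1),
      ∑ i ∈ Finset.univ.filter (fun i : Fin m => i.castSucc < j),
        psum a i.castSucc * (F i.castSucc - F i.succ) + psum a j * F j =
      ∑ i ∈ Finset.Iic j, a i * F i := by
    intro j
    induction j using Fin.induction with
    | zero =>
      rw [show Finset.Iic (0 : Fin (m + 1)) = {0} by ext j; simp]
      simp [psum_zero]
    | succ j ih =>
      rw [filter_castSucc_lt_succ, Iic_succ_eq_insert, Finset.sum_insert (by simp),
        Finset.sum_insert (by simp [Fin.le_def]), ← ih, psum_succ]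
      ring
  have := key (Fin.last m)
  rwa [Finset.filter_true_of_mem (fun j _ => Fin.castSucc_lt_last j),
    show Finset.Iic (Fin.last m) = Finset.univ by ext j; simp [Fin.le_last]] at this

/-- Summation by parts for the weight vector concentrated at the first level, all of whose partial
sums are `1`. -/
lemma sum_castSucc_sub_succ (F : Fin (m + 1) → ℝ) :
    ∑ i : Fin m, (F i.castSucc - F i.succ) + F (Fin.last m) = F 0 := by
  have h1 : ∀ i : Fin (m + 1), psum (Pi.single 0 1) i = 1 := by
    intro i
    unfold psum
    rw [Finset.sum_pi_single', if_pos (by simp)]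
  have := sum_psum_mul_sub (Pi.single 0 1) F
  simpa [h1, Pi.single_apply] using this

end Abel

/-! ### Images of measures on the levels -/

section Push

variable {m : ℕ} {A : Fin (m + 1) → Type*} {π : (i : Fin m) → A i.castSucc → A i.succ}

lemma measurable_map_tau [∀ i, MeasurableSpace (A i)] [∀ i, DiscreteMeasurableSpace (A i)]
    (i : Fin (m + 1)) :
    Measurable (fun (x : ℕ → A 0) (n : ℕ) => tau π i (x n)) :=
  measurable_pi_lambda _ fun n =>
    (Measurable.of_discrete (f := tau π i)).comp (measurable_pi_apply n)

lemma push_zero [∀ i, MeasurableSpace (A i)] {η : Measure (ℕ → A 0)} : push π 0 η = η := by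
  unfold push
  simp only [tau_zero, id]
  exact Measure.map_id

lemma isProbabilityMeasure_push [∀ i, MeasurableSpace (A i)] [∀ i, DiscreteMeasurableSpace (A i)]
    {η : Measure (ℕ → A 0)} [IsProbabilityMeasure η]
    (i : Fin (m + 1)) :
    IsProbabilityMeasure (push π i η) :=
  Measure.isProbabilityMeasure_map (measurable_map_tau i).aemeasurable

lemma push_map_shift [∀ i, MeasurableSpace (A i)] [∀ i, DiscreteMeasurableSpace (A i)]
    {η : Measure (ℕ → A 0)} (i : Fin (m + 1)) (n : ℕ) :
    push π i (η.map leftShift^[n]) = (push π i η).map leftShift^[n] := by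
  unfold push
  rw [Measure.map_map (measurable_map_tau i) (measurable_leftShift_iterate n),
    Measure.map_map (measurable_leftShift_iterate n) (measurable_map_tau i)]
  congr 1
  funext x
  funext j
  simp [iterate_leftShift]

lemma measureReal_cyl_le_push [∀ i, Finite (A i)] [∀ i, MeasurableSpace (A i)]
    [∀ i, DiscreteMeasurableSpace (A i)] {η : Measure (ℕ → A 0)} [IsProbabilityMeasure η]
    (i : Fin (m + 1)) (I : List (A 0)) :
    η.real (cyl I) ≤ (push π i η).real (cyl (I.map (tau π i))) := by
  rw [push, map_measureReal_apply (measurable_map_tau i) (measurableSet_cyl _)]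
  refine measureReal_mono fun x hx => ?_
  rw [Set.mem_preimage, mem_cyl, word_map, List.length_map, mem_cyl.1 hx]

end Push

/-! ### The variational inequality at finite length -/

section TowerEntropy

variable {m : ℕ} {A : Fin (m + 1) → Type*} {a : Fin (m + 1) → ℝ} [∀ i, TopologicalSpace (A i)]
  {X : (i : Fin (m + 1)) → Subshift (A i) ℕ} {π : (i : Fin m) → A i.castSucc → A i.succ}
  [∀ i, Finite (A i)] {φ : List (A 0) → ℝ≥0} {C : ℝ≥0}

lemma log_phiTilde (hπ : IsOneBlockTower X π) (ha0 : 0 < a 0) (ha : ∀ i, 0 ≤ a i)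
    {I : List (A 0)} (hI : I ∈ lang (X 0)) (hφ : φ I ≠ 0) (hZ : phiTop X π a φ I.length ≠ 0) :
    Real.log (phiTilde X π a φ I) =
      ∑ i : Fin m, 1 / psum a i.castSucc *
        (Real.log (phiLevel X π a φ i.castSucc (I.map (tau π i.castSucc))) -
          Real.log (phiLevel X π a φ i.succ (I.map (tau π i.succ)))) +
      1 / psum a (Fin.last m) *
        Real.log (phiLevel X π a φ (Fin.last m) (I.map (tau π (Fin.last m)))) -
      Real.log (phiTop X π a φ I.length) := by
  have hp : ∀ i, (0 : ℝ) < phiLevel X π a φ i (I.map (tau π i)) := fun i => by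
    exact_mod_cast pos_iff_ne_zero.2 (phiLevel_ne_zero hπ ha0 ha i hI hφ)
  have hZ' : (0 : ℝ) < phiTop X π a φ I.length := by exact_mod_cast pos_iff_ne_zero.2 hZ
  have hlog : ∀ i (t : ℝ), (0 : ℝ) < (phiLevel X π a φ i (I.map (tau π i)) : ℝ) ^ t := fun i t =>
    Real.rpow_pos_of_pos (hp i) t
  unfold phiTilde
  push_cast
  rw [Real.log_mul (Finset.prod_ne_zero_iff.2 fun i _ => (div_pos (hlog _ _) (hlog _ _)).ne')
    (div_pos (hlog _ _) hZ').ne', Real.log_prod fun i _ => (div_pos (hlog _ _) (hlog _ _)).ne',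
    Real.log_div (hlog _ _).ne' hZ'.ne', Real.log_rpow (hp _), add_sub_assoc]
  congr 1
  refine Finset.sum_congr rfl fun i _ => ?_
  rw [Real.log_div (hlog _ _).ne' (hlog _ _).ne', Real.log_rpow (hp _), Real.log_rpow (hp _)]
  ring

variable [∀ i, MeasurableSpace (A i)]

/-- The finite-time version of `weightedValue`, on words of length `n`. -/
def towerValue (X : (i : Fin (m + 1)) → Subshift (A i) ℕ)
    (π : (i : Fin m) → A i.castSucc → A i.succ) (a : Fin (m + 1) → ℝ) (φ : List (A 0) → ℝ≥0)
    (η : Measure (ℕ → A 0)) (n : ℕ) : ℝ :=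
  wordMean (X 0) η n (fun I => Real.log (φ I)) +
    ∑ i, a i * wordEntropy (X i) (push π i η) n

/-- The relative entropy of the distribution of the first `n` letters with respect to `f`. -/
def wordKL {A : Type*} [TopologicalSpace A] [Finite A] [MeasurableSpace A] (X : Subshift A ℕ)
    (f : List A → ℝ≥0) (η : Measure (ℕ → A)) (n : ℕ) : ℝ :=
  wordMean X η n (fun I => Real.log (η.real (cyl I)) - Real.log (f I))

variable [∀ i, DiscreteMeasurableSpace (A i)] {η : Measure (ℕ → A 0)}

lemma push_compl_carrier [∀ i, DiscreteTopology (A i)] (hπ : IsOneBlockTower X π)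
    (h0 : η (X 0).carrierᶜ = 0) (i : Fin (m + 1)) : push π i η (X i).carrierᶜ = 0 := by
  rw [push, Measure.map_apply (measurable_map_tau i) (X i).isClosed.measurableSet.compl]
  exact measure_mono_null (fun x hx hx' => hx (hπ.tau_mem i hx')) h0

variable [IsProbabilityMeasure η]

variable [∀ i, DiscreteTopology (A i)]

lemma wordMean_push (hπ : IsOneBlockTower X π) (h0 : η (X 0).carrierᶜ = 0) (i : Fin (m + 1))
    (n : ℕ) (g : List (A i) → ℝ) :
    wordMean (X i) (push π i η) n g = wordMean (X 0) η n (fun I => g (I.map (tau π i))) := by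
  have := isProbabilityMeasure_push (π := π) (η := η) i
  rw [← integral_word h0, ← integral_word (push_compl_carrier hπ h0 i), push,
    integral_map (measurable_map_tau i).aemeasurable]
  · simp only [word_map]
  · refine Measurable.aestronglyMeasurable ?_
    have : (fun x : ℕ → A i => g (word x n)) =
        (fun v : Fin n → A i => g (List.ofFn v)) ∘ fun (x : ℕ → A i) (j : Fin n) => x j := rfl
    rw [this]
    exact (measurable_of_finite _).comp (by fun_prop)

lemma exists_of_push_ne_zero (hπ : IsOneBlockTower X π) (h0 : η (X 0).carrierᶜ = 0)
    (i : Fin (m + 1)) {n : ℕ} {J : List (A i)} (hJ : J ∈ langN (X i) n)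
    (hne : (push π i η).real (cyl J) ≠ 0) :
    ∃ I ∈ langN (X 0) n, η.real (cyl I) ≠ 0 ∧ I.map (tau π i) = J := by
  classical
  by_contra hcon
  push Not at hcon
  apply hne
  have h := wordMean_push hπ h0 i n (fun J' => if J' = J then 1 else 0)
  simp only [wordMean, mul_ite, mul_one, mul_zero, Finset.sum_ite_eq', hJ, if_true] at h
  rw [h]
  refine Finset.sum_eq_zero fun I hI => ?_
  split_ifs with hIJ
  · by_contra hI0
    exact hcon I hI hI0 hIJ
  · rfl

/-- The gain of entropy in one step of the tower dominates the gain of the weights. -/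
lemma wordMean_step_nonneg (hπ : IsOneBlockTower X π) (ha0 : 0 < a 0) (ha : ∀ i, 0 ≤ a i)
    (h0 : η (X 0).carrierᶜ = 0) {n : ℕ} (hpos : PosOn (X 0) φ η n) (i : Fin m) :
    0 ≤ wordMean (X 0) η n (fun I =>
      (Real.log ((push π i.castSucc η).real (cyl (I.map (tau π i.castSucc)))) -
        Real.log ((push π i.succ η).real (cyl (I.map (tau π i.succ))))) -
      1 / psum a i.castSucc * (Real.log (phiLevel X π a φ i.castSucc (I.map (tau π i.castSucc))) -
        Real.log (phiLevel X π a φ i.succ (I.map (tau π i.succ))))) := by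
  have hp1 := isProbabilityMeasure_push (π := π) (η := η) i.castSucc
  have hp2 := isProbabilityMeasure_push (π := π) (η := η) i.succ
  set η₁ := push π i.castSucc η with hη₁
  set η₂ := push π i.succ η with hη₂
  have hfac : ∀ I ∈ langN (X 0) n, η.real (cyl I) ≠ 0 →
      0 < phiLevel X π a φ i.castSucc (I.map (tau π i.castSucc)) ∧
      0 < phiLevel X π a φ i.succ (I.map (tau π i.succ)) ∧
      0 < η₂.real (cyl (I.map (tau π i.succ))) := fun I hI hne =>
    ⟨pos_iff_ne_zero.2 (phiLevel_ne_zero hπ ha0 ha _ (mem_langN.1 hI).1 (hpos I hI hne)),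
      pos_iff_ne_zero.2 (phiLevel_ne_zero hπ ha0 ha _ (mem_langN.1 hI).1 (hpos I hI hne)),
      (measureReal_nonneg.lt_of_ne' hne).trans_le (measureReal_cyl_le_push _ _)⟩
  have hcond : ∀ I ∈ langN (X 0) n, η.real (cyl I) ≠ 0 →
      (0 : ℝ) < condWeight X π a φ i (I.map (tau π i.castSucc)) := by
    intro I hI hne
    obtain ⟨h1, h2, -⟩ := hfac I hI hne
    rw [map_tau_succ] at h2
    exact_mod_cast div_pos (NNReal.rpow_pos h1) (NNReal.rpow_pos h2)
  -- The image of `η` on level `i` is compared with the vector that has the image on the next level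
  -- as its marginal and distributes it along the fibres by the relative weights; its total mass is
  -- at most `1`.
  have hG := sum_mul_log_sub_log_le (langN (X i.castSucc) n) (fun J => η₁.real (cyl J))
    (fun J => condWeight X π a φ i J * η₂.real (cyl (J.map (π i))))
    (fun _ _ => measureReal_nonneg) (fun _ _ => mul_nonneg (NNReal.coe_nonneg _) measureReal_nonneg)
    (by
      intro J hJ hne
      obtain ⟨I, hI, hI0, rfl⟩ := exists_of_push_ne_zero hπ h0 i.castSucc hJ hne
      rw [← map_tau_succ]
      exact (mul_pos (hcond I hI hI0) (hfac I hI hI0).2.2).ne')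
  rw [sum_measureReal_cyl (push_compl_carrier hπ h0 i.castSucc)] at hG
  have hq : ∑ J ∈ langN (X i.castSucc) n, (condWeight X π a φ i J : ℝ) *
      η₂.real (cyl (J.map (π i))) ≤ 1 := by
    have h := sum_condWeight_mul (φ := φ) hπ ha0 ha i n (fun J => (η₂ (cyl J)).toNNReal)
    have h' := h.trans_le (Finset.sum_le_sum_of_subset (Finset.filter_subset _ _))
    have h'' := NNReal.coe_le_coe.2 h'
    push_cast at h''
    refine h''.trans_eq ?_
    have h1 := sum_measureReal_cyl (push_compl_carrier hπ h0 i.succ) n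
    simp only [Measure.real] at h1
    exact h1
  have hpush := wordMean_push hπ h0 i.castSucc n (fun J =>
    Real.log (condWeight X π a φ i J * η₂.real (cyl (J.map (π i)))) - Real.log (η₁.real (cyl J)))
  rw [wordMean] at hpush
  rw [hpush] at hG
  have hneg : wordMean (X 0) η n (fun I =>
      (Real.log (η₁.real (cyl (I.map (tau π i.castSucc)))) -
        Real.log (η₂.real (cyl (I.map (tau π i.succ))))) -
      1 / psum a i.castSucc * (Real.log (phiLevel X π a φ i.castSucc (I.map (tau π i.castSucc))) -
        Real.log (phiLevel X π a φ i.succ (I.map (tau π i.succ))))) =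
      -1 * wordMean (X 0) η n (fun I => Real.log (condWeight X π a φ i (I.map (tau π i.castSucc)) *
        η₂.real (cyl ((I.map (tau π i.castSucc)).map (π i)))) -
          Real.log (η₁.real (cyl (I.map (tau π i.castSucc))))) := by
    rw [← wordMean_const_mul]
    refine wordMean_congr fun I hI hne => ?_
    obtain ⟨h1, h2, h3⟩ := hfac I hI hne
    have h4 := hcond I hI hne
    rw [← map_tau_succ, Real.log_mul h4.ne' h3.ne', condWeight, ← map_tau_succ, NNReal.coe_div,
      NNReal.coe_rpow, NNReal.coe_rpow, Real.log_div (by positivity) (by positivity),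
      Real.log_rpow (by exact_mod_cast h1), Real.log_rpow (by exact_mod_cast h2)]
    ring
  rw [hneg]
  linarith

/-- Gibbs' inequality on the last level against the probability vector `φ⁽ᵏ⁾(J) ^ (1 / s_k) / Z n`.
-/
lemma wordMean_last_nonneg (hπ : IsOneBlockTower X π) (ha0 : 0 < a 0) (ha : ∀ i, 0 ≤ a i)
    (h0 : η (X 0).carrierᶜ = 0) {n : ℕ} (hpos : PosOn (X 0) φ η n)
    (hZ : phiTop X π a φ n ≠ 0) :
    0 ≤ wordMean (X 0) η n (fun I =>
      Real.log ((push π (Fin.last m) η).real (cyl (I.map (tau π (Fin.last m))))) -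
      1 / psum a (Fin.last m) *
        Real.log (phiLevel X π a φ (Fin.last m) (I.map (tau π (Fin.last m))))) +
      Real.log (phiTop X π a φ n) := by
  have hp1 := isProbabilityMeasure_push (π := π) (η := η) (Fin.last m)
  set η₁ := push π (Fin.last m) η with hη₁
  have hZ' : (0 : ℝ) < phiTop X π a φ n := by exact_mod_cast pos_iff_ne_zero.2 hZ
  have hfac : ∀ I ∈ langN (X 0) n, η.real (cyl I) ≠ 0 →
      (0 : ℝ) < phiLevel X π a φ (Fin.last m) (I.map (tau π (Fin.last m))) := fun I hI hne => by
    exact_mod_cast pos_iff_ne_zero.2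
      (phiLevel_ne_zero hπ ha0 ha _ (mem_langN.1 hI).1 (hpos I hI hne))
  set q : List (A (Fin.last m)) → ℝ := fun J =>
    (phiLevel X π a φ (Fin.last m) J : ℝ) ^ (1 / psum a (Fin.last m)) / phiTop X π a φ n with hq
  have hG := sum_mul_log_sub_log_le (langN (X (Fin.last m)) n) (fun J => η₁.real (cyl J)) q
    (fun _ _ => measureReal_nonneg) (fun _ _ => by positivity)
    (by
      intro J hJ hne
      obtain ⟨I, hI, hI0, rfl⟩ := exists_of_push_ne_zero hπ h0 (Fin.last m) hJ hne
      have := hfac I hI hI0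
      simp only [hq]
      positivity)
  rw [sum_measureReal_cyl (push_compl_carrier hπ h0 (Fin.last m))] at hG
  have hq1 : ∑ J ∈ langN (X (Fin.last m)) n, q J = 1 := by
    rw [hq, ← Finset.sum_div, div_eq_one_iff_eq hZ'.ne', phiTop]
    push_cast
    rfl
  have hpush := wordMean_push hπ h0 (Fin.last m) n (fun J =>
    Real.log (q J) - Real.log (η₁.real (cyl J)))
  rw [wordMean] at hpush
  rw [hpush, hq1, sub_self] at hG
  have hneg : wordMean (X 0) η n (fun I =>
      Real.log (η₁.real (cyl (I.map (tau π (Fin.last m))))) - 1 / psum a (Fin.last m) *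
        Real.log (phiLevel X π a φ (Fin.last m) (I.map (tau π (Fin.last m))))) +
      Real.log (phiTop X π a φ n) =
      -1 * wordMean (X 0) η n (fun I => Real.log (q (I.map (tau π (Fin.last m)))) -
          Real.log (η₁.real (cyl (I.map (tau π (Fin.last m)))))) := by
    rw [← wordMean_const_mul, ← wordMean_const h0 n (Real.log (phiTop X π a φ n)), ← wordMean_add]
    refine wordMean_congr fun I hI hne => ?_
    have h1 := hfac I hI hne
    simp only [hq]
    rw [Real.log_div (by positivity) hZ'.ne', Real.log_rpow h1]
    ring
  rw [hneg]
  linarith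

/-- The variational inequality on words: the defect of `towerValue` is comparable with the
relative entropy with respect to `phiTilde`. -/
theorem towerValue_bounds (hπ : IsOneBlockTower X π) (ha0 : 0 < a 0) (ha : ∀ i, 0 ≤ a i)
    (h0 : η (X 0).carrierᶜ = 0) {n : ℕ} (hpos : PosOn (X 0) φ η n)
    (hZ : phiTop X π a φ n ≠ 0) :
    0 ≤ wordKL (X 0) (phiTilde X π a φ) η n ∧
      a 0 * wordKL (X 0) (phiTilde X π a φ) η n ≤
        psum a (Fin.last m) * Real.log (phiTop X π a φ n) - towerValue X π a φ η n ∧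
      psum a (Fin.last m) * Real.log (phiTop X π a φ n) - towerValue X π a φ η n ≤
        psum a (Fin.last m) * wordKL (X 0) (phiTilde X π a φ) η n := by
  set F : Fin (m + 1) → ℝ := fun i =>
    wordMean (X 0) η n (fun I => Real.log ((push π i η).real (cyl (I.map (tau π i))))) with hF
  set G : Fin (m + 1) → ℝ := fun i =>
    wordMean (X 0) η n (fun I => Real.log (phiLevel X π a φ i (I.map (tau π i)))) with hG
  set s := psum a with hs
  have hspos : ∀ i, 0 < s i := psum_pos ha0 ha
  set L := Real.log (phiTop X π a φ n)
  -- `D i` and `E` are the gaps in Gibbs' inequality on the single levels; both the relative entropy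
  -- and the defect are combinations of them.
  set D : Fin m → ℝ := fun i =>
    (F i.castSucc - F i.succ) - 1 / s i.castSucc * (G i.castSucc - G i.succ) with hD
  set E : ℝ := F (Fin.last m) - 1 / s (Fin.last m) * G (Fin.last m) + L with hE
  have hD0 : ∀ i, 0 ≤ D i := by
    intro i
    have := wordMean_step_nonneg hπ ha0 ha h0 hpos i
    rwa [wordMean_sub, wordMean_sub, wordMean_const_mul, wordMean_sub] at this
  have hE0 : 0 ≤ E := by
    have := wordMean_last_nonneg hπ ha0 ha h0 hpos hZ
    rwa [wordMean_sub, wordMean_const_mul] at this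
  have hkl : wordKL (X 0) (phiTilde X π a φ) η n = ∑ i, D i + E := by
    have h1 : wordMean (X 0) η n (fun I => Real.log (phiTilde X π a φ I)) =
        ∑ i : Fin m, 1 / s i.castSucc * (G i.castSucc - G i.succ) +
          1 / s (Fin.last m) * G (Fin.last m) - L := by
      have h2 : wordMean (X 0) η n (fun I => Real.log (phiTilde X π a φ I)) =
          wordMean (X 0) η n (fun I => ∑ i : Fin m, 1 / psum a i.castSucc *
            (Real.log (phiLevel X π a φ i.castSucc (I.map (tau π i.castSucc))) -
              Real.log (phiLevel X π a φ i.succ (I.map (tau π i.succ)))) +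
            1 / psum a (Fin.last m) *
              Real.log (phiLevel X π a φ (Fin.last m) (I.map (tau π (Fin.last m)))) - L) := by
        refine wordMean_congr fun I hI hne => ?_
        obtain ⟨hI', rfl⟩ := mem_langN.1 hI
        exact log_phiTilde hπ ha0 ha hI' (hpos I hI hne) hZ
      rw [h2, wordMean_sub, wordMean_const h0, wordMean_add, wordMean_const_mul, wordMean_sum]
      congr 2
      refine Finset.sum_congr rfl fun i _ => ?_
      rw [wordMean_const_mul, wordMean_sub]
    have hF0 : wordMean (X 0) η n (fun I => Real.log (η.real (cyl I))) = F 0 := by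
      simp only [hF, push_zero, tau_zero, List.map_id]
    have hDsum : ∑ i, D i = ∑ i : Fin m, (F i.castSucc - F i.succ) -
        ∑ i : Fin m, 1 / s i.castSucc * (G i.castSucc - G i.succ) := Finset.sum_sub_distrib _ _
    rw [wordKL, wordMean_sub, h1, hF0, hDsum, hE]
    linarith [sum_castSucc_sub_succ F]
  -- The coefficients `s_i` turn the differences of `F` into `∑ a_i F_i` by summation by parts and
  -- cancel the exponents `1 / s_i`, so that the differences of `G` telescope to the mean of `log
  -- φ`.
  have hval : s (Fin.last m) * L - towerValue X π a φ η n =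
      ∑ i, s i.castSucc * D i + s (Fin.last m) * E := by
    have hent : ∀ i, wordEntropy (X i) (push π i η) n = -F i := fun i => by
      rw [wordEntropy, wordMean_push hπ h0]
    have hG0 : wordMean (X 0) η n (fun I => Real.log (φ I)) = G 0 := by
      simp only [hG, phiLevel_zero, tau_zero, List.map_id]
    have h1 : ∑ i, s i.castSucc * D i = ∑ i : Fin m, s i.castSucc * (F i.castSucc - F i.succ) -
        ∑ i : Fin m, (G i.castSucc - G i.succ) := by
      rw [← Finset.sum_sub_distrib]
      refine Finset.sum_congr rfl fun i _ => ?_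
      have := (hspos i.castSucc).ne'
      simp only [hD]
      field_simp
    have h2 : s (Fin.last m) * E = s (Fin.last m) * F (Fin.last m) - G (Fin.last m) +
        s (Fin.last m) * L := by
      have := (hspos (Fin.last m)).ne'
      simp only [hE]
      field_simp
    have h3 := sum_psum_mul_sub a F
    have h4 := sum_castSucc_sub_succ G
    rw [towerValue, hG0, h1, h2]
    simp only [hent, mul_neg, Finset.sum_neg_distrib]
    linarith
  have hs0 : s 0 = a 0 := psum_zero a
  clear_value D E
  rw [hkl, hval]
  -- Both inequalities compare coefficients: `a 0 = s_1 ≤ s_i ≤ s_k`.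
  refine ⟨add_nonneg (Finset.sum_nonneg fun i _ => hD0 i) hE0, ?_, ?_⟩
  · rw [mul_add, Finset.mul_sum]
    refine add_le_add (Finset.sum_le_sum fun i _ => ?_) ?_
    · exact mul_le_mul_of_nonneg_right (hs0 ▸ psum_mono ha (Fin.zero_le _)) (hD0 i)
    · exact mul_le_mul_of_nonneg_right (hs0 ▸ psum_mono ha (Fin.zero_le _)) hE0
  · rw [mul_add, Finset.mul_sum]
    refine add_le_add (Finset.sum_le_sum fun i _ => ?_) le_rfl
    exact mul_le_mul_of_nonneg_right (psum_mono ha (Fin.le_last _)) (hD0 i)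

/-- Sub-additivity of `towerValue`. -/
lemma towerValue_add_le (hπ : IsOneBlockTower X π) (ha : ∀ i, 0 ≤ a i)
    (hsub : SubMul (X 0) C φ) (h0 : η (X 0).carrierᶜ = 0) {n k : ℕ}
    (hpos : PosOn (X 0) φ η (n + k)) :
    towerValue X π a φ η (n + k) ≤
      towerValue X π a φ η n + towerValue X π a φ (η.map leftShift^[n]) k + Real.log C := by
  have h1 := wordMean_log_add_le hsub h0 hpos
  have h2 : ∑ i, a i * wordEntropy (X i) (push π i η) (n + k) ≤
      ∑ i, a i * wordEntropy (X i) (push π i η) n +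
        ∑ i, a i * wordEntropy (X i) (push π i (η.map leftShift^[n])) k := by
    rw [← Finset.sum_add_distrib]
    refine Finset.sum_le_sum fun i _ => ?_
    have := isProbabilityMeasure_push (π := π) (η := η) i
    rw [← mul_add, push_map_shift]
    exact mul_le_mul_of_nonneg_left (wordEntropy_add_le (push_compl_carrier hπ h0 i) n k) (ha i)
  unfold towerValue
  linarith

end TowerEntropy

/-! ### Relative entropy: passage to the limit and absolute continuity -/

section OneLevel

open scoped Topology

lemma SubMul.ne_zero_of_append {A : Type*} [TopologicalSpace A] {X : Subshift A ℕ} {φ : List A → ℝ≥0}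
    {C : ℝ≥0} (h : SubMul X C φ) {I J : List A} (hIJ : I ++ J ∈ lang X)
    (h0 : φ (I ++ J) ≠ 0) : φ I ≠ 0 ∧ φ J ≠ 0 := by
  have := (pos_iff_ne_zero.2 h0).trans_le (h.2 I J hIJ)
  constructor
  · intro hI; simp [hI] at this
  · intro hJ; simp [hJ] at this

variable {A : Type*} [TopologicalSpace A] [Finite A] [MeasurableSpace A]
  [DiscreteMeasurableSpace A] {X : Subshift A ℕ} {ρ : Measure (ℕ → A)} [IsProbabilityMeasure ρ]
  {φ f : List A → ℝ≥0} {C : ℝ≥0} {pt : List A → ℕ → A}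

/-- A charged word begins some charged longer word, and sub-multiplicativity passes positivity to
the factors of a word. -/
lemma PosOn.left (hsub : SubMul X C φ) (h0 : ρ X.carrierᶜ = 0) {n k : ℕ}
    (h : PosOn X φ ρ (n + k)) : PosOn X φ ρ n := by
  classical
  intro I hI hne hφ
  apply hne
  have := wordMean_take h0 n k (fun J => if J = I then 1 else 0)
  simp only [wordMean, mul_ite, mul_one, mul_zero, Finset.sum_ite_eq', hI, if_true] at this
  rw [← this]
  refine Finset.sum_eq_zero fun W hW => ?_
  split_ifs with hWI
  · by_contra hW0
    have hL := (mem_langN.1 hW).1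
    have hφW := h W hW hW0
    rw [← List.take_append_drop n W] at hL hφW
    exact (hsub.ne_zero_of_append hL hφW).1 (hWI ▸ hφ)
  · rfl

lemma PosOn.right [DiscreteTopology A] (hsub : SubMul X C φ) (h0 : ρ X.carrierᶜ = 0) {n k : ℕ}
    (h : PosOn X φ ρ (n + k)) : PosOn X φ (ρ.map leftShift^[n]) k := by
  classical
  intro I hI hne hφ
  apply hne
  have := wordMean_drop h0 n k (fun J => if J = I then 1 else 0)
  simp only [wordMean, mul_ite, mul_one, mul_zero, Finset.sum_ite_eq', hI, if_true] at this
  rw [← this]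
  refine Finset.sum_eq_zero fun W hW => ?_
  split_ifs with hWI
  · by_contra hW0
    have hL := (mem_langN.1 hW).1
    have hφW := h W hW hW0
    rw [← List.take_append_drop n W] at hL hφW
    exact (hsub.ne_zero_of_append hL hφW).2 (hWI ▸ hφ)
  · rfl

/-- On words of the full length `N` the word measure has exactly the distribution `f`. -/
lemma wordKL_wordMeasure (hpt : IsSelection X pt) (N : ℕ) :
    wordKL X f (wordMeasure X f pt N) N = 0 := by
  refine Finset.sum_eq_zero fun W hW => ?_
  simp [measureReal_def, wordMeasure_cyl hpt hW]

lemma posOn_wordMeasure (hpt : IsSelection X pt) (hf : ∀ I ∈ lang X, f I ≠ 0 → φ I ≠ 0) (N : ℕ) :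
    PosOn X φ (wordMeasure X f pt N) N := by
  intro W hW hne
  refine hf W (mem_langN.1 hW).1 fun h0 => hne ?_
  simp [measureReal_def, wordMeasure_cyl hpt hW, h0]

/-- Words charged by the limit measure have positive weight. -/
lemma IsWordLimit.posOn [DiscreteTopology A] {μ : Measure (ℕ → A)} (hμ : IsWordLimit X f pt μ)
    (hpt : IsSelection X pt) (h1 : ∀ n, ∑ W ∈ langN X n, f W = 1)
    (hf : ∀ I ∈ lang X, f I ≠ 0 → φ I ≠ 0) (hsub : SubMul X C φ) (n : ℕ) : PosOn X φ μ n := by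
  intro I hI hne hφ
  apply hne
  suffices μ (cyl I) ≤ 0 by simp [measureReal_def, le_antisymm this zero_le]
  refine hμ.measure_le_of_forall (detBy_cyl I) fun b a ha => ?_
  obtain ⟨k, rfl⟩ := Nat.exists_eq_add_of_le ha
  have := isProbabilityMeasure_wordMeasure (pt := pt) (h1 (b + (I.length + k)))
  have hc := wordMeasure_compl_carrier (f := f) hpt (b + (I.length + k))
  have hp : IsProbabilityMeasure
      ((wordMeasure X f pt (b + (I.length + k))).map leftShift^[b]) :=
    Measure.isProbabilityMeasure_map (measurable_leftShift_iterate b).aemeasurable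
  have h2 := ((posOn_wordMeasure hpt hf (b + (I.length + k))).right hsub hc).left hsub
    (map_shift_compl_carrier hc b) I (mem_langN.2 ⟨(mem_langN.1 hI).1, rfl⟩)
  by_contra hcon
  refine h2 ?_ hφ
  rw [map_measureReal_apply (measurable_leftShift_iterate b) (measurableSet_cyl _)]
  rw [measureReal_def, Ne, ENNReal.toReal_eq_zero_iff]
  push Not
  exact ⟨fun h => hcon (by rw [h]), measure_ne_top _ _⟩

lemma avgMeasure_real_cyl (h1 : ∀ n, ∑ W ∈ langN X n, f W = 1) (N : ℕ) (I : List A) :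
    (avgMeasure X f pt N).real (cyl I) = ∑ j ∈ Finset.range (N + 1), ((N + 1 : ℕ) : ℝ)⁻¹ *
      ((wordMeasure X f pt (3 * (N + 1))).map leftShift^[N + 1 + j]).real (cyl I) := by
  have := isProbabilityMeasure_wordMeasure (pt := pt) (h1 (3 * (N + 1)))
  rw [measureReal_def, avgMeasure_apply (measurableSet_cyl I), ENNReal.toReal_mul,
    ENNReal.toReal_inv, ENNReal.toReal_natCast, ENNReal.toReal_sum (fun _ _ => measure_ne_top _ _),
    Finset.mul_sum]
  refine Finset.sum_congr rfl fun j _ => ?_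
  rw [map_measureReal_apply (measurable_leftShift_iterate _) (measurableSet_cyl _), measureReal_def]

/-- Convexity and continuity: bounds for the relative entropy pass to the limit measure. -/
lemma IsWordLimit.wordKL_le {μ : Measure (ℕ → A)} [IsProbabilityMeasure μ]
    (hμ : IsWordLimit X f pt μ)
    (h1 : ∀ n, ∑ W ∈ langN X n, f W = 1) {n : ℕ} {K : ℝ}
    (hK : ∀ N i, i + n ≤ N → wordKL X f ((wordMeasure X f pt N).map leftShift^[i]) n ≤ K) :
    wordKL X f μ n ≤ K := by
  have hform : ∀ ρ : Measure (ℕ → A), wordKL X f ρ n = ∑ I ∈ langN X n,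
      (ρ.real (cyl I) * Real.log (ρ.real (cyl I)) - ρ.real (cyl I) * Real.log (f I)) := fun ρ =>
    Finset.sum_congr rfl fun I _ => mul_sub _ _ _
  -- The function `x log x` is continuous on the line, including `0`, and `log (f I)` is a constant.
  have ht : Tendsto (fun N => wordKL X f (avgMeasure X f pt N) n) (hyperfilter ℕ)
      (𝓝 (wordKL X f μ n)) := by
    simp only [hform]
    refine tendsto_finsetSum _ fun I _ => ?_
    have hI : Tendsto (fun N => (avgMeasure X f pt N).real (cyl I)) (hyperfilter ℕ)
        (𝓝 (μ.real (cyl I))) :=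
      (ENNReal.tendsto_toReal (measure_ne_top _ _)).comp (hμ _ _ (detBy_cyl I))
    exact ((Real.continuous_mul_log.tendsto _).comp hI).sub (hI.mul_const _)
  refine le_of_tendsto ht (((eventually_ge_atTop n).filter_mono
    Nat.hyperfilter_le_atTop).mono fun N hN => ?_)
  set y : ℕ → List A → ℝ := fun j I =>
    ((wordMeasure X f pt (3 * (N + 1))).map leftShift^[N + 1 + j]).real (cyl I) with hy
  set w : ℝ := ((N + 1 : ℕ) : ℝ)⁻¹ with hw
  have hw0 : 0 ≤ w := by positivity
  have hw1 : ∑ _j ∈ Finset.range (N + 1), w = 1 := by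
    rw [Finset.sum_const, Finset.card_range, nsmul_eq_mul, hw, mul_inv_cancel₀ (by positivity)]
  have havg : ∀ I, (avgMeasure X f pt N).real (cyl I) = ∑ j ∈ Finset.range (N + 1), w * y j I :=
    fun I => avgMeasure_real_cyl h1 N I
  calc wordKL X f (avgMeasure X f pt N) n
      ≤ ∑ I ∈ langN X n, ∑ j ∈ Finset.range (N + 1),
          w * (y j I * Real.log (y j I) - y j I * Real.log (f I)) := by
        rw [hform]
        refine Finset.sum_le_sum fun I _ => ?_
        have hJ := Real.convexOn_mul_log.map_sum_le (t := Finset.range (N + 1))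
          (w := fun _ => w) (p := fun j => y j I) (fun _ _ => hw0) hw1
          (fun _ _ => Set.mem_Ici.2 measureReal_nonneg)
        simp only [smul_eq_mul] at hJ
        rw [havg]
        simp only [mul_sub, Finset.sum_sub_distrib]
        refine sub_le_sub hJ (le_of_eq ?_)
        rw [Finset.sum_mul]
        exact Finset.sum_congr rfl fun j _ => by ring
    _ = ∑ j ∈ Finset.range (N + 1), w *
          wordKL X f ((wordMeasure X f pt (3 * (N + 1))).map leftShift^[N + 1 + j]) n := by
        rw [Finset.sum_comm]
        refine Finset.sum_congr rfl fun j _ => ?_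
        rw [← Finset.mul_sum, hform]
    _ ≤ ∑ j ∈ Finset.range (N + 1), w * K := by
        refine Finset.sum_le_sum fun j hj => mul_le_mul_of_nonneg_left (hK _ _ ?_) hw0
        have := Finset.mem_range.1 hj
        omega
    _ = K := by rw [← Finset.sum_mul, hw1, one_mul]

/-- The relative entropy controls the mass of a set determined by finitely many coordinates. -/
lemma mul_measureReal_le_wordKL_add {μ : Measure (ℕ → A)} [IsProbabilityMeasure μ]
    (h0 : ρ X.carrierᶜ = 0) (h0' : μ X.carrierᶜ = 0) {r : ℕ}
    (h1 : ∑ W ∈ langN X r, f W = 1) (hpos : PosOn X f ρ r) {K : ℝ}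
    (hK : ∀ I ∈ lang X, (f I : ℝ) ≤ K * μ.real (cyl I)) {U : Set (ℕ → A)} (hU : DetBy r U)
    {t : ℝ} (ht : 0 ≤ t) :
    t * ρ.real U ≤ wordKL X f ρ r + (Real.exp t - 1) * (K * μ.real U) := by
  classical
  set g : List A → ℝ := fun I => if cyl I ⊆ U then 1 else 0 with hg
  have hmass : ∀ (τ : Measure (ℕ → A)) [IsProbabilityMeasure τ], τ X.carrierᶜ = 0 →
      wordMean X τ r g = τ.real U := by
    intro τ _ hτ
    rw [← integral_word hτ]
    have : (fun x => g (word x r)) = U.indicator (fun _ => (1 : ℝ)) := by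
      funext x
      have hx : cyl (word x r) ⊆ U ↔ x ∈ U := by
        refine ⟨fun h => h (mem_cyl_word x r), fun h y hy => hU x y ?_ h⟩
        rw [mem_cyl, length_word] at hy
        exact hy.symm
      simp only [hg, hx, Set.indicator_apply]
    rw [this, integral_indicator_const _ hU.measurableSet, smul_eq_mul, mul_one]
  -- Gibbs' inequality against the tilted weights `f · exp (t · 1_U)`. Their total mass exceeds `1`
  -- by `exp t - 1` times the `f`-mass of `U`, and that mass is at most `K * μ U`.
  have hG := sum_mul_log_sub_log_le (langN X r) (fun I => ρ.real (cyl I))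
    (fun I => f I * Real.exp (t * g I)) (fun _ _ => measureReal_nonneg)
    (fun _ _ => by positivity) (fun I hI hne =>
      mul_ne_zero (by exact_mod_cast hpos I hI hne) (Real.exp_pos _).ne')
  rw [sum_measureReal_cyl h0] at hG
  have hleft : ∑ I ∈ langN X r, ρ.real (cyl I) *
      (Real.log (f I * Real.exp (t * g I)) - Real.log (ρ.real (cyl I))) =
      t * ρ.real U - wordKL X f ρ r := by
    rw [← hmass ρ h0, wordKL, ← wordMean_const_mul, ← wordMean_sub]
    refine wordMean_congr fun I hI hne => ?_
    rw [Real.log_mul (by exact_mod_cast hpos I hI hne) (Real.exp_pos _).ne', Real.log_exp]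
    ring
  have hright : ∑ I ∈ langN X r, (f I : ℝ) * Real.exp (t * g I) - 1 ≤
      (Real.exp t - 1) * (K * μ.real U) := by
    have h1' : ∑ I ∈ langN X r, (f I : ℝ) = 1 := by exact_mod_cast congrArg NNReal.toReal h1
    have hsum : ∑ I ∈ langN X r, (f I : ℝ) * Real.exp (t * g I) - 1 =
        ∑ I ∈ langN X r, ((f I : ℝ) * Real.exp (t * g I) - f I) := by
      rw [Finset.sum_sub_distrib, h1']
    rw [hsum, ← hmass μ h0', wordMean, Finset.mul_sum, Finset.mul_sum]
    refine Finset.sum_le_sum fun I hI => ?_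
    have he : 0 ≤ Real.exp t - 1 := by linarith [Real.one_le_exp ht]
    by_cases hIU : cyl I ⊆ U
    · simp only [hg, hIU, if_true, mul_one]
      calc (f I : ℝ) * Real.exp t - f I = (Real.exp t - 1) * f I := by ring
        _ ≤ _ := mul_le_mul_of_nonneg_left (hK I (mem_langN.1 hI).1) he
    · simp [hg, hIU]
  rw [hleft] at hG
  linarith

/-- Bounded relative entropies imply absolute continuity. -/
theorem absolutelyContinuous_of_wordKL_le {μ : Measure (ℕ → A)} [IsProbabilityMeasure μ]
    (h0 : ρ X.carrierᶜ = 0) (h0' : μ X.carrierᶜ = 0)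
    (h1 : ∀ n, ∑ W ∈ langN X n, f W = 1) (hpos : ∀ n, PosOn X f ρ n) {K D : ℝ} (hKpos : 0 ≤ K)
    (hK : ∀ I ∈ lang X, (f I : ℝ) ≤ K * μ.real (cyl I)) (hD : ∀ n, wordKL X f ρ n ≤ D) :
    ρ ≪ μ := by
  refine Measure.AbsolutelyContinuous.mk fun B hB hμB => ?_
  by_contra hρB
  have hb : 0 < ρ.real B := by
    rw [measureReal_def]
    exact ENNReal.toReal_pos hρB (measure_ne_top _ _)
  set b := ρ.real B
  -- With `ρ U ≥ b / 2` this gives `t * ρ U ≥ |D| + 2`. The choice of `δ` keeps the term with `μ U`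
  -- at most `1`, and `|D| + 2 ≤ D + 1` is absurd.
  set t : ℝ := 2 * (|D| + 2) / b with ht
  have ht0 : 0 ≤ t := by positivity
  have he : 0 ≤ Real.exp t - 1 := by linarith [Real.one_le_exp ht0]
  set δ : ℝ := min (b / 2) (1 / ((Real.exp t - 1) * K + 1)) with hδ
  have hδ0 : 0 < δ := lt_min (by positivity) (by positivity)
  -- Approximation with respect to `μ + ρ` makes `U` close to `B` for both measures at once.
  have hdense := Measure.MeasureDense.of_generateFrom_isSetAlgebra_finite (μ + ρ)
    (isSetAlgebra_detBy (A := A)) generateFrom_detBy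
  obtain ⟨U, ⟨r, hU⟩, hlt⟩ := hdense.approx B hB (measure_ne_top _ _) δ hδ0
  have hsd : (μ + ρ).real (symmDiff B U) < δ := by
    rw [measureReal_def]
    exact (ENNReal.lt_ofReal_iff_toReal_lt (measure_ne_top _ _)).1 hlt
  rw [measureReal_add_apply] at hsd
  have hμU : μ.real U ≤ μ.real (symmDiff B U) := by
    have hμB' : μ.real B = 0 := by simp [measureReal_def, hμB]
    calc μ.real U ≤ μ.real (B ∪ symmDiff B U) := by
          refine measureReal_mono fun x hx => ?_
          by_cases hx' : x ∈ B
          · exact Or.inl hx'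
          · exact Or.inr (Or.inr ⟨hx, hx'⟩)
      _ ≤ μ.real B + μ.real (symmDiff B U) := measureReal_union_le _ _
      _ = _ := by rw [hμB', zero_add]
  have hρU : b ≤ ρ.real U + ρ.real (symmDiff B U) := by
    refine le_trans (measureReal_mono fun x hx => ?_) (measureReal_union_le _ _)
    by_cases hx' : x ∈ U
    · exact Or.inl hx'
    · exact Or.inr (Or.inl ⟨hx, hx'⟩)
  have hn1 : 0 ≤ μ.real (symmDiff B U) := measureReal_nonneg
  have hn2 : 0 ≤ ρ.real (symmDiff B U) := measureReal_nonneg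
  have hδ1 : δ ≤ b / 2 := min_le_left _ _
  have hδ2 : δ ≤ 1 / ((Real.exp t - 1) * K + 1) := min_le_right _ _
  have hmain := mul_measureReal_le_wordKL_add h0 h0' (h1 r) (hpos r) hK hU ht0
  have h2 : |D| + 2 ≤ t * ρ.real U := by
    calc |D| + 2 = t * (b / 2) := by rw [ht]; field_simp
      _ ≤ t * ρ.real U := by gcongr; linarith
  have h3 : (Real.exp t - 1) * (K * μ.real U) ≤ 1 := by
    have h4 : 0 ≤ (Real.exp t - 1) * K := mul_nonneg he hKpos
    calc (Real.exp t - 1) * (K * μ.real U) = (Real.exp t - 1) * K * μ.real U := by ring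
      _ ≤ ((Real.exp t - 1) * K + 1) * (1 / ((Real.exp t - 1) * K + 1)) := by
          gcongr
          · linarith
          · linarith
      _ = 1 := by field_simp
  have := hD r
  have := le_abs_self D
  linarith

end OneLevel

/-! ### Bounded relative entropy of inner windows -/

section TowerLimit

variable {m : ℕ} {A : Fin (m + 1) → Type*} {a : Fin (m + 1) → ℝ} [∀ i, TopologicalSpace (A i)]
  {X : (i : Fin (m + 1)) → Subshift (A i) ℕ} {π : (i : Fin m) → A i.castSucc → A i.succ}
  [∀ i, Finite (A i)] {φ : List (A 0) → ℝ≥0} {C D : ℝ≥0}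

lemma phiTilde_ne_zero_iff (hπ : IsOneBlockTower X π) (ha0 : 0 < a 0) (ha : ∀ i, 0 ≤ a i)
    (hZ : ∀ n, phiTop X π a φ n ≠ 0) {I : List (A 0)} (hI : I ∈ lang (X 0)) :
    phiTilde X π a φ I ≠ 0 ↔ φ I ≠ 0 := by
  rw [phiTilde_eq]
  constructor
  · intro h
    refine ne_zero_of_stoppedWeight_ne_zero (X := X) (π := π) ha0 (Fin.last m) fun h0 => h ?_
    rw [h0, zero_div]
  · intro h
    exact div_ne_zero (stoppedWeight_ne_zero hπ ha0 ha _ hI h) (hZ _)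

variable [∀ i, MeasurableSpace (A i)] [∀ i, DiscreteMeasurableSpace (A i)]
  [∀ i, DiscreteTopology (A i)] {pt : List (A 0) → ℕ → A 0}

/-- The relative entropies of the inner distributions of the word measures are bounded. -/
lemma exists_wordKL_wordMeasure_le (hπ : IsOneBlockTower X π) (ha0 : 0 < a 0)
    (ha : ∀ i, 0 ≤ a i) (hsub : SubMul (X 0) C φ) (hZ : ∀ n, phiTop X π a φ n ≠ 0)
    (hD : 0 < D)
    (hZle : ∀ n k, phiTop X π a φ n * phiTop X π a φ k ≤ D * phiTop X π a φ (n + k))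
    (hpt : IsSelection (X 0) pt) :
    ∃ K : ℝ, ∀ n N i, i + n ≤ N → wordKL (X 0) (phiTilde X π a φ)
      ((wordMeasure (X 0) (phiTilde X π a φ) pt N).map leftShift^[i]) n ≤ K := by
  set s := psum a (Fin.last m)
  have hs : 0 < s := psum_pos ha0 ha _
  -- The word is cut into parts of lengths `i`, `n`, `j`. The defect of the whole is at most zero
  -- and those of the outer parts are nonnegative, so the defect of the window is bounded by the
  -- errors of two cuts: `log C` each for the sub-additive value and `s log D` each for the
  -- partition sums.
  refine ⟨(2 * Real.log C + s * (2 * Real.log D)) / a 0, fun n N i hin => ?_⟩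
  obtain ⟨j, rfl⟩ := Nat.exists_eq_add_of_le hin
  rw [add_assoc]
  set N := i + (n + j) with hN
  set ν := wordMeasure (X 0) (phiTilde X π a φ) pt N with hν
  have hν1 : IsProbabilityMeasure ν :=
    isProbabilityMeasure_wordMeasure (sum_phiTilde hπ ha0 ha (hZ N))
  have hν0 : ν (X 0).carrierᶜ = 0 := wordMeasure_compl_carrier hpt N
  have hpos : PosOn (X 0) φ ν (i + (n + j)) := posOn_wordMeasure hpt
    (fun I hI => (phiTilde_ne_zero_iff hπ ha0 ha hZ hI).1) N
  have hν'1 : IsProbabilityMeasure (ν.map leftShift^[i]) :=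
    Measure.isProbabilityMeasure_map (measurable_leftShift_iterate i).aemeasurable
  have hν'0 := map_shift_compl_carrier hν0 i
  have hpos' := hpos.right hsub hν0
  set ν' := ν.map leftShift^[i]
  have hν''1 : IsProbabilityMeasure (ν'.map leftShift^[n]) :=
    Measure.isProbabilityMeasure_map (measurable_leftShift_iterate n).aemeasurable
  have hν''0 := map_shift_compl_carrier hν'0 n
  have hpos'' := hpos'.right hsub hν'0
  have h1 := towerValue_add_le (a := a) hπ ha hsub hν0 hpos
  have h2 := towerValue_add_le (a := a) hπ ha hsub hν'0 hpos'
  have b0 := towerValue_bounds hπ ha0 ha hν0 hpos (hZ _)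
  have b1 := towerValue_bounds hπ ha0 ha hν0 (hpos.left hsub hν0) (hZ _)
  have b2 := towerValue_bounds hπ ha0 ha hν'0 (hpos'.left hsub hν'0) (hZ _)
  have b3 := towerValue_bounds hπ ha0 ha hν''0 hpos'' (hZ _)
  have hkl0 : wordKL (X 0) (phiTilde X π a φ) ν (i + (n + j)) = 0 := wordKL_wordMeasure hpt N
  rw [hkl0, mul_zero] at b0
  have p1 := mul_nonneg ha0.le b1.1
  have p3 := mul_nonneg ha0.le b3.1
  have hlog : ∀ n k, Real.log (phiTop X π a φ n) + Real.log (phiTop X π a φ k) ≤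
      Real.log D + Real.log (phiTop X π a φ (n + k)) := by
    intro n k
    have hp : ∀ n, (0 : ℝ) < phiTop X π a φ n := fun n => by
      exact_mod_cast pos_iff_ne_zero.2 (hZ n)
    rw [← Real.log_mul (hp n).ne' (hp k).ne', ← Real.log_mul (by exact_mod_cast hD.ne') (hp _).ne']
    exact Real.log_le_log (mul_pos (hp n) (hp k)) (by exact_mod_cast hZle n k)
  have l1 := mul_le_mul_of_nonneg_left (hlog i (n + j)) hs.le
  have l2 := mul_le_mul_of_nonneg_left (hlog n j) hs.le
  rw [le_div_iff₀ ha0, mul_comm]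
  linarith [b0.2.2, b1.2.1, b2.2.1, b3.2.1]

end TowerLimit

/-! ### Almost additive sequences -/

section Sequences

open scoped Topology

lemma _root_.Subadditive.natCast_mul_le_of_tendsto {u : ℕ → ℝ} (hu : Subadditive u) {L : ℝ}
    (h : Tendsto (fun n : ℕ => u n / n) atTop (𝓝 L)) (n : ℕ) : n * L ≤ u n := by
  have hb := h.bddBelow_range
  have hL : hu.lim = L := tendsto_nhds_unique (hu.tendsto_lim hb) h
  rcases Nat.eq_zero_or_pos n with rfl | hn
  · have := hu 0 0
    simp only [add_zero] at this
    simp only [Nat.cast_zero, zero_mul]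
    linarith
  · have := hu.lim_le_div hb hn.ne'
    rw [hL, le_div_iff₀ (by exact_mod_cast hn)] at this
    linarith

lemma tendsto_div_of_abs_sub_le {u : ℕ → ℝ} {P D : ℝ} (h : ∀ n : ℕ, |u n - n * P| ≤ D) :
    Tendsto (fun n : ℕ => u n / n) atTop (𝓝 P) := by
  rw [tendsto_iff_norm_sub_tendsto_zero]
  refine squeeze_zero' (Eventually.of_forall fun _ => norm_nonneg _)
    ((eventually_ge_atTop 1).mono fun n hn => ?_)
    (tendsto_const_nhds.div_atTop tendsto_natCast_atTop_atTop : Tendsto (fun n : ℕ => D / n) _ _)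
  have hn' : (0 : ℝ) < n := by exact_mod_cast hn
  rw [Real.norm_eq_abs, show u n / n - P = (u n - n * P) / n by field_simp, abs_div,
    abs_of_pos hn']
  exact div_le_div_of_nonneg_right (h n) hn'.le

/-- An almost additive sequence is almost linear. -/
lemma exists_abs_sub_natCast_mul_le {u : ℕ → ℝ} {C : ℝ}
    (h : ∀ n k, |u (n + k) - u n - u k| ≤ C) : ∃ P D : ℝ, ∀ n : ℕ, |u n - n * P| ≤ D := by
  -- Both `u + C` and `C - u` are sub-additive; Fekete's lemma bounds each from below by a linear
  -- sequence, and the two slopes are opposite.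
  have hv : Subadditive fun n => u n + C := fun n k => by
    have := (abs_le.1 (h n k)).2; linarith
  have hw : Subadditive fun n => C - u n := fun n k => by
    have := (abs_le.1 (h n k)).1; linarith
  have hb : BddBelow (Set.range fun n : ℕ => (u n + C) / n) := by
    refine ⟨min 0 (-(C - u 1) - (C - u 0)), ?_⟩
    rintro _ ⟨n, rfl⟩
    rcases Nat.eq_zero_or_pos n with rfl | hn
    · simp
    · refine (min_le_right _ _).trans ?_
      have hn' : (1 : ℝ) ≤ n := by exact_mod_cast hn
      have h1 := hw.apply_mul_add_le n 1 0
      have h0 := (abs_le.1 (h 0 0)).1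
      have h2 := abs_nonneg (u (0 + 0) - u 0 - u 0)
      have hC := h2.trans (h 0 0)
      simp only [mul_one, add_zero] at h0 h1
      have h3 : 0 ≤ C - u 0 := by linarith
      rw [le_div_iff₀ (by linarith)]
      nlinarith
  have ht := hv.tendsto_lim hb
  set P := hv.lim
  have ht' : Tendsto (fun n : ℕ => (C - u n) / n) atTop (𝓝 (-P)) := by
    have h2 : Tendsto (fun n : ℕ => 2 * C / (n : ℝ)) atTop (𝓝 0) :=
      tendsto_const_nhds.div_atTop tendsto_natCast_atTop_atTop
    have := h2.sub ht
    rw [zero_sub] at this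
    refine this.congr fun n => ?_
    rw [← sub_div]
    congr 1; ring
  refine ⟨P, C, fun n => abs_le.2 ⟨?_, ?_⟩⟩
  · have := hv.natCast_mul_le_of_tendsto ht n
    linarith
  · have := hw.natCast_mul_le_of_tendsto ht' n
    linarith

/-- If a positive combination of almost sub-additive sequences is almost linear, then so is each
of the sequences. -/
lemma almost_linear_of_sum {ι : Type*} [Fintype ι] {a h : ι → ℝ} (ha : ∀ i, 0 ≤ a i)
    {H : ι → ℕ → ℝ} (ht : ∀ i, Tendsto (fun n : ℕ => H i n / n) atTop (𝓝 (h i)))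
    (hle : ∀ i (n : ℕ), n * h i ≤ H i n) {E : ℕ → ℝ} {c : ℝ}
    (hE : ∀ n k, E (n + k) ≤ E n + E k + c) {P D : ℝ}
    (hV : ∀ n : ℕ, |E n + ∑ i, a i * H i n - n * P| ≤ D) :
    ∃ L, L + ∑ i, a i * h i = P ∧ Tendsto (fun n : ℕ => E n / n) atTop (𝓝 L) ∧
      (∃ D', ∀ n : ℕ, |E n - n * L| ≤ D') ∧
      ∀ i, 0 < a i → ∃ D', ∀ n : ℕ, |H i n - n * h i| ≤ D' := by
  set s := ∑ i, a i * h i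
  have hsum : ∀ n : ℕ, (n : ℝ) * s ≤ ∑ i, a i * H i n := fun n => by
    rw [Finset.mul_sum]
    refine Finset.sum_le_sum fun i _ => ?_
    calc (n : ℝ) * (a i * h i) = a i * (n * h i) := by ring
      _ ≤ _ := mul_le_mul_of_nonneg_left (hle i n) (ha i)
  have hEt : Tendsto (fun n : ℕ => E n / n) atTop (𝓝 (P - s)) := by
    have h1 := tendsto_div_of_abs_sub_le hV
    have h2 : Tendsto (fun n : ℕ => ∑ i, a i * (H i n / n)) atTop (𝓝 s) :=
      tendsto_finsetSum _ fun i _ => (ht i).const_mul _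
    refine (h1.sub h2).congr fun n => ?_
    rw [add_div, Finset.sum_div]
    simp only [mul_div_assoc]
    ring
  -- Each summand now lies above its linear part up to a constant, while the sum is at most the
  -- total linear part plus a constant. Hence none of them can exceed its linear part by more than a
  -- constant.
  have hEs : Subadditive fun n => E n + c := fun n k => by
    have := hE n k; linarith
  have hElow : ∀ n : ℕ, n * (P - s) ≤ E n + c := by
    refine hEs.natCast_mul_le_of_tendsto ?_
    have h2 : Tendsto (fun n : ℕ => c / (n : ℝ)) atTop (𝓝 0) :=
      tendsto_const_nhds.div_atTop tendsto_natCast_atTop_atTop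
    have := hEt.add h2
    rw [add_zero] at this
    exact this.congr fun n => (add_div _ _ _).symm
  refine ⟨P - s, by ring, hEt, ⟨max D c, fun n => abs_le.2 ⟨?_, ?_⟩⟩,
    fun i hi => ⟨(D + c) / a i, fun n => abs_le.2 ⟨?_, ?_⟩⟩⟩
  · have := hElow n
    have := le_max_right D c
    linarith
  · have := hsum n
    have := (abs_le.1 (hV n)).2
    have := le_max_left D c
    linarith
  · have h0 := (abs_nonneg _).trans (hV 0)
    have h1 := hEs 0 0
    have h2 := hElow n
    have h3 := hsum n
    have h4 := (abs_le.1 (hV n)).2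
    have h5 : 0 ≤ (D + c) / a i := div_nonneg (by linarith) hi.le
    have := hle i n
    linarith
  · rw [le_div_iff₀ hi]
    have h1 : a i * H i n - n * (a i * h i) ≤ ∑ i, (a i * H i n - n * (a i * h i)) :=
      Finset.single_le_sum (f := fun i => a i * H i n - n * (a i * h i)) (fun j _ => by
        have := mul_le_mul_of_nonneg_left (hle j n) (ha j)
        linarith) (Finset.mem_univ i)
    rw [Finset.sum_sub_distrib, ← Finset.mul_sum] at h1
    have h2 := hElow n
    have h4 := (abs_le.1 (hV n)).2
    linarith

end Sequences

/-! ### The limits that define entropy and the potential -/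

section OneLevel

open scoped Topology

lemma ae_ne_zero_of_posOn {A : Type*} [TopologicalSpace A] [Finite A] [MeasurableSpace A]
    {X : Subshift A ℕ} {ρ : Measure (ℕ → A)} [IsProbabilityMeasure ρ] {φ : List A → ℝ≥0}
    (h0 : ρ X.carrierᶜ = 0) {n : ℕ} (hpos : PosOn X φ ρ n) :
    ∀ᵐ x ∂ρ, φ (word x n) ≠ 0 := by
  have hX : ∀ᵐ x ∂ρ, x ∈ X.carrier := h0
  have hc : ∀ᵐ x ∂ρ, ∀ I ∈ langN X n, ρ.real (cyl I) = 0 → x ∉ cyl I := by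
    rw [Finset.eventually_all]
    intro I _
    by_cases hI : ρ.real (cyl I) = 0
    · have : ρ (cyl I) = 0 := by
        rwa [measureReal_def, ENNReal.toReal_eq_zero_iff, or_iff_left (measure_ne_top _ _)] at hI
      filter_upwards [measure_eq_zero_iff_ae_notMem.1 this] with x hx _ using hx
    · exact Eventually.of_forall fun x h => absurd h hI
  filter_upwards [hX, hc] with x hx hx'
  refine hpos _ (word_mem_langN hx n) fun h => hx' _ (word_mem_langN hx n) h (mem_cyl_word x n)

lemma measurable_comp_word {A β : Type*} [Finite A] [MeasurableSpace A]
    [DiscreteMeasurableSpace A] [MeasurableSpace β] (g : List A → β) (n : ℕ) :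
    Measurable fun x : ℕ → A => g (word x n) := by
  have : (fun x : ℕ → A => g (word x n)) =
      (fun v : Fin n → A => g (List.ofFn v)) ∘ fun (x : ℕ → A) (j : Fin n) => x j := rfl
  rw [this]
  exact (measurable_of_finite _).comp (by fun_prop)

/-- On a charged cylinder with `φ = 0` the negative part has integral `∞`, and in `EReal`
subtracting `⊤` from anything gives `⊥`. -/
lemma extIntegral_log_of_not_posOn {A : Type*} [TopologicalSpace A] [Finite A]
    [MeasurableSpace A] [DiscreteMeasurableSpace A] {X : Subshift A ℕ} {ρ : Measure (ℕ → A)}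
    {φ : List A → ℝ≥0} {n : ℕ} (hpos : ¬ PosOn X φ ρ n) :
    extIntegral ρ (fun x => ENNReal.log (φ (word x n) : ℝ≥0∞)) = ⊥ := by
  unfold PosOn at hpos
  push Not at hpos
  obtain ⟨I, hI, hne, hφ⟩ := hpos
  have hρ : ρ (cyl I) ≠ 0 := fun h => hne (by simp [measureReal_def, h])
  have h2 : ∫⁻ x, (-ENNReal.log (φ (word x n) : ℝ≥0∞)).toENNReal ∂ρ = ∞ := by
    rw [eq_top_iff]
    calc ∞ = ∫⁻ _x in cyl I, ∞ ∂ρ := by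
          rw [setLIntegral_const, ENNReal.top_mul hρ]
      _ = ∫⁻ x in cyl I, (-ENNReal.log (φ (word x n) : ℝ≥0∞)).toENNReal ∂ρ := by
          refine setLIntegral_congr_fun (measurableSet_cyl I) fun x hx => ?_
          rw [mem_cyl, (mem_langN.1 hI).2] at hx
          simp [hx, hφ]
      _ ≤ _ := setLIntegral_le_lintegral _ _
  rw [extIntegral, h2, EReal.coe_ennreal_top, EReal.sub_top]

variable {A : Type*} [TopologicalSpace A] [Finite A] [MeasurableSpace A]
  [DiscreteMeasurableSpace A] {X : Subshift A ℕ} {ρ : Measure (ℕ → A)} [IsProbabilityMeasure ρ]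
  {φ : List A → ℝ≥0} {C : ℝ≥0}

lemma InvMeasure.map_iterate {A : Type*} [TopologicalSpace A] [MeasurableSpace A]
    {X : Subshift A ℕ} {ρ : Measure (ℕ → A)} (h : InvMeasure X ρ) (n : ℕ) :
    ρ.map leftShift^[n] = ρ := (h.invariant.iterate n).map_eq

lemma InvMeasure.entropy_spec [DiscreteTopology A] (h : InvMeasure X ρ) :
    Tendsto (fun n : ℕ => wordEntropy X ρ n / n) atTop (𝓝 (entropy X ρ)) ∧
      ∀ n : ℕ, n * entropy X ρ ≤ wordEntropy X ρ n := by
  have hs : Subadditive (wordEntropy X ρ) := fun n k => by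
    have := wordEntropy_add_le h.null_compl n k
    rwa [h.map_iterate] at this
  have hb : BddBelow (Set.range fun n : ℕ => wordEntropy X ρ n / n) := by
    refine ⟨0, ?_⟩
    rintro _ ⟨n, rfl⟩
    exact div_nonneg (wordEntropy_nonneg n) (Nat.cast_nonneg n)
  have ht := hs.tendsto_lim hb
  have he : entropy X ρ = hs.lim := ht.limsup_eq
  rw [he]
  exact ⟨ht, hs.natCast_mul_le_of_tendsto ht⟩

lemma extIntegral_log_of_posOn (h0 : ρ X.carrierᶜ = 0) {n : ℕ} (hpos : PosOn X φ ρ n) :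
    extIntegral ρ (fun x => ENNReal.log (φ (word x n) : ℝ≥0∞)) =
      ((wordMean X ρ n (fun I => Real.log (φ I)) : ℝ) : EReal) := by
  have hae := ae_ne_zero_of_posOn h0 hpos
  set G : (ℕ → A) → ℝ := fun x => Real.log (φ (word x n)) with hG
  have hlog : ∀ᵐ x ∂ρ, ENNReal.log (φ (word x n) : ℝ≥0∞) = (G x : EReal) := by
    filter_upwards [hae] with x hx
    rw [ENNReal.log_of_nnreal hx]
  have hint : Integrable G ρ := by
    obtain ⟨M, hM⟩ := (Set.finite_range fun v : Fin n → A =>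
      ‖Real.log (φ (List.ofFn v))‖).bddAbove
    refine Integrable.of_bound
      (measurable_comp_word (fun I => Real.log (φ I)) n).aestronglyMeasurable M ?_
    exact Eventually.of_forall fun x => hM ⟨fun j => x j, rfl⟩
  have h1 : ∫⁻ x, (ENNReal.log (φ (word x n) : ℝ≥0∞)).toENNReal ∂ρ =
      ∫⁻ x, ENNReal.ofReal (G x) ∂ρ := by
    refine lintegral_congr_ae (hlog.mono fun x hx => ?_)
    simp only
    rw [hx, EReal.toENNReal_of_ne_top (EReal.coe_ne_top _), EReal.toReal_coe]
  have h2 : ∫⁻ x, (-ENNReal.log (φ (word x n) : ℝ≥0∞)).toENNReal ∂ρ =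
      ∫⁻ x, ENNReal.ofReal (-G x) ∂ρ := by
    refine lintegral_congr_ae (hlog.mono fun x hx => ?_)
    simp only
    rw [hx, ← EReal.coe_neg, EReal.toENNReal_of_ne_top (EReal.coe_ne_top _), EReal.toReal_coe]
  have hp : ∫⁻ x, ENNReal.ofReal (G x) ∂ρ ≠ ∞ := hint.lintegral_lt_top.ne
  have hn : ∫⁻ x, ENNReal.ofReal (-G x) ∂ρ ≠ ∞ := hint.neg.lintegral_lt_top.ne
  rw [extIntegral, h1, h2, ← integral_word h0,
    integral_eq_lintegral_pos_part_sub_lintegral_neg_part hint, EReal.coe_sub,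
    EReal.coe_ennreal_toReal hp, EReal.coe_ennreal_toReal hn]

/-- A charged word of weight zero entails one of every greater length, so from some length on all
the integrals are `-∞`. -/
lemma InvMeasure.posOn_of_phiStar_ne_bot (h : InvMeasure X ρ) (hsub : SubMul X C φ)
    (hΦ : PhiStar φ ρ ≠ ⊥) (n : ℕ) : PosOn X φ ρ n := by
  by_contra hcon
  apply hΦ
  have : (fun k : ℕ => extIntegral ρ (fun x => ENNReal.log (φ (word x k) : ℝ≥0∞)) / (k : EReal))
      =ᶠ[atTop] fun _ => ⊥ := by
    refine (eventually_ge_atTop (n + 1)).mono fun k hk => ?_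
    have hk' : ¬ PosOn X φ ρ k := fun hp => hcon (by
      rw [show k = n + (k - n) by omega] at hp
      exact hp.left hsub h.null_compl)
    simp only
    rw [extIntegral_log_of_not_posOn hk', EReal.bot_div_of_pos_ne_top]
    · exact_mod_cast (by omega : 0 < k)
    · exact EReal.natCast_ne_top k
  rw [PhiStar, limsup_congr this, limsup_const]

lemma phiStar_eq_limsup (h0 : ρ X.carrierᶜ = 0) (hpos : ∀ n, PosOn X φ ρ n) :
    PhiStar φ ρ = limsup (fun n : ℕ =>
      ((wordMean X ρ n (fun I => Real.log (φ I)) / n : ℝ) : EReal)) atTop := by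
  unfold PhiStar
  congr 1
  funext n
  rw [extIntegral_log_of_posOn h0 (hpos n), EReal.coe_div]
  rfl

lemma phiStar_eq_of_tendsto (h0 : ρ X.carrierᶜ = 0) (hpos : ∀ n, PosOn X φ ρ n) {L : ℝ}
    (h : Tendsto (fun n : ℕ => wordMean X ρ n (fun I => Real.log (φ I)) / n) atTop (𝓝 L)) :
    PhiStar φ ρ = (L : EReal) := by
  rw [phiStar_eq_limsup h0 hpos]
  exact ((continuous_coe_real_ereal.tendsto L).comp h).limsup_eq

/-- The word means plus `log C` are sub-additive, so any single quotient bounds the later ones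
asymptotically. No lower bound on the quotients is assumed, since the limit may be `-∞`. -/
lemma InvMeasure.phiStar_le [DiscreteTopology A] (h : InvMeasure X ρ) (hsub : SubMul X C φ)
    (hC : 1 ≤ C) (hpos : ∀ n, PosOn X φ ρ n) {n : ℕ} (hn : n ≠ 0) :
    PhiStar φ ρ ≤
      (((wordMean X ρ n (fun I => Real.log (φ I)) + Real.log C) / n : ℝ) : EReal) := by
  have hs : Subadditive fun n => wordMean X ρ n (fun I => Real.log (φ I)) + Real.log C := by
    intro n k
    have := wordMean_log_add_le hsub h.null_compl (hpos (n + k))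
    rw [h.map_iterate] at this
    linarith
  have hlogC : 0 ≤ Real.log C := Real.log_nonneg (by exact_mod_cast hC)
  rw [phiStar_eq_limsup h.null_compl hpos]
  refine EReal.le_of_forall_lt_iff_le.1 fun z hz => ?_
  have hz' := EReal.coe_lt_coe_iff.1 hz
  refine limsup_le_of_le (by isBoundedDefault)
    ((hs.eventually_div_lt_of_div_lt hn hz').mono fun k hk => ?_)
  refine EReal.coe_le_coe_iff.2 (le_trans ?_ hk.le)
  gcongr
  linarith

end OneLevel

/-! ### Weighted values of invariant measures -/

section TowerValue

variable {m : ℕ} {A : Fin (m + 1) → Type*} {a : Fin (m + 1) → ℝ} [∀ i, TopologicalSpace (A i)]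
  {X : (i : Fin (m + 1)) → Subshift (A i) ℕ} {π : (i : Fin m) → A i.castSucc → A i.succ}
  [∀ i, Finite (A i)] {φ : List (A 0) → ℝ≥0} {C : ℝ≥0}
  [∀ i, MeasurableSpace (A i)] [∀ i, DiscreteMeasurableSpace (A i)]
  [∀ i, DiscreteTopology (A i)] {ρ : Measure (ℕ → A 0)}

lemma InvMeasure.push (hπ : IsOneBlockTower X π) (h : InvMeasure (X 0) ρ) (i : Fin (m + 1)) :
    InvMeasure (X i) (push π i ρ) := by
  have := h.isProb
  refine ⟨isProbabilityMeasure_push i, push_compl_carrier hπ h.null_compl i,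
    measurable_leftShift, ?_⟩
  have h1 := push_map_shift (π := π) (η := ρ) i 1
  rw [h.map_iterate] at h1
  exact h1.symm

/-- The weighted value of an invariant measure is bounded by its finite-time versions. -/
lemma InvMeasure.exists_weightedValue_eq (hπ : IsOneBlockTower X π) (ha : ∀ i, 0 ≤ a i)
    (h : InvMeasure (X 0) ρ) (hsub : SubMul (X 0) C φ) (hC : 1 ≤ C)
    (hv : weightedValue X π a φ ρ ≠ ⊥) :
    ∃ v : ℝ, weightedValue X π a φ ρ = v ∧ (∀ n, PosOn (X 0) φ ρ n) ∧
      ∀ n : ℕ, n ≠ 0 → n * v ≤ towerValue X π a φ ρ n + Real.log C := by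
  have := h.isProb
  have hbot : PhiStar φ ρ ≠ ⊥ := by
    intro hb
    rw [weightedValue, hb, EReal.bot_add] at hv
    exact hv rfl
  have hpos := h.posOn_of_phiStar_ne_bot hsub hbot
  have hle := fun n hn => h.phiStar_le hsub hC hpos (n := n) hn
  have htop : PhiStar φ ρ ≠ ⊤ := ((hle 1 one_ne_zero).trans_lt (EReal.coe_lt_top _)).ne
  obtain ⟨L, hL⟩ : ∃ L : ℝ, PhiStar φ ρ = L := ⟨_, (EReal.coe_toReal htop hbot).symm⟩
  refine ⟨L + ∑ i, a i * entropy (X i) (FactorSubshift.push π i ρ), ?_, hpos, fun n hn => ?_⟩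
  · rw [weightedValue, hL, EReal.coe_add]
  · have h1 := hle n hn
    rw [hL, EReal.coe_le_coe_iff, le_div_iff₀ (by exact_mod_cast Nat.pos_of_ne_zero hn)] at h1
    have h2 : (n : ℝ) * ∑ i, a i * entropy (X i) (FactorSubshift.push π i ρ) ≤
        ∑ i, a i * wordEntropy (X i) (FactorSubshift.push π i ρ) n := by
      rw [Finset.mul_sum]
      refine Finset.sum_le_sum fun i _ => ?_
      have := isProbabilityMeasure_push (π := π) (η := ρ) i
      have := mul_le_mul_of_nonneg_left ((h.push hπ i).entropy_spec.2 n) (ha i)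
      linarith
    rw [towerValue, mul_add]
    linarith

end TowerValue

lemma SubMul.mono {A : Type*} [TopologicalSpace A] {X : Subshift A ℕ} {C C' : ℝ≥0}
    {φ : List A → ℝ≥0} (h : SubMul X C φ) (hC : C ≤ C') : SubMul X C' φ :=
  ⟨h.1.trans_le hC, fun I J hIJ => (h.2 I J hIJ).trans (by gcongr)⟩

/-! ### The maximal value and the measures that attain it -/

section Equilibrium

variable {m : ℕ} {A : Fin (m + 1) → Type*} {a : Fin (m + 1) → ℝ} [∀ i, TopologicalSpace (A i)]
  {X : (i : Fin (m + 1)) → Subshift (A i) ℕ} {π : (i : Fin m) → A i.castSucc → A i.succ}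
  [∀ i, Finite (A i)] {φ : List (A 0) → ℝ≥0} {C D : ℝ≥0}

/-- The logarithms of the partition sums grow linearly, up to a bounded error. -/
theorem exists_abs_log_phiTop_sub_le (hZ : ∀ n, phiTop X π a φ n ≠ 0) (hC : 0 < C) (hD : 0 < D)
    (hle : ∀ n k, phiTop X π a φ (n + k) ≤ C * phiTop X π a φ n * phiTop X π a φ k)
    (hge : ∀ n k, phiTop X π a φ n * phiTop X π a φ k ≤ D * phiTop X π a φ (n + k)) (s : ℝ) :
    ∃ P E : ℝ, ∀ n : ℕ, |s * Real.log (phiTop X π a φ n) - n * P| ≤ E := by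
  have hZ' : ∀ n, (phiTop X π a φ n : ℝ) ≠ 0 := fun n => by exact_mod_cast hZ n
  have hC' : (C : ℝ) ≠ 0 := by exact_mod_cast hC.ne'
  have hD' : (D : ℝ) ≠ 0 := by exact_mod_cast hD.ne'
  have hpos : ∀ n, (0 : ℝ) < phiTop X π a φ n := fun n => lt_of_le_of_ne (NNReal.coe_nonneg _) (hZ' n).symm
  refine exists_abs_sub_natCast_mul_le (C := |s| * max (Real.log C) (Real.log D)) fun n k => ?_
  have h1 : Real.log (phiTop X π a φ (n + k)) ≤
      Real.log C + Real.log (phiTop X π a φ n) + Real.log (phiTop X π a φ k) := by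
    rw [← Real.log_mul hC' (hZ' n), ← Real.log_mul (mul_ne_zero hC' (hZ' n)) (hZ' k)]
    exact Real.log_le_log (hpos _) (by exact_mod_cast hle n k)
  have h2 : Real.log (phiTop X π a φ n) + Real.log (phiTop X π a φ k) ≤
      Real.log D + Real.log (phiTop X π a φ (n + k)) := by
    rw [← Real.log_mul hD' (hZ' _), ← Real.log_mul (hZ' n) (hZ' k)]
    exact Real.log_le_log (mul_pos (hpos _) (hpos _)) (by exact_mod_cast hge n k)
  rw [← mul_sub, ← mul_sub, abs_mul]
  refine mul_le_mul_of_nonneg_left (abs_le.2 ⟨?_, ?_⟩) (abs_nonneg _)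
  · have := le_max_right (Real.log C) (Real.log D); linarith
  · have := le_max_left (Real.log C) (Real.log D); linarith

variable [∀ i, MeasurableSpace (A i)] [∀ i, DiscreteMeasurableSpace (A i)]
  [∀ i, DiscreteTopology (A i)] {ρ : Measure (ℕ → A 0)} {P E : ℝ}

/-- The weighted value of an invariant measure is at most the growth rate of the partition sums. -/
theorem InvMeasure.weightedValue_le (h : InvMeasure (X 0) ρ) (hπ : IsOneBlockTower X π)
    (ha0 : 0 < a 0) (ha : ∀ i, 0 ≤ a i) (hsub : SubMul (X 0) C φ) (hC : 1 ≤ C)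
    (hZ : ∀ n, phiTop X π a φ n ≠ 0)
    (hP : ∀ n : ℕ, |psum a (Fin.last m) * Real.log (phiTop X π a φ n) - n * P| ≤ E) :
    weightedValue X π a φ ρ ≤ P := by
  have := h.isProb
  by_cases hv : weightedValue X π a φ ρ = ⊥
  · simp [hv]
  obtain ⟨v, hv, hpos, hle⟩ := h.exists_weightedValue_eq hπ ha hsub hC hv
  rw [hv, EReal.coe_le_coe_iff]
  by_contra! hlt
  -- If `v > P`, the chain `n v ≤ towerValue + log C ≤ s_k log Z n + log C ≤ n P + E + log C` fails
  -- for this `n`.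
  obtain ⟨n, hn⟩ := exists_nat_gt ((E + Real.log C) / (v - P))
  rw [div_lt_iff₀ (sub_pos.2 hlt)] at hn
  have hE : 0 ≤ E := (abs_nonneg _).trans (hP 0)
  have hlog : 0 ≤ Real.log C := Real.log_nonneg (by exact_mod_cast hC)
  have hn0 : n ≠ 0 := by
    rintro rfl
    simp only [Nat.cast_zero, zero_mul] at hn
    linarith
  have h1 := hle n hn0
  obtain ⟨h2, h3, -⟩ := towerValue_bounds hπ ha0 ha h.null_compl (hpos n) (hZ n)
  have h4 := mul_nonneg ha0.le h2
  have h5 := (abs_le.1 (hP n)).2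
  nlinarith

/-- An invariant measure whose weighted value is maximal has bounded relative entropy with respect
to the weight `φ̃`. -/
theorem InvMeasure.exists_wordKL_le_of_weightedValue_eq (h : InvMeasure (X 0) ρ)
    (hπ : IsOneBlockTower X π) (ha0 : 0 < a 0) (ha : ∀ i, 0 ≤ a i) (hsub : SubMul (X 0) C φ)
    (hC : 1 ≤ C) (hZ : ∀ n, phiTop X π a φ n ≠ 0)
    (hP : ∀ n : ℕ, |psum a (Fin.last m) * Real.log (phiTop X π a φ n) - n * P| ≤ E)
    (hv : weightedValue X π a φ ρ = P) :
    (∀ n, PosOn (X 0) φ ρ n) ∧ ∃ K, ∀ n, wordKL (X 0) (phiTilde X π a φ) ρ n ≤ K := by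
  have := h.isProb
  obtain ⟨v, hv', hpos, hle⟩ := h.exists_weightedValue_eq hπ ha hsub hC (by simp [hv])
  obtain rfl : P = v := by rwa [hv, EReal.coe_eq_coe_iff] at hv'
  refine ⟨hpos, max (wordKL (X 0) (phiTilde X π a φ) ρ 0) ((E + Real.log C) / a 0), fun n => ?_⟩
  rcases eq_or_ne n 0 with rfl | hn
  · exact le_max_left _ _
  · refine le_max_of_le_right ((le_div_iff₀ ha0).2 ?_)
    have h1 := hle n hn
    obtain ⟨-, h3, -⟩ := towerValue_bounds hπ ha0 ha h.null_compl (hpos n) (hZ n)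
    have h5 := (abs_le.1 (hP n)).2
    linarith

/-- An invariant measure with bounded relative entropy with respect to the weight `φ̃` has maximal
weighted value, and its word averages and word entropies grow linearly up to a bounded error. -/
theorem InvMeasure.exists_phiStar_eq_of_wordKL_le (h : InvMeasure (X 0) ρ)
    (hπ : IsOneBlockTower X π) (ha0 : 0 < a 0) (ha : ∀ i, 0 ≤ a i) (hsub : SubMul (X 0) C φ)
    (hZ : ∀ n, phiTop X π a φ n ≠ 0)
    (hP : ∀ n : ℕ, |psum a (Fin.last m) * Real.log (phiTop X π a φ n) - n * P| ≤ E)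
    (hpos : ∀ n, PosOn (X 0) φ ρ n) {K : ℝ}
    (hK : ∀ n, wordKL (X 0) (phiTilde X π a φ) ρ n ≤ K) :
    weightedValue X π a φ ρ = P ∧
    (∃ K', ∀ n : ℕ, |wordEntropy (X 0) ρ n - n * entropy (X 0) ρ| ≤ K') ∧
    ∃ L : ℝ, PhiStar φ ρ = L ∧
      ∃ K', ∀ n : ℕ, |wordMean (X 0) ρ n (fun I => Real.log (φ I)) - n * L| ≤ K' := by
  have := h.isProb
  have hs := psum_pos ha0 ha (Fin.last m)
  have hspec : ∀ i, Tendsto (fun n : ℕ => wordEntropy (X i) (FactorSubshift.push π i ρ) n / n) atTop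
      (nhds (entropy (X i) (FactorSubshift.push π i ρ))) ∧
      ∀ n : ℕ, n * entropy (X i) (FactorSubshift.push π i ρ) ≤
        wordEntropy (X i) (FactorSubshift.push π i ρ) n := fun i => by
    have := (h.push hπ i).isProb
    exact (h.push hπ i).entropy_spec
  obtain ⟨L, hL, htend, hE, hH⟩ := almost_linear_of_sum ha (fun i => (hspec i).1)
    (fun i => (hspec i).2) (E := fun n => wordMean (X 0) ρ n fun I => Real.log (φ I))
    (c := Real.log C) (fun n k => by
      have := wordMean_log_add_le hsub h.null_compl (hpos (n + k))
      rwa [h.map_iterate] at this)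
    -- The defect lies between `0` and `s_k K`, so the finite-time value is almost linear with the
    -- slope `P`.
    (P := P) (D := E + psum a (Fin.last m) * K) (fun n => by
      obtain ⟨h2, h3, h4⟩ := towerValue_bounds hπ ha0 ha h.null_compl (hpos n) (hZ n)
      have h5 := mul_nonneg ha0.le h2
      have h6 := mul_le_mul_of_nonneg_left (hK n) hs.le
      have h7 := abs_le.1 (hP n)
      have h8 := mul_nonneg hs.le h2
      unfold towerValue at h3 h4
      exact abs_le.2 ⟨by linarith, by linarith⟩)
  have hstar : PhiStar φ ρ = L := phiStar_eq_of_tendsto h.null_compl hpos htend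
  refine ⟨?_, ?_, L, hstar, hE⟩
  · rw [weightedValue, hstar, ← EReal.coe_add, hL]
  -- The entropy of the first level can be isolated because its coefficient `a 0` is positive.
  · obtain ⟨K', hK'⟩ := hH 0 ha0
    refine ⟨K', fun n => ?_⟩
    have := hK' n
    rwa [push_zero] at this

end Equilibrium

end FactorSubshift

end

/-! ### The theorem -/

open FactorSubshift in
theorem theorem7p1 {m : ℕ} (hm : 1 ≤ m) {A : Fin (m + 1) → Type*}
    [∀ i, Finite (A i)] [∀ i, TopologicalSpace (A i)] [∀ i, DiscreteTopology (A i)]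
    [∀ i, MeasurableSpace (A i)] [∀ i, DiscreteMeasurableSpace (A i)]
    (X : (i : Fin (m + 1)) → Subshift (A i) ℕ)
    (π : (i : Fin m) → A i.castSucc → A i.succ)
    (hπ : FactorSubshift.IsOneBlockTower X π)
    (a : Fin (m + 1) → ℝ) (ha0 : 0 < a 0) (ha : ∀ i, 0 ≤ a i)
    (p : ℕ) (φ : List (A 0) → ℝ≥0) (hφ : FactorSubshift.MemDw (X 0) p φ) :
    ∃ μ : Measure (ℕ → A 0),
      -- existence and uniqueness
      FactorSubshift.IsWeightedEquilibrium X π a φ μ ∧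
      (∀ ν, FactorSubshift.IsWeightedEquilibrium X π a φ ν → ν = μ) ∧
      Ergodic FactorSubshift.leftShift μ ∧
      -- (i) the measure of cylinders
      (∃ C : ℝ≥0, 0 < C ∧ ∀ I ∈ FactorSubshift.lang (X 0),
        FactorSubshift.starSup (X 0) (FactorSubshift.phiTilde X π a φ) I ≤
          C * μ (FactorSubshift.cyl I) ∧
        μ (FactorSubshift.cyl I) ≤
          C * FactorSubshift.starSup (X 0) (FactorSubshift.phiTilde X π a φ) I) ∧
      (∃ c : ℝ≥0, 0 < c ∧ ∀ I ∈ FactorSubshift.lang (X 0),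
        (c * FactorSubshift.phiTilde X π a φ I : ℝ≥0∞) ≤
          FactorSubshift.starSup (X 0) (FactorSubshift.phiTilde X π a φ) I) ∧
      -- (ii) the lower bound of weak mixing type
      (∃ c : ℝ≥0, 0 < c ∧ ∀ B D : Set (ℕ → A 0), MeasurableSet B → MeasurableSet D →
        B ⊆ (X 0).carrier → D ⊆ (X 0).carrier →
        c * μ B * μ D ≤ liminf (fun n : ℕ =>
          ∑ i ∈ Finset.range (p + 1), μ (B ∩ FactorSubshift.leftShift^[n + i] ⁻¹' D)) atTop) ∧
      -- (iii) the estimates; the first clause says that all logarithms in them are finite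
      (∀ I ∈ FactorSubshift.lang (X 0), μ (FactorSubshift.cyl I) ≠ 0 →
        0 < φ I ∧ 0 < FactorSubshift.phiTilde X π a φ I) ∧
      (∃ C : ℝ, ∀ n : ℕ,
        |∑ I ∈ FactorSubshift.langN (X 0) n,
            μ.real (FactorSubshift.cyl I) * Real.log (μ.real (FactorSubshift.cyl I)) -
          ∑ I ∈ FactorSubshift.langN (X 0) n,
            μ.real (FactorSubshift.cyl I) * Real.log (FactorSubshift.phiTilde X π a φ I)| ≤ C) ∧
      (∃ C : ℝ, ∀ n : ℕ,
        |∑ I ∈ FactorSubshift.langN (X 0) n,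
            μ.real (FactorSubshift.cyl I) * Real.log (μ.real (FactorSubshift.cyl I)) -
          -(n * FactorSubshift.entropy (X 0) μ)| ≤ C) ∧
      (∃ L : ℝ, FactorSubshift.PhiStar φ μ = (L : EReal) ∧ ∃ C : ℝ, ∀ n : ℕ,
        |∑ I ∈ FactorSubshift.langN (X 0) n,
            μ.real (FactorSubshift.cyl I) * Real.log (φ I) - n * L| ≤ C) ∧
      -- (iv) the lower bound of mixing type
      (FactorSubshift.MemD (X 0) p φ →
        ∃ c : ℝ≥0, 0 < c ∧ ∀ B D : Set (ℕ → A 0), MeasurableSet B → MeasurableSet D →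
          B ⊆ (X 0).carrier → D ⊆ (X 0).carrier →
          c * μ B * μ D ≤ liminf (fun n : ℕ =>
            μ (B ∩ FactorSubshift.leftShift^[n] ⁻¹' D)) atTop) := by
  obtain ⟨C₁, hsub₁⟩ := hφ.exists_subMul
  obtain ⟨C, hC, hsub⟩ : ∃ C, 1 ≤ C ∧ SubMul (X 0) C φ :=
    ⟨max C₁ 1, le_max_right _ _, hsub₁.mono (le_max_left _ _)⟩
  obtain ⟨c, hcon⟩ := hφ.exists_connects
  obtain ⟨J, hJ, hJne, hJ0⟩ := hφ.1
  have hX := hφ.carrier_nonempty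
  obtain ⟨d, hext⟩ := exists_extendable hsub hcon hJ hJne hJ0.ne'
  have hnil := hsub.nil_ne_zero hJ hJ0.ne'
  have hZ := phiTop_ne_zero hπ ha0 ha (hext.exists_langN_ne_zero hnil)
  obtain ⟨cs, hscon⟩ := exists_stoppedWeight_connect hπ ha0 ha hsub hcon
  obtain ⟨ds, hsext⟩ := exists_stoppedWeight_extendable hπ ha0 ha hsub hext hnil
  obtain ⟨ct, htcon⟩ := connects_phiTilde ha0 ha hsub hZ hscon
  obtain ⟨dt, htext⟩ := extendable_phiTilde ha0 ha hsub hZ hsext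
  obtain ⟨CZ, hCZ, hZle⟩ := exists_phiTop_add_le (X := X) (π := π) ha0 ha hsub
  obtain ⟨DZ, hDZ, hZge⟩ := exists_phiTop_mul_le hπ ha0 ha hX hsub hZ hscon
  obtain ⟨P, E, hP⟩ := exists_abs_log_phiTop_sub_le hZ hCZ hDZ hZle hZge (psum a (Fin.last m))
  have h1 : ∀ n, ∑ W ∈ langN (X 0) n, phiTilde X π a φ W = 1 :=
    fun n => sum_phiTilde hπ ha0 ha (hZ n)
  obtain ⟨pt, hpt⟩ := exists_isSelection hX
  obtain ⟨μ, hprob, hnull, hμ⟩ := exists_isWordLimit hpt h1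
  have hinv := hμ.measurePreserving h1
  have hμinv : InvMeasure (X 0) μ := ⟨hprob, hnull, hinv⟩
  have hSp : ∀ k ∈ Finset.range (p + 1), k ≤ p :=
    fun k hk => Nat.lt_succ_iff.1 (Finset.mem_range.1 hk)
  obtain ⟨e, he, hmix⟩ := hμ.exists_mixing_detBy hpt h1 htcon htext hSp
  have hmix' := fun B D hB hD => mixing_of_detBy hinv hmix (B := B) (D := D) hB hD
  have herg := ergodic_of_mixing hinv he hmix'
  obtain ⟨G, hG, hGle⟩ := hμ.exists_wordMeasure_le hpt h1 htcon htext hSp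
  have hstar := starSup_le_of_wordMeasure_le hpt hGle
  obtain ⟨K, hK⟩ := exists_wordKL_wordMeasure_le hπ ha0 ha hsub hZ hDZ hZge hpt
  have hKL : ∀ n, wordKL (X 0) (phiTilde X π a φ) μ n ≤ K := fun n => hμ.wordKL_le h1 (hK n)
  have hiff : ∀ I ∈ lang (X 0), (phiTilde X π a φ I ≠ 0 ↔ φ I ≠ 0) :=
    fun I hI => phiTilde_ne_zero_iff hπ ha0 ha hZ hI
  have hpos := hμ.posOn hpt h1 (fun I hI => (hiff I hI).1) hsub
  obtain ⟨hval, ⟨K₁, hK₁⟩, L, hL, K₂, hK₂⟩ :=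
    hμinv.exists_phiStar_eq_of_wordKL_le hπ ha0 ha hsub hZ hP hpos hKL
  -- The growth rate `P` bounds all weighted values and `μ` attains it.
  have hsup : ⨆ (η : Measure (ℕ → A 0)) (_ : InvMeasure (X 0) η), weightedValue X π a φ η = P :=
    le_antisymm (iSup₂_le fun η hη => hη.weightedValue_le hπ ha0 ha hsub hC hZ hP)
      (hval ▸ le_iSup₂ (f := fun (η : Measure (ℕ → A 0)) (_ : InvMeasure (X 0) η) =>
        weightedValue X π a φ η) μ hμinv)
  have hKL0 : ∀ n, 0 ≤ wordKL (X 0) (phiTilde X π a φ) μ n := fun n =>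
    (towerValue_bounds hπ ha0 ha hnull (hpos n) (hZ n)).1
  have hsum : ∀ n, wordMean (X 0) μ n (fun I => Real.log (μ.real (cyl I))) =
      -wordEntropy (X 0) μ n := fun n => (neg_neg _).symm
  refine ⟨μ, ⟨hμinv, hval.trans hsup.symm⟩, ?_, herg, ⟨max G 1, lt_max_of_lt_left hG, ?_⟩,
    ⟨1, one_pos, fun I hI => ?_⟩, ⟨e, he, fun B D hB hD _ _ => hmix' B D hB hD⟩, ?_,
    ⟨K, fun n => ?_⟩, ⟨K₁, fun n => ?_⟩, ⟨L, hL, K₂, hK₂⟩, ?_⟩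
  · rintro ν ⟨hν, hνeq⟩
    have := hν.isProb
    obtain ⟨hνpos, K', hK'⟩ := hν.exists_wordKL_le_of_weightedValue_eq hπ ha0 ha hsub hC hZ hP
      (hνeq.trans hsup)
    -- An invariant probability measure absolutely continuous with respect to an ergodic one equals
    -- it. The domination needed is `phiTilde ≤ phiTilde* ≤ G μ` on cylinders.
    refine herg.eq_of_absolutelyContinuous hν.invariant
      (absolutelyContinuous_of_wordKL_le hν.null_compl hnull h1
        (fun n I hI hI0 => (hiff I (mem_langN.1 hI).1).2 (hνpos n I hI hI0)) G.coe_nonneg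
        (fun I hI => ?_) hK')
    have h := ENNReal.toReal_mono (by finiteness) ((le_starSup hI).trans (hstar I))
    simpa [measureReal_def] using h
  · refine fun I _ => ⟨(hstar I).trans ?_, (hμ.cyl_le_starSup hpt I).trans ?_⟩
    · gcongr
      exact le_max_left _ _
    · refine le_mul_of_one_le_left zero_le ?_
      exact_mod_cast le_max_right G 1
  · simpa using le_starSup hI
  · intro I hI hI0
    have h := hpos I.length I (mem_langN.2 ⟨hI, rfl⟩) 
      (by simpa [measureReal_def, ENNReal.toReal_eq_zero_iff] using hI0)
    exact ⟨pos_iff_ne_zero.2 h, pos_iff_ne_zero.2 ((hiff I hI).2 h)⟩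
  · have h := wordMean_sub (X := X 0) (ρ := μ) n (fun I => Real.log (μ.real (cyl I)))
      (fun I => Real.log (phiTilde X π a φ I))
    change |wordMean (X 0) μ n _ - wordMean (X 0) μ n _| ≤ K
    rw [← h]
    exact abs_le.2 ⟨by have := hKL0 n; have := hKL n; unfold wordKL at *; linarith, hKL n⟩
  · have h := hK₁ n
    change |wordMean (X 0) μ n _ - _| ≤ K₁
    rwa [hsum, neg_sub_neg, abs_sub_comm]
  · intro hφ'
    -- The limit measure does not depend on the set of connecting lengths, so the mixing bound can
    -- be rerun for the same `μ` with the single length `p`; the extension property is kept.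
    obtain ⟨c', hcon'⟩ := hφ'.exists_connects
    obtain ⟨cs', hscon'⟩ := exists_stoppedWeight_connect hπ ha0 ha hsub hcon'
    obtain ⟨ct', htcon'⟩ := connects_phiTilde ha0 ha hsub hZ hscon'
    obtain ⟨e', he', hmix₁⟩ := hμ.exists_mixing_detBy hpt h1 htcon' htext
      (fun k hk => (Finset.mem_singleton.1 hk).le)
    refine ⟨e', he', fun B D hB hD _ _ => ?_⟩
    have h := mixing_of_detBy hinv hmix₁ hB hD
    simp only [Finset.sum_singleton] at h
    -- The fixed delay `p` does not affect the lower limit.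
    rwa [liminf_nat_add (fun n => μ (B ∩ leftShift^[n] ⁻¹' D)) p] at h
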